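/- Let $(M,\mu)$ be a $\sigma$-finite measure space, $\tau(f)=\int_M f\,d\mu$, and let $(T_t)_{t\ge 0}$ be a standard semigroup: a semigroup of linear operators, $T_0=\mathrm{id}$, acting compatibly on all complex spaces $L^p=L^p(M,\mu)$, $1\le p\le\infty$, which are contractions on every $L^p$, symmetric (self-adjoint on $L^2$, and on $L^\infty$ the adjoint of $T_t$ on $L^1$), with $T_t1=1$ and $T_tf\to f$ in $L^2$ as $t\to0^+$ for $f\in L^2$. Let $L=\lim_{t\to0^+}(T_t-\mathrm{id})/t$ be its generator and $$2\Gamma(f,g)=L(f^*g)-L(f^*)g-f^*L(g),\qquad \Gamma(f)=\Gamma(f,f),$$ the gradient form, where $f^*$ is the complex conjugate, $f,g$ are in the domain of the generator on $L^2$, and $L(f^*g)$ is taken in $L^1$. Assume that there is a weak-$*$ dense $*$-subalgebra $\mathcal A$ of $L^\infty$, contained in the domain of the generator on $L^2$, with $T_t\mathcal A\subset\mathcal A$ for all $t\ge 0$, and that $\Gamma_2\ge0$ on $\mathcal A$, i.e. $\Gamma(T_vf)\le T_v\Gamma(f)$ almost everywhere for all $v>0$, $f\in\mathcal A$. For $g\in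 L^2$ put $$\|g\|_{bmo(\mathcal T)}=\sup_{t>0}\big\|T_t|g|^2-|T_tg|^2\big\|_\infty^{1/2}\in[0,\infty].$$ For $f\in L^1$ or $f\in L^2$ such that $T_sf\in L^2$ for all $s>0$ and such that $f$ has no component in $\ker L$, i.e. $T_tf\to0$ in $L^2$ as $t\to\infty$, put $$\|f\|_{H_1^S}=\Big\|\Big(\int_0^\infty T_s\Gamma(T_sf)\,ds\Big)^{1/2}\Big\|_1,\qquad \|f\|_{H_1^G}=\Big\|\Big(\int_0^\infty\Gamma(T_sf)\,ds\Big)^{1/2}\Big\|_1 ,$$ and let $H_1^S(\mathcal T)$ be the space of all such $f\in L^1$ with $\|f\|_{H_1^S}<\infty$. Then, with absolute constants $c_1,c_2$ (independent of $M,\mu,(T_t),\mathcal A$): (1) for all such $f$ and all $g\in L^2$ with $fg$ integrable, $$|\tau(fg)|\le c_1\|f\|_{H_1^S}^{1/2}\|f\|_{H_1^G}^{1/2}\|g\|_{bmo(\mathcal T)}\le c_2\|f\|_{H_1^S}\|g\|_{bmo(\mathcal T)} ;$$ (2) $bmo(\mathcal T)\subset (H_1^S(\mathcal T))^*$: for every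 $g\in L^2$ with $\|g\|_{bmo(\mathcal T)}<\infty$ there is a linear functional $\ell$ on $H_1^S(\mathcal T)$ with $\ell(f)=\tau(fg)$ whenever $f\in H_1^S(\mathcal T)$ and $fg$ is integrable, and $|\ell(f)|\le c_2\|f\|_{H_1^S}\|g\|_{bmo(\mathcal T)}$ for all $f\in H_1^S(\mathcal T)$. -/

import Mathlib

open MeasureTheory Filter Topology
open scoped ENNReal NNReal

noncomputable section

/-- A standard semigroup of operators on a measure space: one family `T_t` (`t ≥ 0`) of linear
operators acting compatibly on all the complex spaces `L^p`, `1 ≤ p ≤ ∞`. Only the values at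
times `t ≥ 0` are constrained (and used). -/
structure StandardSemigroup {M : Type*} [MeasurableSpace M] (μ : Measure M) where
  /-- the operator `T_t` on `L^p` -/
  op : (p : ℝ≥0∞) → [Fact (1 ≤ p)] → ℝ → (Lp ℂ p μ →L[ℂ] Lp ℂ p μ)
  /-- the operators on the different `L^p` are restrictions of one and the same operator -/
  compat : ∀ (p q : ℝ≥0∞) [Fact (1 ≤ p)] [Fact (1 ≤ q)] (t : ℝ), 0 ≤ t →
    ∀ (f : Lp ℂ p μ) (g : Lp ℂ q μ), f =ᵐ[μ] g → op p t f =ᵐ[μ] op q t g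
  op_zero : ∀ (p : ℝ≥0∞) [Fact (1 ≤ p)] (f : Lp ℂ p μ), op p 0 f = f
  op_add : ∀ (p : ℝ≥0∞) [Fact (1 ≤ p)] (s t : ℝ), 0 ≤ s → 0 ≤ t →
    ∀ f : Lp ℂ p μ, op p (s + t) f = op p s (op p t f)
  /-- contractions on every `L^p` -/
  contraction : ∀ (p : ℝ≥0∞) [Fact (1 ≤ p)] (t : ℝ), 0 ≤ t →
    ∀ f : Lp ℂ p μ, ‖op p t f‖ ≤ ‖f‖
  /-- symmetry on `L^2` -/
  symm : ∀ t : ℝ, 0 ≤ t → ∀ f g : Lp ℂ 2 μ, inner ℂ (op 2 t f) g = inner ℂ f (op 2 t g)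
  /-- symmetry on the dual pair `(L^1, L^∞)`: the operator on `L^∞` is the adjoint of the one on
  `L^1`, as usual -/
  symm_one_top : ∀ t : ℝ, 0 ≤ t → ∀ (f : Lp ℂ 1 μ) (g : Lp ℂ ∞ μ),
    ∫ x, star (op ∞ t g x) * f x ∂μ = ∫ x, star (g x) * op 1 t f x ∂μ
  /-- `T_t 1 = 1` -/
  op_one : ∀ t : ℝ, 0 ≤ t → op ∞ t ((memLp_top_const (1 : ℂ)).toLp (fun _ => (1 : ℂ))) =
    (memLp_top_const (1 : ℂ)).toLp (fun _ => (1 : ℂ))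
  /-- strong continuity at `0` on `L^2` -/
  continuous_zero : ∀ f : Lp ℂ 2 μ, Tendsto (fun t : ℝ => op 2 t f) (𝓝[>] 0) (𝓝 f)

namespace StandardSemigroup

variable {M : Type*} [MeasurableSpace M] {μ : Measure M} (T : StandardSemigroup μ)

/-- `f` belongs to the domain of the `L^p`-generator `L = lim (T_t - id) / t` and `L f = h`. -/
def IsGenerator (p : ℝ≥0∞) [Fact (1 ≤ p)] (f h : Lp ℂ p μ) : Prop :=
  Tendsto (fun t : ℝ => ((t : ℂ)⁻¹) • (T.op p t f - f)) (𝓝[>] 0) (𝓝 h)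

/-- Membership in the domain `D(L)` of the `L^p`-generator. -/
def InDomain (p : ℝ≥0∞) [Fact (1 ≤ p)] (f : Lp ℂ p μ) : Prop :=
  ∃ h, T.IsGenerator p f h

open Classical in
/-- The `L^p`-generator, extended by `0` off its domain. -/
def gen (p : ℝ≥0∞) [Fact (1 ≤ p)] (f : Lp ℂ p μ) : Lp ℂ p μ :=
  if h : T.InDomain p f then h.choose else 0

/-- Meyer's gradient form `2 Γ(f,g) = L(f^* g) - L(f^*) g - f^* L(g)`. The factors `f`, `g` lie in
`L^2`, where the generator is taken in `L^2`; the product `f^* g` lies in `L^1`, where the generator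
is taken in `L^1`. -/
def Gam (f g : Lp ℂ 2 μ) : Lp ℂ 1 μ :=
  (2⁻¹ : ℂ) • (T.gen 1 (star f • g : Lp ℂ 1 μ) - (T.gen 2 (star f) • g : Lp ℂ 1 μ)
    - (star f • T.gen 2 g : Lp ℂ 1 μ))

/-- The weak-* topology `σ(L^∞, L^1)` on `L^∞`. -/
@[reducible]
def weakStarTopology (μ : Measure M) : TopologicalSpace (Lp ℂ ∞ μ) :=
  TopologicalSpace.induced (fun (a : Lp ℂ ∞ μ) (k : Lp ℂ 1 μ) => ∫ x, k x * a x ∂μ)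
    Pi.topologicalSpace

/-- `A` is a `*`-subalgebra of `L^∞` (not necessarily unital), weak-* dense in `L^∞`, invariant
under the semigroup, and contained in the domain of the `L^2`-generator. -/
structure IsAdmissibleAlgebra (A : Submodule ℂ (Lp ℂ ∞ μ)) : Prop where
  star_mem : ∀ a ∈ A, star a ∈ A
  mul_mem : ∀ a ∈ A, ∀ b ∈ A, (a • b : Lp ℂ ∞ μ) ∈ A
  dense : @Dense (Lp ℂ ∞ μ) (weakStarTopology μ) (A : Set (Lp ℂ ∞ μ))
  op_mem : ∀ t : ℝ, 0 ≤ t → ∀ a ∈ A, T.op ∞ t a ∈ A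
  domain : ∀ a ∈ A, ∃ f : Lp ℂ 2 μ, f =ᵐ[μ] a ∧ T.InDomain 2 f

/-- The condition `Γ₂ ≥ 0` on `A`: `Γ(T_v f) ≤ T_v Γ(f)` a.e. for all `v > 0` and `f ∈ A`.
(Both sides are real.) -/
def Gam2Nonneg (A : Submodule ℂ (Lp ℂ ∞ μ)) : Prop :=
  ∀ v : ℝ, 0 < v → ∀ f : Lp ℂ 2 μ, (∃ a ∈ A, f =ᵐ[μ] a) →
    ∀ᵐ x ∂μ, (T.Gam (T.op 2 v f) (T.op 2 v f) x).re ≤ (T.op 1 v (T.Gam f f) x).re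

open Classical in
/-- `T_s f` as an element of `L^2`, for `f ∈ L^p` with `T_s f ∈ L^2` (and `0` otherwise). -/
def flow (p : ℝ≥0∞) [Fact (1 ≤ p)] (f : Lp ℂ p μ) (s : ℝ) : Lp ℂ 2 μ :=
  if h : MemLp (T.op p s f) 2 μ then h.toLp (T.op p s f) else 0

/-- The functions `f ∈ L^p` for which `Γ(T_s f)` makes sense for all `s > 0` (that is,
`T_s f ∈ L^2`, hence `T_s f ∈ D(L)`, for all `s > 0`) and which have no component in `ker L`
(that is, `T_t f → 0` in `L^2` as `t → ∞`). -/
def SquareDomain (p : ℝ≥0∞) [Fact (1 ≤ p)] (f : Lp ℂ p μ) : Prop :=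
  (∀ s : ℝ, 0 < s → MemLp (T.op p s f) 2 μ) ∧ Tendsto (T.flow p f) atTop (𝓝 0)

/-- `∫_0^∞ F_s ds` for a curve `F` of nonnegative functions in `L^1`: the increasing limit, with
values in `[0, ∞]`, of the Bochner integrals in `L^1` over `[1/(n+1), n+1]`. -/
def timeIntegral (F : ℝ → Lp ℂ 1 μ) (x : M) : ℝ≥0∞ :=
  ⨆ n : ℕ, ENNReal.ofReal
    ((∫ s in (1 / ((n : ℝ) + 1))..((n : ℝ) + 1), F s : Lp ℂ 1 μ) x).re

/-- The area function `S_Γ(f) = (∫_0^∞ T_s Γ(T_s f) ds)^{1/2}`. -/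
def areaFun (p : ℝ≥0∞) [Fact (1 ≤ p)] (f : Lp ℂ p μ) (x : M) : ℝ≥0∞ :=
  timeIntegral (fun s => T.op 1 s (T.Gam (T.flow p f s) (T.flow p f s))) x ^ (1 / 2 : ℝ)

/-- The Littlewood-Paley function `G_Γ(f) = (∫_0^∞ Γ(T_s f) ds)^{1/2}`. -/
def littlewoodPaleyFun (p : ℝ≥0∞) [Fact (1 ≤ p)] (f : Lp ℂ p μ) (x : M) : ℝ≥0∞ :=
  timeIntegral (fun s => T.Gam (T.flow p f s) (T.flow p f s)) x ^ (1 / 2 : ℝ)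

/-- `‖f‖_{H_1^S} = ‖S_Γ(f)‖_1`. -/
def hardySNorm (p : ℝ≥0∞) [Fact (1 ≤ p)] (f : Lp ℂ p μ) : ℝ≥0∞ :=
  ∫⁻ x, T.areaFun p f x ∂μ

/-- `‖f‖_{H_1^G} = ‖G_Γ(f)‖_1`. -/
def hardyGNorm (p : ℝ≥0∞) [Fact (1 ≤ p)] (f : Lp ℂ p μ) : ℝ≥0∞ :=
  ∫⁻ x, T.littlewoodPaleyFun p f x ∂μ

/-- `‖g‖_{bmo} = sup_{t > 0} ‖T_t |g|² - |T_t g|²‖_∞^{1/2}`. -/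
def bmoNorm (g : Lp ℂ 2 μ) : ℝ≥0∞ :=
  ⨆ (t : ℝ) (_ : 0 < t),
    eLpNorm ((T.op 1 t (star g • g : Lp ℂ 1 μ)
      - (star (T.op 2 t g) • T.op 2 t g : Lp ℂ 1 μ) : Lp ℂ 1 μ)) ∞ μ ^ (1 / 2 : ℝ)

/-- The space `H_1^S` of all `f ∈ L^1` with `‖f‖_{H_1^S} < ∞`. The spanning set is itself a linear
subspace under the hypotheses of the theorem; the span only serves to carry the vector space
structure. -/
def hardyS : Submodule ℂ (Lp ℂ 1 μ) :=
  Submodule.span ℂ {f | T.SquareDomain 1 f ∧ T.hardySNorm 1 f < ∞}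

end StandardSemigroup

end

/-! The argument follows the Fefferman–Stein proof of H¹–BMO duality. Put u_s = (T_s f)^* and w_s =
T_s g. Then ⟨u_s, w_s⟩ = τ(T_{2s}f · g) goes to 0 as s → ∞ and, for suitable g, to τ(fg) as s → 0.
Formally its derivative is -2τ(Γ(u_s, w_s)), so for every positive weight φ_s, Cauchy–Schwarz bounds
the derivative by ∫ φ_s⁻¹ Γ(u_s) + ∫ φ_s Γ(w_s). The weight is φ_s = σ_s^{1/2}, where σ_s = ∫_s^N
T_{v-s} Γ(u_v) dv is an area integral started at s.

For the first term, the curvature condition gives γ_s = ∫_s^N Γ(u_v) dv ≤ 2σ_s. Since Γ(u_s) =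
-dγ_s/ds, the time integral of φ_s⁻¹ Γ(u_s) telescopes to at most 2√2 γ_ε^{1/2}, whose integral is
controlled by the H_1^G norm (`sum_div_min_sqrt_le`, `gamma_le_areaIntegral`). For the second term,
T_δ φ_{s+δ} ≤ φ_s, while U_s = ∫ T_{s-v} Γ(w_v) dv is at most half of T_s|g|² - |T_s g|², hence
bounded by ‖g‖²_{bmo}/2. Summation by parts then leaves ‖g‖²_{bmo}/2 times τ(φ_ε), and τ(φ_ε) is at
most the H_1^S norm because ∫√h ≤ ∫√(T_t h) (`sum_weight_gamma_le`, `lintegral_sqrt_le_P`). Scaling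
the weight by a constant and optimising gives the product of square roots.

Differentiability is obtained from the variance T_t|f|² - |T_t f|², a nonnegative quadratic form
whose quotient by t tends to 2Γ(f). Symmetry of T_t on L² gives ‖T_h T_s f - T_s f‖ ≤ (h/s)‖f‖,
which makes these quotients locally Lipschitz in x at T_s x, uniformly in t. Existence of Γ and the
curvature condition thus pass by density from the algebra to the range of T_s, s > 0. The weights
are frozen on the cells of a grid, truncated above by R and shifted by η; both parameters are
removed at the end.

If f is only in L¹, g is truncated radially, which does not increase its variances
(`varL_retract_le`). The functional of the second assertion is a limit of truncated pairings along
an ultrafilter. -/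

noncomputable section

namespace StandardSemigroup

variable {M : Type*} [MeasurableSpace M] {μ : Measure M}

/-! ### Real and complex `L^1` -/

instance isOrderedModule_L1 : IsOrderedModule ℝ (Lp ℝ 1 μ) :=
  IsOrderedModule.of_smul_nonneg fun c hc F hF => by
    rw [← Lp.coeFn_nonneg] at hF ⊢
    filter_upwards [hF, Lp.coeFn_smul c F] with x hx hs
    rw [hs]
    exact mul_nonneg hc hx

/-- The real part, from complex to real `L^1`. -/
def reL : Lp ℂ 1 μ →L[ℝ] Lp ℝ 1 μ := Complex.reCLM.compLpL 1 μ

/-- The inclusion of real into complex `L^1`. -/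
def ofL : Lp ℝ 1 μ →L[ℝ] Lp ℂ 1 μ := Complex.ofRealCLM.compLpL 1 μ

lemma coeFn_reL (G : Lp ℂ 1 μ) : reL G =ᵐ[μ] fun x => (G x).re :=
  Complex.reCLM.coeFn_compLpL G

lemma coeFn_ofL (F : Lp ℝ 1 μ) : ofL F =ᵐ[μ] fun x => (F x : ℂ) :=
  Complex.ofRealCLM.coeFn_compLpL F

lemma reL_ofL (F : Lp ℝ 1 μ) : reL (ofL F) = F := by
  apply Lp.ext
  filter_upwards [coeFn_reL (ofL F), coeFn_ofL F] with x h1 h2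
  rw [h1, h2, Complex.ofReal_re]

lemma norm_ofL (F : Lp ℝ 1 μ) : ‖ofL F‖ = ‖F‖ := by
  rw [L1.norm_eq_integral_norm, L1.norm_eq_integral_norm]
  apply integral_congr_ae
  filter_upwards [coeFn_ofL F] with x h
  rw [h, Complex.norm_real]

lemma norm_reL_le (G : Lp ℂ 1 μ) : ‖reL G‖ ≤ ‖G‖ := by
  rw [L1.norm_eq_integral_norm, L1.norm_eq_integral_norm]
  apply integral_mono_ae (L1.integrable_coeFn _).norm (L1.integrable_coeFn _).norm
  filter_upwards [coeFn_reL G] with x h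
  rw [h]
  exact Complex.abs_re_le_norm _

lemma ofL_decomposition (G : Lp ℂ 1 μ) :
    G = ofL (reL G) + Complex.I • ofL (reL ((-Complex.I) • G)) := by
  apply Lp.ext
  filter_upwards [coeFn_reL G, coeFn_ofL (reL G), coeFn_reL ((-Complex.I) • G),
    coeFn_ofL (reL ((-Complex.I) • G)), Lp.coeFn_smul (-Complex.I) G,
    Lp.coeFn_smul Complex.I (ofL (reL ((-Complex.I) • G))),
    Lp.coeFn_add (ofL (reL G)) (Complex.I • ofL (reL ((-Complex.I) • G)))] with x h1 h2 h3 h4 h5 h6 h7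
  rw [h7, Pi.add_apply, h6, Pi.smul_apply, h4, h3, h5, h2, h1, Pi.smul_apply]
  apply Complex.ext <;> simp

/-- The integral as a functional on real `L^1`. -/
def tau : Lp ℝ 1 μ →L[ℝ] ℝ := L1.integralCLM

lemma tau_apply (F : Lp ℝ 1 μ) : tau F = ∫ x, F x ∂μ := by
  rw [← L1.integral_eq_integral, L1.integral_eq]; rfl

lemma tau_nonneg {F : Lp ℝ 1 μ} (hF : 0 ≤ F) : 0 ≤ tau F := by
  rw [tau_apply]
  exact integral_nonneg_of_ae ((Lp.coeFn_nonneg F).2 hF)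

lemma norm_eq_tau {F : Lp ℝ 1 μ} (hF : 0 ≤ F) : ‖F‖ = tau F := by
  rw [L1.norm_eq_integral_norm, tau_apply]
  apply integral_congr_ae
  filter_upwards [(Lp.coeFn_nonneg F).2 hF] with x h
  exact Real.norm_of_nonneg h

/-- Integration against a bounded function, as a functional on real `L^1`. -/
def pairL (w : Lp ℝ ∞ μ) : Lp ℝ 1 μ →L[ℝ] ℝ := (ContinuousLinearMap.mul ℝ ℝ).lpPairing μ ∞ 1 w

lemma pairL_apply (w : Lp ℝ ∞ μ) (F : Lp ℝ 1 μ) : pairL w F = ∫ x, w x * F x ∂μ :=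
  (ContinuousLinearMap.mul ℝ ℝ).lpPairing_eq_integral w F

lemma integrable_mul_top (w : Lp ℝ ∞ μ) (F : Lp ℝ 1 μ) : Integrable (fun x => w x * F x) μ :=
  Integrable.mul_of_top_right (L1.integrable_coeFn F) (Lp.memLp w)

variable (T : StandardSemigroup μ)

/-! ### The real operators on `L^1` -/

/-- Duality between L¹ and L^∞, tested on the constant 1, which the semigroup fixes. -/
lemma integral_op_one {t : ℝ} (ht : 0 ≤ t) (f : Lp ℂ 1 μ) :
    ∫ x, T.op 1 t f x ∂μ = ∫ x, f x ∂μ := by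
  have h := T.symm_one_top t ht f ((memLp_top_const (1 : ℂ)).toLp (fun _ => (1 : ℂ)))
  rw [T.op_one t ht] at h
  have e := (memLp_top_const (μ := μ) (1 : ℂ)).coeFn_toLp
  have h1 : ∫ x, f x ∂μ = ∫ x, star ((memLp_top_const (μ := μ) (1 : ℂ)).toLp
      (fun _ => (1 : ℂ)) x) * f x ∂μ := by
    apply integral_congr_ae
    filter_upwards [e] with x hx
    rw [hx]
    simp
  rw [h1, h]
  apply integral_congr_ae
  filter_upwards [e] with x hx
  rw [hx]
  simp

/-- Positivity is not an axiom; it follows from contractivity on L¹ and conservation of the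
integral. Indeed ∫|T_t F| ≤ ∫F = ∫ Re T_t F forces |T_t F| = Re T_t F almost everywhere. -/
lemma op_ofL_eq_norm {t : ℝ} (ht : 0 ≤ t) {F : Lp ℝ 1 μ} (hF : 0 ≤ F) :
    ∀ᵐ x ∂μ, T.op 1 t (ofL F) x = (‖T.op 1 t (ofL F) x‖ : ℂ) := by
  set K := T.op 1 t (ofL F) with hK
  have hi : Integrable K μ := L1.integrable_coeFn K
  have h1 : ∫ x, (K x).re ∂μ = tau F := by
    have := T.integral_op_one ht (ofL F)
    rw [← hK] at this
    have h2 : (∫ x, K x ∂μ).re = ∫ x, (K x).re ∂μ := (integral_re hi).symm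
    rw [← h2, this, tau_apply, integral_congr_ae (coeFn_ofL F), integral_complex_ofReal,
      Complex.ofReal_re]
  have h2 : ∫ x, ‖K x‖ ∂μ ≤ tau F := by
    rw [← L1.norm_eq_integral_norm, ← norm_eq_tau hF, ← norm_ofL F]
    exact T.contraction 1 t ht _
  have h3 : ∫ x, (‖K x‖ - (K x).re) ∂μ = 0 := by
    apply le_antisymm
    · rw [integral_sub hi.norm (by exact hi.re)]
      linarith
    · exact integral_nonneg fun x => sub_nonneg.2 (Complex.re_le_norm _)
  rw [integral_eq_zero_iff_of_nonneg (fun x => sub_nonneg.2 (Complex.re_le_norm _))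
    (hi.norm.sub hi.re)] at h3
  filter_upwards [h3] with x hx
  have hx' : ‖K x‖ = (K x).re := sub_eq_zero.1 hx
  have := (Complex.re_eq_norm.1 hx'.symm)
  exact Complex.eq_coe_norm_of_nonneg this

/-- The operator `T_t` on real `L^1`. -/
def P (t : ℝ) : Lp ℝ 1 μ →L[ℝ] Lp ℝ 1 μ := reL ∘L ((T.op 1 t).restrictScalars ℝ) ∘L ofL

lemma P_apply (t : ℝ) (F : Lp ℝ 1 μ) : T.P t F = reL (T.op 1 t (ofL F)) := rfl

lemma P_nonneg {t : ℝ} (ht : 0 ≤ t) {F : Lp ℝ 1 μ} (hF : 0 ≤ F) : 0 ≤ T.P t F := by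
  rw [← Lp.coeFn_nonneg, P_apply]
  filter_upwards [T.op_ofL_eq_norm ht hF, coeFn_reL (T.op 1 t (ofL F))] with x h1 h2
  rw [h2, h1, Complex.ofReal_re]
  exact norm_nonneg _

lemma P_mono {t : ℝ} (ht : 0 ≤ t) {F G : Lp ℝ 1 μ} (h : F ≤ G) : T.P t F ≤ T.P t G := by
  have := T.P_nonneg ht (sub_nonneg.2 h)
  rwa [map_sub, sub_nonneg] at this

lemma op_ofL {t : ℝ} (ht : 0 ≤ t) (F : Lp ℝ 1 μ) : T.op 1 t (ofL F) = ofL (T.P t F) := by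
  have pos : ∀ {F : Lp ℝ 1 μ}, 0 ≤ F → T.op 1 t (ofL F) = ofL (T.P t F) := fun {F} hF => by
    apply Lp.ext
    filter_upwards [T.op_ofL_eq_norm ht hF, coeFn_reL (T.op 1 t (ofL F)),
      coeFn_ofL (T.P t F)] with x h1 h2 h3
    rw [h3, P_apply, h2, h1, Complex.ofReal_re]
  have : F = F⁺ - F⁻ := (posPart_sub_negPart F).symm
  rw [this, map_sub, map_sub, map_sub, map_sub, pos (posPart_nonneg F), pos (negPart_nonneg F)]

lemma reL_op {t : ℝ} (ht : 0 ≤ t) (G : Lp ℂ 1 μ) : reL (T.op 1 t G) = T.P t (reL G) := by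
  conv_lhs => rw [ofL_decomposition G, map_add, map_smul, T.op_ofL ht, T.op_ofL ht, map_add, reL_ofL]
  convert add_zero _
  apply Lp.ext
  set F := T.P t (reL (-Complex.I • G))
  filter_upwards [coeFn_reL (Complex.I • ofL F), Lp.coeFn_smul Complex.I (ofL F), coeFn_ofL F,
    Lp.coeFn_zero ℝ 1 μ] with x h1 h2 h3 h4
  rw [h1, h2, Pi.smul_apply, h3, h4]
  simp

lemma P_zero (F : Lp ℝ 1 μ) : T.P 0 F = F := by
  rw [P_apply, T.op_zero, reL_ofL]

lemma P_add {s t : ℝ} (hs : 0 ≤ s) (ht : 0 ≤ t) (F : Lp ℝ 1 μ) :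
    T.P (s + t) F = T.P s (T.P t F) := by
  rw [P_apply, T.op_add 1 s t hs ht, T.op_ofL ht, T.op_ofL hs, reL_ofL]

lemma norm_P_le {t : ℝ} (ht : 0 ≤ t) (F : Lp ℝ 1 μ) : ‖T.P t F‖ ≤ ‖F‖ :=
  (norm_reL_le _).trans ((T.contraction 1 t ht _).trans (norm_ofL F).le)

lemma tau_P {t : ℝ} (ht : 0 ≤ t) (F : Lp ℝ 1 μ) : tau (T.P t F) = tau F := by
  have h := T.integral_op_one ht (ofL F)
  rw [T.op_ofL ht, integral_congr_ae (coeFn_ofL F), integral_congr_ae (coeFn_ofL (T.P t F)),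
    integral_complex_ofReal, integral_complex_ofReal] at h
  rw [tau_apply, tau_apply]
  exact_mod_cast h

/-- An operator of the semigroup does not increase uniform bounds. -/
lemma norm_op_le_of_norm_le {p : ℝ≥0∞} [Fact (1 ≤ p)] {t : ℝ} (ht : 0 ≤ t) (f : Lp ℂ p μ) {c : ℝ}
    (hc : 0 ≤ c) (hf : ∀ᵐ x ∂μ, ‖f x‖ ≤ c) : ∀ᵐ x ∂μ, ‖T.op p t f x‖ ≤ c := by
  have hm : MemLp f ∞ μ := memLp_top_of_bound (Lp.aestronglyMeasurable f) c hf
  have e := T.compat p ∞ t ht f (hm.toLp f) hm.coeFn_toLp.symm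
  have h1 := T.contraction ∞ t ht (hm.toLp f)
  have h2 : ‖hm.toLp f‖ ≤ c := by
    rw [Lp.norm_toLp]
    refine ENNReal.toReal_le_of_le_ofReal hc ?_
    rw [eLpNorm_exponent_top]
    exact eLpNormEssSup_le_of_ae_bound hf
  filter_upwards [e, ae_le_eLpNormEssSup (f := T.op ∞ t (hm.toLp f)) (μ := μ)] with x e1 e2
  rw [e1]
  rw [← eLpNorm_exponent_top, ← Lp.enorm_def] at e2
  exact (enorm_le_iff_norm_le.1 e2).trans (h1.trans h2)

/-- Constants need not lie in L¹, so c - F cannot be fed to positivity. Instead F is replaced by its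
positive part, which is bounded by c ≥ 0, and contractivity on L^∞ applies. -/
lemma P_le_const {t : ℝ} (ht : 0 ≤ t) {F : Lp ℝ 1 μ} {c : ℝ} (hc : 0 ≤ c)
    (hF : ∀ᵐ x ∂μ, F x ≤ c) : ∀ᵐ x ∂μ, T.P t F x ≤ c := by
  have h1 : T.P t F ≤ T.P t F⁺ := T.P_mono ht (le_posPart F)
  have hb : ∀ᵐ x ∂μ, ‖ofL F⁺ x‖ ≤ c := by
    filter_upwards [coeFn_ofL F⁺, Lp.coeFn_sup F 0, Lp.coeFn_zero ℝ 1 μ, hF] with x e1 e2 e3 h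
    rw [e1, Complex.norm_real, posPart_def, e2, Pi.sup_apply, e3, Pi.zero_apply, Real.norm_eq_abs,
      abs_of_nonneg le_sup_right]
    exact sup_le h hc
  filter_upwards [(Lp.coeFn_le _ _).2 h1, T.norm_op_le_of_norm_le ht _ hc hb,
    coeFn_reL (T.op 1 t (ofL F⁺))] with x e1 e2 e3
  refine e1.trans ?_
  rw [P_apply, e3]
  exact (Complex.re_le_norm _).trans e2

lemma const_le_P {t : ℝ} (ht : 0 ≤ t) {F : Lp ℝ 1 μ} {c : ℝ} (hc : c ≤ 0)
    (hF : ∀ᵐ x ∂μ, c ≤ F x) : ∀ᵐ x ∂μ, c ≤ T.P t F x := by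
  have h := T.P_le_const ht (F := -F) (c := -c) (by linarith) (by
    filter_upwards [hF, Lp.coeFn_neg F] with x h1 h2
    rw [h2, Pi.neg_apply]; linarith)
  rw [map_neg] at h
  filter_upwards [h, Lp.coeFn_neg (T.P t F)] with x h1 h2
  rw [h2, Pi.neg_apply] at h1
  linarith

lemma integral_mul_P {t : ℝ} (ht : 0 ≤ t) (K V : Lp ℝ 1 μ) {c : ℝ}
    (hV : ∀ᵐ x ∂μ, |V x| ≤ c) :
    ∫ x, T.P t V x * K x ∂μ = ∫ x, V x * T.P t K x ∂μ := by
  have hb : ∀ᵐ x ∂μ, ‖ofL V x‖ ≤ c := by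
    filter_upwards [coeFn_ofL V, hV] with x e h
    rwa [e, Complex.norm_real]
  have hm : MemLp (ofL V) ∞ μ := memLp_top_of_bound (Lp.aestronglyMeasurable _) c hb
  have e0 := hm.coeFn_toLp
  have e := T.compat 1 ∞ t ht (ofL V) (hm.toLp _) e0.symm
  have h := T.symm_one_top t ht (ofL K) (hm.toLp _)
  rw [T.op_ofL ht] at h e
  have h1 : ((∫ x, T.P t V x * K x ∂μ : ℝ) : ℂ) = ((∫ x, V x * T.P t K x ∂μ : ℝ) : ℂ) := by
    rw [← integral_complex_ofReal, ← integral_complex_ofReal]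
    refine Eq.trans (integral_congr_ae ?_) (h.trans (integral_congr_ae ?_))
    · filter_upwards [e, coeFn_ofL (T.P t V), coeFn_ofL K] with x h1 h2 h3
      rw [← h1, h2, h3]
      simp
    · filter_upwards [e0, coeFn_ofL V, coeFn_ofL (T.P t K)] with x h1 h2 h3
      rw [h1, h2, h3]
      simp
  exact_mod_cast h1

end StandardSemigroup

end

/-! ### Contraction semigroups, Schwarz inequalities and strong continuity on L¹. -/

noncomputable section

/-- A strongly continuous one-parameter semigroup of contractions on a normed space. -/
structure IsContractionSemigroup {X : Type*} [NormedAddCommGroup X] [NormedSpace ℝ X]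
    (S : ℝ → X →L[ℝ] X) : Prop where
  zero : ∀ x, S 0 x = x
  add : ∀ s t : ℝ, 0 ≤ s → 0 ≤ t → ∀ x, S (s + t) x = S s (S t x)
  contraction : ∀ t : ℝ, 0 ≤ t → ∀ x, ‖S t x‖ ≤ ‖x‖
  continuous_zero : ∀ x, Tendsto (fun t => S t x) (𝓝[>] 0) (𝓝 x)

namespace IsContractionSemigroup

variable {X : Type*} [NormedAddCommGroup X] [NormedSpace ℝ X] {S : ℝ → X →L[ℝ] X}

lemma dist_le (hS : IsContractionSemigroup S) {s t : ℝ} (hs : 0 ≤ s) (ht : 0 ≤ t) (x : X) :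
    ‖S s x - S t x‖ ≤ ‖S |s - t| x - x‖ := by
  rcases le_total t s with h | h
  · have e := hS.add t (s - t) ht (sub_nonneg.2 h) x
    rw [add_sub_cancel] at e
    rw [e, ← map_sub, abs_of_nonneg (sub_nonneg.2 h)]
    exact hS.contraction t ht _
  · have e := hS.add s (t - s) hs (sub_nonneg.2 h) x
    rw [add_sub_cancel] at e
    rw [e, ← map_sub, abs_of_nonpos (sub_nonpos.2 h), neg_sub, norm_sub_rev (S (t - s) x)]
    exact hS.contraction s hs _

lemma tendsto_Ici (hS : IsContractionSemigroup S) (x : X) :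
    Tendsto (fun t => S t x) (𝓝[≥] 0) (𝓝 x) := by
  rw [← Set.Ioi_insert, nhdsWithin_insert]
  refine Tendsto.sup ?_ (hS.continuous_zero x)
  have := tendsto_pure_nhds (fun t => S t x) (0 : ℝ)
  rwa [hS.zero] at this

lemma tendsto_apply (hS : IsContractionSemigroup S) {ι : Type*} {l : Filter ι} {r : ι → ℝ}
    {y : ι → X} {r₀ : ℝ} {y₀ : X} (hr : ∀ᶠ i in l, 0 ≤ r i) (hr₀ : 0 ≤ r₀)
    (hr' : Tendsto r l (𝓝 r₀)) (hy : Tendsto y l (𝓝 y₀)) :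
    Tendsto (fun i => S (r i) (y i)) l (𝓝 (S r₀ y₀)) := by
  rw [tendsto_iff_norm_sub_tendsto_zero]
  have h1 : Tendsto (fun i => |r i - r₀|) l (𝓝[≥] 0) := by
    rw [tendsto_nhdsWithin_iff]
    refine ⟨?_, Eventually.of_forall fun i => Set.mem_Ici.2 (abs_nonneg _)⟩
    have := (hr'.sub_const r₀).abs
    simpa using this
  have h2 := ((hS.tendsto_Ici y₀).comp h1).sub_const y₀ |>.norm
  have h3 := (hy.sub_const y₀).norm
  rw [sub_self, norm_zero] at h2 h3
  have h4 := h3.add h2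
  rw [add_zero] at h4
  refine squeeze_zero' (Eventually.of_forall fun i => norm_nonneg _) ?_ h4
  filter_upwards [hr] with i hi
  calc ‖S (r i) (y i) - S r₀ y₀‖ = ‖S (r i) (y i - y₀) + (S (r i) y₀ - S r₀ y₀)‖ := by
        rw [map_sub]; congr 1; abel
    _ ≤ ‖S (r i) (y i - y₀)‖ + ‖S (r i) y₀ - S r₀ y₀‖ := norm_add_le _ _
    _ ≤ _ := add_le_add (hS.contraction _ hi _) (hS.dist_le hi hr₀ y₀)

lemma continuousOn_apply (hS : IsContractionSemigroup S) {r : ℝ → ℝ} {y : ℝ → X} {s : Set ℝ}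
    (h0 : ∀ v ∈ s, 0 ≤ r v) (hr : ContinuousOn r s) (hy : ContinuousOn y s) :
    ContinuousOn (fun v => S (r v) (y v)) s := fun v hv =>
  hS.tendsto_apply (eventually_nhdsWithin_of_forall h0) (h0 v hv) (hr v hv) (hy v hv)

end IsContractionSemigroup

namespace StandardSemigroup

variable {M : Type*} [MeasurableSpace M] {μ : Measure M}

/-- A family of inequalities with continuous dependence on a complex parameter holds off one
null set. -/
lemma ae_forall_nonneg_of_continuous {Y : Type*} [TopologicalSpace Y]
    [TopologicalSpace.SeparableSpace Y] [Nonempty Y]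
    {Φ : M → Y → ℝ} (hc : ∀ x, Continuous (Φ x))
    (h : ∀ c, ∀ᵐ x ∂μ, 0 ≤ Φ x c) : ∀ᵐ x ∂μ, ∀ c, 0 ≤ Φ x c := by
  filter_upwards [ae_all_iff.2 fun n => h (TopologicalSpace.denseSeq Y n)] with x hx c
  have : IsClosed {c | 0 ≤ Φ x c} := isClosed_le continuous_const (hc x)
  exact this.closure_subset_iff.2 (by rintro _ ⟨n, rfl⟩; exact hx n)
    ((TopologicalSpace.denseRange_denseSeq Y) c)

/-! ### The square of the modulus -/

/-- `|g|²` as an element of real `L^1`. -/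
def nsq (g : Lp ℂ 2 μ) : Lp ℝ 1 μ := reL (star g • g : Lp ℂ 1 μ)

lemma coeFn_star_smul (f g : Lp ℂ 2 μ) :
    (star f • g : Lp ℂ 1 μ) =ᵐ[μ] fun x => star (f x) * g x := by
  filter_upwards [Lp.coeFn_lpSMul (r := 1) (star f) g, Lp.coeFn_star f] with x h1 h2
  rw [h1, Pi.smul_apply', h2, Pi.star_apply, smul_eq_mul]

lemma coeFn_nsq (g : Lp ℂ 2 μ) : nsq g =ᵐ[μ] fun x => ‖g x‖ ^ 2 := by
  filter_upwards [coeFn_reL (star g • g : Lp ℂ 1 μ), coeFn_star_smul g g] with x h1 h2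
  rw [nsq, h1, h2, Complex.star_def, ← Complex.normSq_eq_conj_mul_self, Complex.ofReal_re,
    Complex.normSq_eq_norm_sq]

lemma ofL_nsq (g : Lp ℂ 2 μ) : ofL (nsq g) = (star g • g : Lp ℂ 1 μ) := by
  apply Lp.ext
  filter_upwards [coeFn_ofL (nsq g), coeFn_nsq g, coeFn_star_smul g g] with x h1 h2 h3
  rw [h1, h2, h3, Complex.star_def, ← Complex.normSq_eq_conj_mul_self, Complex.normSq_eq_norm_sq]

lemma tau_nsq (g : Lp ℂ 2 μ) : tau (nsq g) = ‖g‖ ^ 2 := by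
  have h : ((‖g‖ ^ 2 : ℝ) : ℂ) = ((tau (nsq g) : ℝ) : ℂ) := by
    rw [tau_apply, ← integral_complex_ofReal, Complex.ofReal_pow]
    have := inner_self_eq_norm_sq_to_K (𝕜 := ℂ) g
    refine Eq.trans this.symm ?_
    rw [L2.inner_def]
    apply integral_congr_ae
    filter_upwards [coeFn_nsq g] with x h
    rw [h, inner_self_eq_norm_sq_to_K]
    simp
  exact_mod_cast h.symm

lemma nsq_sub (f g : Lp ℂ 2 μ) :
    nsq f - nsq g = reL (star (f - g) • f + star g • (f - g) : Lp ℂ 1 μ) := by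
  apply Lp.ext
  filter_upwards [Lp.coeFn_sub (nsq f) (nsq g), coeFn_nsq f, coeFn_nsq g, coeFn_star_smul (f - g) f,
    coeFn_star_smul g (f - g), Lp.coeFn_sub f g,
    Lp.coeFn_add (star (f - g) • f : Lp ℂ 1 μ) (star g • (f - g) : Lp ℂ 1 μ),
    coeFn_reL (star (f - g) • f + star g • (f - g) : Lp ℂ 1 μ)] with x h1 h2 h3 h4 h5 h6 h7 h8
  rw [h1, h8, h7, Pi.sub_apply, Pi.add_apply, h2, h3, h4, h5, h6, Pi.sub_apply,
    ← Complex.normSq_eq_norm_sq, ← Complex.normSq_eq_norm_sq, Complex.normSq_apply,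
    Complex.normSq_apply]
  simp
  ring

/-- Complex conjugation on `L^2` as a continuous real-linear map. -/
def conjL : Lp ℂ 2 μ →L[ℝ] Lp ℂ 2 μ := (Complex.conjCLE : ℂ →L[ℝ] ℂ).compLpL 2 μ

lemma conjL_apply (f : Lp ℂ 2 μ) : conjL f = star f := by
  apply Lp.ext
  filter_upwards [(Complex.conjCLE : ℂ →L[ℝ] ℂ).coeFn_compLpL f, Lp.coeFn_star f] with x h1 h2
  rw [h2, conjL, h1]
  rfl

lemma continuous_star_smul :
    Continuous fun q : Lp ℂ 2 μ × Lp ℂ 2 μ => (star q.1 • q.2 : Lp ℂ 1 μ) := by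
  have h : ∀ q : Lp ℂ 2 μ × Lp ℂ 2 μ, (star q.1 • q.2 : Lp ℂ 1 μ) =
      (ContinuousLinearMap.mul ℂ ℂ).holderL μ 2 2 1 (conjL q.1) q.2 := by
    intro q
    apply Lp.ext
    rw [ContinuousLinearMap.holderL_apply_apply, conjL_apply]
    filter_upwards [Lp.coeFn_lpSMul (r := 1) (star q.1) q.2,
      (ContinuousLinearMap.mul ℂ ℂ).coeFn_holder (r := 1) (star q.1) q.2] with x h1 h2
    rw [h1, h2]
    simp
  simp_rw [h]
  fun_prop

lemma continuous_nsq : Continuous (nsq : Lp ℂ 2 μ → Lp ℝ 1 μ) :=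
  reL.continuous.comp (continuous_star_smul.comp (continuous_id.prodMk continuous_id))

/-- The parallelogram-type identity for `|·|²`. -/
lemma nsq_add_eq (a d : Lp ℂ 2 μ) {r : ℝ} (hr : r ≠ 0) :
    nsq (a + d) = (1 + r) • nsq a + (1 + r⁻¹) • nsq d - r • nsq (a - ((r⁻¹ : ℝ) : ℂ) • d) := by
  apply Lp.ext
  set c : ℂ := ((r⁻¹ : ℝ) : ℂ) with hc
  filter_upwards [coeFn_nsq (a + d), coeFn_nsq a, coeFn_nsq d, coeFn_nsq (a - c • d),
    Lp.coeFn_add a d, Lp.coeFn_sub a (c • d), Lp.coeFn_smul c d,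
    Lp.coeFn_smul (1 + r) (nsq a), Lp.coeFn_smul (1 + r⁻¹) (nsq d),
    Lp.coeFn_smul r (nsq (a - c • d)),
    Lp.coeFn_sub ((1 + r) • nsq a + (1 + r⁻¹) • nsq d) (r • nsq (a - c • d)),
    Lp.coeFn_add ((1 + r) • nsq a) ((1 + r⁻¹) • nsq d)] with x h1 h2 h3 h4 h5 h6 h7 h8 h9 h10 h11 h12
  rw [h11, Pi.sub_apply, h12, Pi.add_apply, h8, h9, h10, Pi.smul_apply, Pi.smul_apply,
    Pi.smul_apply, h1, h2, h3, h4, h5, h6, Pi.add_apply, Pi.sub_apply, h7, Pi.smul_apply]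
  simp only [← Complex.normSq_eq_norm_sq, Complex.normSq_apply, hc, smul_eq_mul, Complex.add_re,
    Complex.add_im, Complex.sub_re, Complex.sub_im, Complex.re_ofReal_mul, Complex.im_ofReal_mul]
  field_simp
  ring

variable (T : StandardSemigroup μ)

/-! ### Schwarz inequalities -/

/-- Functions in `L^1 ∩ L^2` are dense in `L^2`. -/
lemma dense_L1_inter_L2 : Dense {f : Lp ℂ 2 μ | ∃ g : Lp ℂ 1 μ, f =ᵐ[μ] g} := by
  have h := Lp.simpleFunc.denseRange (E := ℂ) (μ := μ) (p := 2) (by simp)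
  refine h.mono ?_
  rintro _ ⟨φ, rfl⟩
  have h1 : MemLp (Lp.simpleFunc.toSimpleFunc φ) 1 μ := by
    rw [memLp_one_iff_integrable]
    exact (SimpleFunc.memLp_iff_integrable (by simp) (by simp)).1 (Lp.simpleFunc.memLp φ)
  exact ⟨h1.toLp _, (Lp.simpleFunc.toSimpleFunc_eq_toFun φ).symm.trans h1.coeFn_toLp.symm⟩

/-- For each constant c, |f - c|² ≥ 0 reads |f|² - 2 Re(c̄ f) ≥ -|c|². The semigroup preserves this
lower bound by a nonpositive constant. All c are handled off one null set, and c = T_t f(x) gives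
the claim. The middle term must be in L¹, hence the reduction to L¹ ∩ L². -/
lemma nsq_op_le {t : ℝ} (ht : 0 ≤ t) (g : Lp ℂ 2 μ) : nsq (T.op 2 t g) ≤ T.P t (nsq g) := by
  have hcl : IsClosed {g : Lp ℂ 2 μ | nsq (T.op 2 t g) ≤ T.P t (nsq g)} :=
    isClosed_le (continuous_nsq.comp (T.op 2 t).continuous)
      ((T.P t).continuous.comp continuous_nsq)
  refine hcl.closure_subset_iff.2 ?_ (dense_L1_inter_L2 g)
  rintro f ⟨k, hk⟩
  have hT := T.compat 2 1 t ht f k hk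
  have h1 : ∀ c : ℂ, ∀ᵐ x ∂μ,
      0 ≤ ‖c‖ ^ 2 - 2 * (star c * T.op 2 t f x).re + T.P t (nsq f) x := by
    intro c
    have h2 : ∀ᵐ x ∂μ, -‖c‖ ^ 2 ≤ (nsq f - (2 : ℝ) • reL (star c • k)) x := by
      filter_upwards [Lp.coeFn_sub (nsq f) ((2 : ℝ) • reL (star c • k)), coeFn_nsq f,
        Lp.coeFn_smul (2 : ℝ) (reL (star c • k)), coeFn_reL (star c • k),
        Lp.coeFn_smul (star c) k, hk] with x e1 e2 e3 e4 e5 e6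
      rw [e1, Pi.sub_apply, e2, e3, Pi.smul_apply, e4, e5, Pi.smul_apply, ← e6]
      simp only [← Complex.normSq_eq_norm_sq, Complex.normSq_apply, smul_eq_mul, Complex.mul_re,
        Complex.star_def, Complex.conj_re, Complex.conj_im]
      nlinarith [sq_nonneg ((f x).re - c.re), sq_nonneg ((f x).im - c.im)]
    have h3 := T.const_le_P ht (by nlinarith [sq_nonneg ‖c‖]) h2
    rw [map_sub, map_smul, ← T.reL_op ht, map_smul] at h3
    filter_upwards [h3, Lp.coeFn_sub (T.P t (nsq f)) ((2 : ℝ) • reL (star c • T.op 1 t k)),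
      Lp.coeFn_smul (2 : ℝ) (reL (star c • T.op 1 t k)), coeFn_reL (star c • T.op 1 t k),
      Lp.coeFn_smul (star c) (T.op 1 t k), hT] with x e1 e2 e3 e4 e5 e6
    rw [e2, Pi.sub_apply, e3, Pi.smul_apply, e4, e5, Pi.smul_apply, ← e6, smul_eq_mul,
      smul_eq_mul] at e1
    linarith
  have h2 := ae_forall_nonneg_of_continuous (fun x => by fun_prop) h1
  change nsq (T.op 2 t f) ≤ T.P t (nsq f)
  rw [← Lp.coeFn_le]
  filter_upwards [h2, coeFn_nsq (T.op 2 t f)] with x e1 e2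
  have := e1 (T.op 2 t f x)
  rw [Complex.star_def, ← Complex.normSq_eq_conj_mul_self, Complex.ofReal_re,
    Complex.normSq_eq_norm_sq] at this
  rw [e2]
  linarith

/-- Same device with real c. In the form T_t √h ≤ √(T_t h) it turns square roots of area integrals
into supermartingale weights. -/
lemma sq_P_le {t : ℝ} (ht : 0 ≤ t) {V h : Lp ℝ 1 μ} (hV : ∀ᵐ x ∂μ, V x ^ 2 ≤ h x) :
    ∀ᵐ x ∂μ, T.P t V x ^ 2 ≤ T.P t h x := by
  have h1 : ∀ c : ℝ, ∀ᵐ x ∂μ, 0 ≤ c ^ 2 - 2 * (c * T.P t V x) + T.P t h x := by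
    intro c
    have h2 : ∀ᵐ x ∂μ, -c ^ 2 ≤ (h - (2 * c) • V) x := by
      filter_upwards [Lp.coeFn_sub h ((2 * c) • V), Lp.coeFn_smul (2 * c) V, hV] with x e1 e2 e3
      rw [e1, Pi.sub_apply, e2, Pi.smul_apply, smul_eq_mul]
      nlinarith [sq_nonneg (V x - c)]
    have h3 := T.const_le_P ht (by nlinarith [sq_nonneg c]) h2
    rw [map_sub, map_smul] at h3
    filter_upwards [h3, Lp.coeFn_sub (T.P t h) ((2 * c) • T.P t V),
      Lp.coeFn_smul (2 * c) (T.P t V)] with x e1 e2 e3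
    rw [e2, Pi.sub_apply, e3, Pi.smul_apply, smul_eq_mul] at e1
    linarith
  have h2 := ae_forall_nonneg_of_continuous (fun x => by fun_prop) h1
  filter_upwards [h2] with x hx
  have := hx (T.P t V x)
  nlinarith

/-- `|e|` as an element of real `L^1`. -/
def absL (e : Lp ℂ 1 μ) : Lp ℝ 1 μ := (Lp.memLp e).norm.toLp _

lemma coeFn_absL (e : Lp ℂ 1 μ) : absL e =ᵐ[μ] fun x => ‖e x‖ := MemLp.coeFn_toLp _

/-- Positivity applied to Re(c̄ e) ≤ |c||e| for every c, then c = T_t e(x). -/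
lemma norm_op_one_le {t : ℝ} (ht : 0 ≤ t) (e : Lp ℂ 1 μ) :
    ∀ᵐ x ∂μ, ‖T.op 1 t e x‖ ≤ T.P t (absL e) x := by
  have habs : 0 ≤ absL e := by
    rw [← Lp.coeFn_nonneg]
    filter_upwards [coeFn_absL e] with x hx
    rw [hx]
    exact norm_nonneg _
  have h1 : ∀ c : ℂ, ∀ᵐ x ∂μ, 0 ≤ ‖c‖ * T.P t (absL e) x - (star c * T.op 1 t e x).re := by
    intro c
    have h2 : reL (star c • e) ≤ ‖c‖ • absL e := by
      rw [← Lp.coeFn_le]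
      filter_upwards [coeFn_reL (star c • e), Lp.coeFn_smul (star c) e, coeFn_absL e,
        Lp.coeFn_smul ‖c‖ (absL e)] with x e1 e2 e3 e4
      rw [e1, e2, e4, Pi.smul_apply, Pi.smul_apply, e3]
      refine (Complex.re_le_norm _).trans ?_
      rw [norm_smul, norm_star, smul_eq_mul]
    have h3 := T.P_mono ht h2
    rw [← T.reL_op ht, (T.op 1 t).map_smul, (T.P t).map_smul, ← Lp.coeFn_le] at h3
    filter_upwards [h3, coeFn_reL (star c • T.op 1 t e), Lp.coeFn_smul (star c) (T.op 1 t e),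
      Lp.coeFn_smul ‖c‖ (T.P t (absL e))] with x e1 e2 e3 e4
    rw [e2, e3, e4, Pi.smul_apply, Pi.smul_apply, smul_eq_mul, smul_eq_mul] at e1
    linarith
  have h2 := ae_forall_nonneg_of_continuous (fun x => by fun_prop) h1
  filter_upwards [h2, (Lp.coeFn_nonneg _).2 (T.P_nonneg ht habs)] with x hx hp
  have := hx (T.op 1 t e x)
  rw [Complex.star_def, ← Complex.normSq_eq_conj_mul_self, Complex.ofReal_re,
    Complex.normSq_eq_norm_sq] at this
  rcases (norm_nonneg (T.op 1 t e x)).eq_or_lt with h0 | h0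
  · rw [← h0]; exact hp
  · nlinarith

/-! ### Compatibility with complex conjugation -/

lemma op_one_star {t : ℝ} (ht : 0 ≤ t) (G : Lp ℂ 1 μ) : T.op 1 t (star G) = star (T.op 1 t G) := by
  have hs : ∀ A B : Lp ℝ 1 μ, star (ofL A + Complex.I • ofL B) = ofL A - Complex.I • ofL B := by
    intro A B
    apply Lp.ext
    filter_upwards [Lp.coeFn_star (ofL A + Complex.I • ofL B),
      Lp.coeFn_add (ofL A) (Complex.I • ofL B), Lp.coeFn_sub (ofL A) (Complex.I • ofL B),
      Lp.coeFn_smul Complex.I (ofL B), coeFn_ofL A, coeFn_ofL B] with x h1 h2 h3 h4 h5 h6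
    rw [h1, Pi.star_apply, h2, h3, Pi.add_apply, Pi.sub_apply, h4, Pi.smul_apply, h5, h6]
    apply Complex.ext <;> simp
  rw [ofL_decomposition G, hs, map_sub, map_add, map_smul, T.op_ofL ht, T.op_ofL ht, hs]

lemma op_two_star {t : ℝ} (ht : 0 ≤ t) (f : Lp ℂ 2 μ) : T.op 2 t (star f) = star (T.op 2 t f) := by
  have hcl : IsClosed {g : Lp ℂ 2 μ | T.op 2 t (conjL g) = conjL (T.op 2 t g)} :=
    isClosed_eq ((T.op 2 t).continuous.comp conjL.continuous)
      (conjL.continuous.comp (T.op 2 t).continuous)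
  rw [← conjL_apply, ← conjL_apply]
  refine hcl.closure_subset_iff.2 ?_ (dense_L1_inter_L2 f)
  rintro g ⟨k, hk⟩
  change T.op 2 t (conjL g) = conjL (T.op 2 t g)
  rw [conjL_apply, conjL_apply]
  have h1 : (star g : Lp ℂ 2 μ) =ᵐ[μ] (star k : Lp ℂ 1 μ) := by
    filter_upwards [Lp.coeFn_star g, Lp.coeFn_star k, hk] with x h1 h2 h3
    rw [h1, h2, Pi.star_apply, Pi.star_apply, h3]
  apply Lp.ext
  filter_upwards [T.compat 2 1 t ht _ _ h1, T.compat 2 1 t ht _ _ hk, Lp.coeFn_star (T.op 2 t g),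
    Lp.coeFn_star (T.op 1 t k)] with x h1 h2 h3 h4
  rw [h1, h3, Pi.star_apply, h2, T.op_one_star ht, h4, Pi.star_apply]

/-! ### Strong continuity -/

/-- The operators on `L^2`, as real-linear maps. -/
def R (t : ℝ) : Lp ℂ 2 μ →L[ℝ] Lp ℂ 2 μ := (T.op 2 t).restrictScalars ℝ

lemma isContractionSemigroup_R : IsContractionSemigroup T.R where
  zero := T.op_zero 2
  add s t hs ht := T.op_add 2 s t hs ht
  contraction t ht := T.contraction 2 t ht
  continuous_zero := T.continuous_zero

lemma exists_nsq_eq {F : Lp ℝ 1 μ} (hF : 0 ≤ F) : ∃ h : Lp ℂ 2 μ, nsq h = F := by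
  have hm : MemLp (fun x => ((√(F x) : ℝ) : ℂ)) 2 μ := by
    refine MemLp.ofReal (K := ℂ) ?_
    rw [memLp_two_iff_integrable_sq (Lp.aestronglyMeasurable F).aemeasurable.sqrt.aestronglyMeasurable]
    refine (L1.integrable_coeFn F).congr ?_
    filter_upwards [(Lp.coeFn_nonneg F).2 hF] with x hx
    rw [Real.sq_sqrt hx]
  refine ⟨hm.toLp _, ?_⟩
  apply Lp.ext
  filter_upwards [coeFn_nsq (hm.toLp _), hm.coeFn_toLp, (Lp.coeFn_nonneg F).2 hF] with x h1 h2 h3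
  rw [h1, h2, Complex.norm_real, Real.norm_eq_abs, sq_abs, Real.sq_sqrt h3]

/-- A nonnegative F is |h|² with h ∈ L². The difference T_t|h|² - |T_t h|² is nonnegative, so its L¹
norm equals its integral ‖h‖² - ‖T_t h‖², which vanishes as t → 0 by continuity on L². -/
lemma tendsto_P_zero (F : Lp ℝ 1 μ) : Tendsto (fun t => T.P t F) (𝓝[>] 0) (𝓝 F) := by
  have pos : ∀ {F : Lp ℝ 1 μ}, 0 ≤ F → Tendsto (fun t => T.P t F) (𝓝[>] 0) (𝓝 F) := by
    intro F hF
    obtain ⟨h, rfl⟩ := exists_nsq_eq hF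
    have h0 := T.continuous_zero h
    have h1 : Tendsto (fun t => nsq (T.op 2 t h)) (𝓝[>] 0) (𝓝 (nsq h)) :=
      (continuous_nsq.tendsto h).comp h0
    have h2 : Tendsto (fun t => T.P t (nsq h) - nsq (T.op 2 t h)) (𝓝[>] 0) (𝓝 0) := by
      rw [tendsto_zero_iff_norm_tendsto_zero]
      have h3 : Tendsto (fun t => ‖h‖ ^ 2 - ‖T.op 2 t h‖ ^ 2) (𝓝[>] 0) (𝓝 0) := by
        have := (h0.norm.pow 2).const_sub (‖h‖ ^ 2)
        rwa [sub_self] at this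
      refine h3.congr' ?_
      filter_upwards [self_mem_nhdsWithin] with t ht
      have ht : 0 ≤ t := le_of_lt ht
      rw [norm_eq_tau (sub_nonneg.2 (T.nsq_op_le ht h)), map_sub, T.tau_P ht, tau_nsq, tau_nsq]
    simpa using h2.add h1
  have h := (pos (posPart_nonneg F)).sub (pos (negPart_nonneg F))
  rw [posPart_sub_negPart] at h
  refine h.congr fun t => ?_
  rw [← map_sub, posPart_sub_negPart]

lemma isContractionSemigroup_P : IsContractionSemigroup T.P where
  zero := T.P_zero
  add _ _ hs ht := T.P_add hs ht
  contraction _ ht := T.norm_P_le ht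
  continuous_zero := T.tendsto_P_zero

end StandardSemigroup

end

noncomputable section

/-! ### Smoothing by a symmetric contraction semigroup on a Hilbert space -/

section Hilbert

variable {E : Type*} [NormedAddCommGroup E] [InnerProductSpace ℂ E] {S : ℝ → E →L[ℂ] E}

/-- A substitute for the spectral theorem. By symmetry, ‖S_{jh/2}(S_h f - f)‖² is the second
difference of ψ_j = ‖S_{jh/2} f‖². Both this and the first difference of ψ decrease in j, so summing
twice gives (n+1)² ‖S_{nh}(S_h f - f)‖² ≤ ‖f‖². -/
lemma norm_sub_mul_le_of_symmetric_semigroup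
    (h0 : ∀ x, S 0 x = x) (hadd : ∀ s t : ℝ, 0 ≤ s → 0 ≤ t → ∀ x, S (s + t) x = S s (S t x))
    (hcontr : ∀ t : ℝ, 0 ≤ t → ∀ x, ‖S t x‖ ≤ ‖x‖)
    (hsymm : ∀ t : ℝ, 0 ≤ t → ∀ x y, inner ℂ (S t x) y = inner ℂ x (S t y))
    {s h : ℝ} (hs : 0 < s) (hh : 0 < h) (f : E) :
    ‖S h (S s f) - S s f‖ ≤ h / s * ‖f‖ := by
  have hj : ∀ j : ℕ, 0 ≤ (j : ℝ) * (h / 2) := fun j => by positivity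
  have hanti : ∀ (y : E) {r r' : ℝ}, 0 ≤ r → r ≤ r' → ‖S r' y‖ ≤ ‖S r y‖ := by
    intro y r r' hr hrr
    have := hadd (r' - r) r (sub_nonneg.2 hrr) hr y
    rw [sub_add_cancel] at this
    rw [this]
    exact hcontr _ (sub_nonneg.2 hrr) _
  set ψ : ℕ → ℝ := fun j => ‖S (j * (h / 2)) f‖ ^ 2 with hψ
  set d : ℕ → ℝ := fun j => ‖S (j * (h / 2)) (S h f - f)‖ ^ 2 with hd
  have hψ_anti : ∀ j, ψ (j + 1) ≤ ψ j := by
    intro j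
    apply pow_le_pow_left₀ (norm_nonneg _)
    apply hanti f (hj j)
    push_cast
    nlinarith
  have hd_anti : Antitone d := by
    intro i j hij
    apply pow_le_pow_left₀ (norm_nonneg _)
    apply hanti _ (hj i)
    have : (i : ℝ) ≤ j := by exact_mod_cast hij
    nlinarith
  have hd_eq : ∀ j, d j = (ψ j - ψ (j + 1)) - (ψ (j + 1) - ψ (j + 2)) := by
    intro j
    have e1 : S (j * (h / 2)) (S h f) = S ((j + 2 : ℕ) * (h / 2)) f := by
      rw [← hadd _ _ (hj j) hh.le]
      congr 2
      push_cast
      ring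
    have e2 : inner ℂ (S ((j + 2 : ℕ) * (h / 2)) f) (S (j * (h / 2)) f) =
        inner ℂ (S ((j + 1 : ℕ) * (h / 2)) f) (S ((j + 1 : ℕ) * (h / 2)) f) := by
      have a1 : ((j + 2 : ℕ) : ℝ) * (h / 2) = h / 2 + (j + 1 : ℕ) * (h / 2) := by push_cast; ring
      have a2 : ((j + 1 : ℕ) : ℝ) * (h / 2) = h / 2 + j * (h / 2) := by push_cast; ring
      rw [a1, hadd _ _ (by positivity) (hj _), hsymm _ (by positivity), ← hadd _ _ (by positivity) (hj j),
        ← a2]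
    simp only [hd, hψ]
    rw [map_sub, e1, @norm_sub_sq ℂ, e2, inner_self_eq_norm_sq]
    ring
  set e : ℕ → ℝ := fun j => ψ j - ψ (j + 1) with he
  have he_nonneg : ∀ j, 0 ≤ e j := fun j => sub_nonneg.2 (hψ_anti j)
  have hd_nonneg : ∀ j, 0 ≤ d j := fun j => by positivity
  have he_anti : Antitone e := antitone_nat_of_succ_le fun j => by
    have := hd_eq j
    have := hd_nonneg j
    simp only [he]
    linarith
  have hsum : ∀ n : ℕ, ((n : ℝ) + 1) * e n ≤ ‖f‖ ^ 2 := by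
    intro n
    have h1 : ∑ j ∈ Finset.range (n + 1), e j = ψ 0 - ψ (n + 1) := Finset.sum_range_sub' ψ (n + 1)
    have h2 : ∑ j ∈ Finset.range (n + 1), e n ≤ ∑ j ∈ Finset.range (n + 1), e j :=
      Finset.sum_le_sum fun j hj => he_anti (by simp at hj; omega)
    rw [Finset.sum_const, Finset.card_range, nsmul_eq_mul, h1] at h2
    have h3 : ψ 0 = ‖f‖ ^ 2 := by simp [hψ, h0]
    have h4 : 0 ≤ ψ (n + 1) := by positivity
    push_cast at h2
    linarith
  have hsum' : ∀ n : ℕ, ((n : ℝ) + 1) * d (2 * n) ≤ e n := by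
    intro n
    have h1 : ∑ j ∈ Finset.range (n + 1), d (n + j) = e n - e (n + (n + 1)) := by
      have := Finset.sum_range_sub' (fun j => e (n + j)) (n + 1)
      rw [add_zero] at this
      rw [← this]
      exact Finset.sum_congr rfl fun j _ => hd_eq (n + j)
    have h2 : ∑ j ∈ Finset.range (n + 1), d (2 * n) ≤ ∑ j ∈ Finset.range (n + 1), d (n + j) :=
      Finset.sum_le_sum fun j hj => hd_anti (by simp at hj; omega)
    rw [Finset.sum_const, Finset.card_range, nsmul_eq_mul, h1] at h2
    have := he_nonneg (n + (n + 1))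
    push_cast at h2
    linarith
  -- The largest n with nh ≤ s: contractivity passes from time nh to time s, and n + 1 ≥ s/h yields
  -- the factor h/s.
  set n := ⌊s / h⌋₊
  have hn1 : (n : ℝ) * h ≤ s := by
    have := Nat.floor_le (div_nonneg hs.le hh.le)
    rwa [le_div_iff₀ hh] at this
  have hn2 : s / h ≤ (n : ℝ) + 1 := (Nat.lt_floor_add_one _).le
  have key : ((n : ℝ) + 1) * ‖S (n * h) (S h f - f)‖ ≤ ‖f‖ := by
    refine le_of_sq_le_sq ?_ (norm_nonneg _)
    have h1 := hsum n
    have h2 := hsum' n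
    have h3 : d (2 * n) = ‖S (n * h) (S h f - f)‖ ^ 2 := by
      simp only [hd]
      congr 4
      push_cast
      ring
    rw [h3] at h2
    have h4 : (0 : ℝ) ≤ (n : ℝ) + 1 := by positivity
    calc (((n : ℝ) + 1) * ‖S (n * h) (S h f - f)‖) ^ 2
        = ((n : ℝ) + 1) * (((n : ℝ) + 1) * ‖S (n * h) (S h f - f)‖ ^ 2) := by ring
      _ ≤ _ := (mul_le_mul_of_nonneg_left h2 h4).trans h1
  have e1 : S h (S s f) - S s f = S s (S h f - f) := by
    rw [map_sub, ← hadd _ _ hh.le hs.le, ← hadd _ _ hs.le hh.le, add_comm]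
  rw [e1]
  have h5 : ‖S s (S h f - f)‖ ≤ ‖S (n * h) (S h f - f)‖ := hanti _ (by positivity) hn1
  have h6 : s / h * ‖S s (S h f - f)‖ ≤ ‖f‖ := by
    calc s / h * ‖S s (S h f - f)‖ ≤ ((n : ℝ) + 1) * ‖S (n * h) (S h f - f)‖ := by gcongr
      _ ≤ _ := key
  calc ‖S s (S h f - f)‖ = h / s * (s / h * ‖S s (S h f - f)‖) := by field_simp
    _ ≤ h / s * ‖f‖ := by gcongr

/-- The orbits of a symmetric contraction semigroup are differentiable at positive times. -/
lemma exists_generator_of_symmetric_semigroup [CompleteSpace E]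
    (h0 : ∀ x, S 0 x = x) (hadd : ∀ s t : ℝ, 0 ≤ s → 0 ≤ t → ∀ x, S (s + t) x = S s (S t x))
    (hcontr : ∀ t : ℝ, 0 ≤ t → ∀ x, ‖S t x‖ ≤ ‖x‖)
    (hsymm : ∀ t : ℝ, 0 ≤ t → ∀ x y, inner ℂ (S t x) y = inner ℂ x (S t y))
    {s : ℝ} (hs : 0 < s) (f : E) :
    ∃ y, Tendsto (fun t : ℝ => ((t : ℂ)⁻¹) • (S t (S s f) - S s f)) (𝓝[>] 0) (𝓝 y) := by
  set x := S s f with hx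
  set a := ‖f‖ / s with ha
  set b := 4 * ‖f‖ / s ^ 2 with hb
  have ha0 : 0 ≤ a := by positivity
  have hb0 : 0 ≤ b := by positivity
  have hA : ∀ k : ℝ, 0 < k → ‖S k x - x‖ ≤ a * k := fun k hk =>
    (norm_sub_mul_le_of_symmetric_semigroup h0 hadd hcontr hsymm hs hk f).trans_eq (by
      rw [ha]; ring)
  have hB : ∀ h k : ℝ, 0 < h → 0 < k → ‖S h (S k x - x) - (S k x - x)‖ ≤ b * h * k := by
    intro h k hh hk
    have hs2 : 0 < s / 2 := by positivity
    have e1 : x = S (s / 2) (S (s / 2) f) := by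
      rw [← hadd _ _ hs2.le hs2.le, add_halves]
    have e2 : S k x - x = S (s / 2) (S k (S (s / 2) f) - S (s / 2) f) := by
      rw [map_sub, ← hadd _ _ hs2.le hk.le, add_comm, hadd _ _ hk.le hs2.le, ← e1]
    rw [e2]
    refine (norm_sub_mul_le_of_symmetric_semigroup h0 hadd hcontr hsymm hs2 hh _).trans ?_
    have := norm_sub_mul_le_of_symmetric_semigroup h0 hadd hcontr hsymm hs2 hk f
    calc h / (s / 2) * ‖S k (S (s / 2) f) - S (s / 2) f‖ ≤ h / (s / 2) * (k / (s / 2) * ‖f‖) := by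
          gcongr
      _ = b * h * k := by rw [hb]; field_simp; ring
  -- Discrete Taylor formula: n increments of length k differ from n times the first one by second
  -- differences, each controlled by `hB`.
  have hC : ∀ k : ℝ, 0 < k → ∀ n : ℕ,
      ‖S (n * k) x - x - (n : ℂ) • (S k x - x)‖ ≤ b * (n * k) ^ 2 := by
    intro k hk n
    induction n with
    | zero => simp [h0]
    | succ n ih =>
      have e1 : S ((n + 1 : ℕ) * k) x = S (n * k) (S k x) := by
        rw [← hadd _ _ (by positivity) hk.le]
        congr 2
        push_cast; ring
      have e2 : S ((n + 1 : ℕ) * k) x - x - ((n + 1 : ℕ) : ℂ) • (S k x - x) =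
          (S (n * k) (S k x - x) - (S k x - x)) + (S (n * k) x - x - (n : ℂ) • (S k x - x)) := by
        rw [e1, map_sub]
        push_cast
        rw [add_smul, one_smul]
        abel
      have e3 : ‖S (n * k) (S k x - x) - (S k x - x)‖ ≤ b * (n * k) * k := by
        rcases Nat.eq_zero_or_pos n with rfl | hn
        · simp [h0]
        · exact hB _ _ (by positivity) hk
      rw [e2]
      refine (norm_add_le _ _).trans ((add_le_add e3 ih).trans ?_)
      push_cast
      have : 0 ≤ b * k ^ 2 * (n + 1) := by positivity
      nlinarith
  have hD : ∀ h k : ℝ, 0 < h → 0 < k →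
      ‖((h : ℂ)⁻¹) • (S h x - x) - ((k : ℂ)⁻¹) • (S k x - x)‖ ≤ b * h + 2 * a * k / h := by
    intro h k hh hk
    set n := ⌊h / k⌋₊
    have hn1 : (n : ℝ) * k ≤ h := by
      have := Nat.floor_le (div_nonneg hh.le hk.le)
      rwa [le_div_iff₀ hk] at this
    have hn2 : h / k < (n : ℝ) + 1 := Nat.lt_floor_add_one _
    have hn2' : h < (n : ℝ) * k + k := by
      rw [div_lt_iff₀ hk] at hn2; linarith
    have hC' : ‖S (n * k) x - x - (n : ℂ) • (S k x - x)‖ ≤ b * h ^ 2 :=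
      (hC k hk n).trans (by gcongr)
    have h1 : ‖S h x - S (n * k) x‖ ≤ a * k := by
      have e := hadd (n * k) (h - n * k) (by positivity) (by linarith) x
      rw [add_sub_cancel] at e
      rw [e, ← map_sub]
      refine (hcontr _ (by positivity) _).trans ?_
      rcases (sub_nonneg.2 hn1).eq_or_lt with h' | h'
      · rw [← h', h0, sub_self, norm_zero]; positivity
      · exact (hA _ h').trans (by gcongr; linarith)
    have h2 : ‖((n : ℂ) - (h : ℂ) / k) • (S k x - x)‖ ≤ a * k := by
      rw [norm_smul]
      have : ‖(n : ℂ) - (h : ℂ) / k‖ ≤ 1 := by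
        have e : (n : ℂ) - (h : ℂ) / k = (((n : ℝ) - h / k : ℝ) : ℂ) := by push_cast; rfl
        rw [e, Complex.norm_real, Real.norm_eq_abs, abs_le]
        have : (n : ℝ) ≤ h / k := by rwa [le_div_iff₀ hk]
        constructor <;> linarith
      calc _ ≤ 1 * (a * k) := by gcongr; exact hA k hk
        _ = _ := one_mul _
    have e : ((h : ℂ)⁻¹) • (S h x - x) - ((k : ℂ)⁻¹) • (S k x - x) =
        ((h : ℂ)⁻¹) • ((S (n * k) x - x - (n : ℂ) • (S k x - x)) + (S h x - S (n * k) x)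
          + ((n : ℂ) - (h : ℂ) / k) • (S k x - x)) := by
      have hh' : (h : ℂ) ≠ 0 := by exact_mod_cast hh.ne'
      have : ((k : ℂ)⁻¹) • (S k x - x) = ((h : ℂ)⁻¹) • ((h : ℂ) / k) • (S k x - x) := by
        rw [smul_smul]
        congr 1
        field_simp
      rw [this, ← smul_sub, sub_smul]
      congr 1
      abel
    rw [e, norm_smul, norm_inv, Complex.norm_real, Real.norm_eq_abs, abs_of_pos hh]
    calc h⁻¹ * ‖_‖ ≤ h⁻¹ * (b * h ^ 2 + a * k + a * k) := by
          gcongr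
          exact (norm_add_le _ _).trans (add_le_add ((norm_add_le _ _).trans (add_le_add hC' h1)) h2)
      _ = _ := by field_simp; ring
  apply CompleteSpace.complete
  rw [Metric.cauchy_iff]
  refine ⟨inferInstance, fun ε hε => ?_⟩
  -- In `hD` the two errors are treated in turn: h is fixed first to make b·h small, then k is taken
  -- small relative to h.
  obtain ⟨h, hh, hbh⟩ : ∃ h : ℝ, 0 < h ∧ b * h < ε / 4 := by
    refine ⟨ε / (8 * (b + 1)), by positivity, ?_⟩
    rw [mul_div_assoc', div_lt_iff₀ (by positivity)]
    nlinarith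
  set c := ε * h / (8 * (2 * a + 1)) with hc
  have hc0 : 0 < c := by positivity
  have hmem : Set.Ioo 0 c ∈ 𝓝[>] (0 : ℝ) := Ioo_mem_nhdsGT hc0
  refine ⟨_, image_mem_map hmem, ?_⟩
  have hclose : ∀ k ∈ Set.Ioo 0 c,
      ‖((h : ℂ)⁻¹) • (S h x - x) - ((k : ℂ)⁻¹) • (S k x - x)‖ < ε / 2 := by
    intro k hk
    refine (hD h k hh hk.1).trans_lt ?_
    have : 2 * a * k / h ≤ ε / 8 := by
      rw [div_le_iff₀ hh]
      have h1 : (2 * a + 1) * k ≤ (2 * a + 1) * c := by gcongr; exact hk.2.le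
      have h2 : (2 * a + 1) * c = ε * h / 8 := by rw [hc]; field_simp
      nlinarith [hk.1]
    linarith
  rintro _ ⟨k, hk, rfl⟩ _ ⟨k', hk', rfl⟩
  have h1 := hclose k hk
  have h2 := hclose k' hk'
  rw [← dist_eq_norm] at h1 h2
  rw [dist_comm] at h1
  linarith [dist_triangle (((k : ℂ)⁻¹) • (S k x - x)) (((h : ℂ)⁻¹) • (S h x - x))
    (((k' : ℂ)⁻¹) • (S k' x - x))]

end Hilbert

namespace StandardSemigroup

variable {M : Type*} [MeasurableSpace M] {μ : Measure M} (T : StandardSemigroup μ)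

lemma norm_op_sub_le {s h : ℝ} (hs : 0 < s) (hh : 0 < h) (f : Lp ℂ 2 μ) :
    ‖T.op 2 h (T.op 2 s f) - T.op 2 s f‖ ≤ h / s * ‖f‖ :=
  norm_sub_mul_le_of_symmetric_semigroup (S := T.op 2) (T.op_zero 2) (T.op_add 2)
    (T.contraction 2) T.symm hs hh f

lemma inDomain_op {s : ℝ} (hs : 0 < s) (f : Lp ℂ 2 μ) : T.InDomain 2 (T.op 2 s f) :=
  exists_generator_of_symmetric_semigroup (S := T.op 2) (T.op_zero 2) (T.op_add 2)
    (T.contraction 2) T.symm hs f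

lemma isGenerator_gen {p : ℝ≥0∞} [Fact (1 ≤ p)] {f : Lp ℂ p μ} (h : T.InDomain p f) :
    T.IsGenerator p f (T.gen p f) := by
  rw [gen, dif_pos h]
  exact h.choose_spec

lemma gen_eq {p : ℝ≥0∞} [Fact (1 ≤ p)] {f h : Lp ℂ p μ} (hf : T.IsGenerator p f h) :
    T.gen p f = h :=
  tendsto_nhds_unique (T.isGenerator_gen ⟨h, hf⟩) hf

end StandardSemigroup

end

noncomputable section

namespace StandardSemigroup

variable {M : Type*} [MeasurableSpace M] {μ : Measure M}

/-! ### Density of the algebra in `L^2` -/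

/-- The elements of `L^2` that belong to `A`. -/
def algL2 (A : Submodule ℂ (Lp ℂ ∞ μ)) : Submodule ℂ (Lp ℂ 2 μ) where
  carrier := {f | ∃ a ∈ A, f =ᵐ[μ] a}
  zero_mem' := ⟨0, A.zero_mem, (Lp.coeFn_zero ℂ 2 μ).trans (Lp.coeFn_zero ℂ ∞ μ).symm⟩
  add_mem' := by
    rintro f g ⟨a, ha, hfa⟩ ⟨b, hb, hgb⟩
    refine ⟨a + b, A.add_mem ha hb, ?_⟩
    filter_upwards [hfa, hgb, Lp.coeFn_add f g, Lp.coeFn_add a b] with x h1 h2 h3 h4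
    rw [h3, h4, Pi.add_apply, Pi.add_apply, h1, h2]
  smul_mem' := by
    rintro c f ⟨a, ha, hfa⟩
    refine ⟨c • a, A.smul_mem c ha, ?_⟩
    filter_upwards [hfa, Lp.coeFn_smul c f, Lp.coeFn_smul c a] with x h1 h2 h3
    rw [h2, h3, Pi.smul_apply, Pi.smul_apply, h1]

lemma eq_zero_of_weakStar_dense {A : Submodule ℂ (Lp ℂ ∞ μ)}
    (hA : @Dense (Lp ℂ ∞ μ) (weakStarTopology μ) (A : Set (Lp ℂ ∞ μ))) {k : Lp ℂ 1 μ}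
    (hk : ∀ a ∈ A, ∫ x, k x * a x ∂μ = 0) : k = 0 := by
  have h1 : ∀ c : Lp ℂ ∞ μ, ∫ x, k x * c x ∂μ = 0 := by
    have hcont : @Continuous _ _ (weakStarTopology μ) _
        fun c : Lp ℂ ∞ μ => ∫ x, k x * c x ∂μ :=
      @Continuous.comp _ _ _ (weakStarTopology μ) _ _ _ (fun p : Lp ℂ 1 μ → ℂ => p k)
        (continuous_apply k) continuous_induced_dom
    have hcl : @IsClosed _ (weakStarTopology μ) {c : Lp ℂ ∞ μ | ∫ x, k x * c x ∂μ = 0} :=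
      @IsClosed.preimage _ _ (weakStarTopology μ) _ _ hcont _ isClosed_singleton
    exact fun c => (@IsClosed.closure_subset_iff _ (weakStarTopology μ) _ _ hcl).2 hk (hA c)
  have h2 : k =ᵐ[μ] 0 := by
    refine (L1.integrable_coeFn k).ae_eq_zero_of_forall_setIntegral_eq_zero fun s hs _ => ?_
    have hm : MemLp (s.indicator fun _ => (1 : ℂ)) ∞ μ := (memLp_top_const (1 : ℂ)).indicator hs
    rw [← h1 (hm.toLp _), ← integral_indicator hs]
    apply integral_congr_ae
    filter_upwards [hm.coeFn_toLp] with x hx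
    rw [hx]
    by_cases hxs : x ∈ s <;> simp [hxs]
  exact (Lp.eq_zero_iff_ae_eq_zero).2 h2

variable {T : StandardSemigroup μ} {A : Submodule ℂ (Lp ℂ ∞ μ)}

/-- If h is orthogonal to A in L², then for a, b ∈ A the integral of (ah)b is the inner product of
(ab)^* ∈ A with h, hence zero. As ah ∈ L¹, weak-* density gives ah = 0 for all a. Then |h|² ∈ L¹
also annihilates A, so h = 0. -/
lemma dense_algL2 (hA : T.IsAdmissibleAlgebra A) : Dense (algL2 A : Set (Lp ℂ 2 μ)) := by
  rw [Submodule.dense_iff_topologicalClosure_eq_top, Submodule.topologicalClosure_eq_top_iff,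
    Submodule.eq_bot_iff]
  intro h hh
  rw [Submodule.mem_orthogonal] at hh
  have key : ∀ a ∈ A, ∀ᵐ x ∂μ, a x * h x = 0 := by
    intro a ha
    obtain ⟨f, hfa, -⟩ := hA.domain a ha
    have h1 : (f • h : Lp ℂ 1 μ) = 0 := by
      refine eq_zero_of_weakStar_dense hA.dense fun b hb => ?_
      have hab := hA.star_mem _ (hA.mul_mem a ha b hb)
      obtain ⟨φ, hφ, -⟩ := hA.domain _ hab
      have h2 := hh φ ⟨_, hab, hφ⟩
      rw [L2.inner_def] at h2
      rw [← h2]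
      apply integral_congr_ae
      filter_upwards [hφ, Lp.coeFn_star (a • b : Lp ℂ ∞ μ), Lp.coeFn_lpSMul (r := ∞) a b,
        Lp.coeFn_lpSMul (r := 1) f h, hfa] with x e1 e2 e3 e4 e5
      rw [e4, Pi.smul_apply', e1, e2, Pi.star_apply, e3, Pi.smul_apply', e5]
      simp
      ring
    filter_upwards [Lp.coeFn_lpSMul (r := 1) f h, hfa, Lp.coeFn_zero ℂ 1 μ] with x e1 e2 e3
    rw [h1, e3, Pi.smul_apply', e2] at e1
    exact e1.symm
  have h3 : (star h • h : Lp ℂ 1 μ) = 0 := by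
    refine eq_zero_of_weakStar_dense hA.dense fun a ha => ?_
    rw [integral_eq_zero_of_ae]
    filter_upwards [key a ha, coeFn_star_smul h h] with x e1 e2
    rw [e2, mul_assoc, mul_comm (h x), e1, mul_zero]
    rfl
  have h4 := tau_nsq h
  rw [nsq, h3, map_zero, map_zero] at h4
  simpa using h4.symm

lemma op_mem_algL2 (hA : T.IsAdmissibleAlgebra A) {t : ℝ} (ht : 0 ≤ t) {f : Lp ℂ 2 μ}
    (hf : f ∈ algL2 A) : T.op 2 t f ∈ algL2 A := by
  obtain ⟨a, ha, hfa⟩ := hf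
  exact ⟨_, hA.op_mem t ht a ha, T.compat 2 ∞ t ht f a hfa⟩

variable (T)

/-! ### The variance form -/

/-- `T_t |f|² - |T_t f|²`. -/
def varL (t : ℝ) (f : Lp ℂ 2 μ) : Lp ℝ 1 μ := T.P t (nsq f) - nsq (T.op 2 t f)

lemma varL_nonneg {t : ℝ} (ht : 0 ≤ t) (f : Lp ℂ 2 μ) : 0 ≤ T.varL t f :=
  sub_nonneg.2 (T.nsq_op_le ht f)

lemma tau_varL {t : ℝ} (ht : 0 ≤ t) (f : Lp ℂ 2 μ) :
    tau (T.varL t f) = ‖f‖ ^ 2 - ‖T.op 2 t f‖ ^ 2 := by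
  rw [varL, map_sub, T.tau_P ht, tau_nsq, tau_nsq]

lemma varL_neg (t : ℝ) (f : Lp ℂ 2 μ) : T.varL t (-f) = T.varL t f := by
  have h : ∀ g : Lp ℂ 2 μ, nsq (-g) = nsq g := by
    intro g
    apply Lp.ext
    filter_upwards [coeFn_nsq g, coeFn_nsq (-g), Lp.coeFn_neg g] with x h1 h2 h3
    rw [h1, h2, h3, Pi.neg_apply, norm_neg]
  rw [varL, varL, map_neg, h, h]

/-- The variance is a nonnegative L¹-valued quadratic form; the gap between the two sides is r times
the variance of a - r⁻¹d. -/
lemma varL_add_le {t : ℝ} (ht : 0 ≤ t) (a d : Lp ℂ 2 μ) {r : ℝ} (hr : 0 < r) :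
    T.varL t (a + d) ≤ (1 + r) • T.varL t a + (1 + r⁻¹) • T.varL t d := by
  have h : T.varL t (a + d) = (1 + r) • T.varL t a + (1 + r⁻¹) • T.varL t d
      - r • T.varL t (a - ((r⁻¹ : ℝ) : ℂ) • d) := by
    simp only [varL]
    rw [nsq_add_eq a d hr.ne', map_add, nsq_add_eq _ _ hr.ne', map_sub, map_add, map_smul, map_smul,
      map_smul, map_sub (T.op 2 t), map_smul (T.op 2 t)]
    module
  rw [h]
  exact sub_le_self _ (smul_nonneg hr.le (T.varL_nonneg ht _))

lemma tau_varL_op_le {s t : ℝ} (hs : 0 < s) (ht : 0 < t) (z : Lp ℂ 2 μ) :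
    tau (T.varL t (T.op 2 s z)) ≤ t * (2 / s * ‖z‖ ^ 2) := by
  rw [T.tau_varL ht.le]
  set f := T.op 2 s z
  have h1 : ‖f‖ ≤ ‖z‖ := T.contraction 2 s hs.le z
  have h2 : ‖T.op 2 t f‖ ≤ ‖f‖ := T.contraction 2 t ht.le f
  have h3 : ‖T.op 2 t f - f‖ ≤ t / s * ‖z‖ := T.norm_op_sub_le hs ht z
  have h4 : ‖f‖ - ‖T.op 2 t f‖ ≤ t / s * ‖z‖ := by
    refine le_trans ?_ h3
    rw [norm_sub_rev]
    exact norm_sub_norm_le _ _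
  calc ‖f‖ ^ 2 - ‖T.op 2 t f‖ ^ 2 = (‖f‖ - ‖T.op 2 t f‖) * (‖f‖ + ‖T.op 2 t f‖) := by ring
    _ ≤ (t / s * ‖z‖) * (‖z‖ + ‖z‖) := by gcongr; exact h2.trans h1
    _ = _ := by ring

/-- The factor t on the right is the point: after division by t the bound is uniform, so convergence
of variance quotients passes from a dense set to all of L². It comes from the smoothing estimate,
and the parameter in `varL_add_le` is taken to be ‖x - b‖. -/
lemma norm_varL_sub_le {s t : ℝ} (hs : 0 < s) (ht : 0 < t) (x b : Lp ℂ 2 μ) :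
    ‖T.varL t (T.op 2 s x) - T.varL t (T.op 2 s b)‖ ≤
      t * (2 / s * (‖x - b‖ * (‖x‖ ^ 2 + ‖b‖ ^ 2 + ‖x - b‖ + 1))) := by
  rcases eq_or_ne x b with rfl | hne
  · simp
  set r := ‖x - b‖
  have hr : 0 < r := norm_pos_iff.2 (sub_ne_zero.2 hne)
  set f := T.op 2 s x with hf
  set a := T.op 2 s b with ha
  have h1 := T.varL_add_le ht.le a (f - a) hr
  have h2 := T.varL_add_le ht.le f (a - f) hr
  rw [add_sub_cancel] at h1 h2
  have h3 : T.varL t (a - f) = T.varL t (f - a) := by rw [← neg_sub, T.varL_neg]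
  rw [h3] at h2
  have hd : f - a = T.op 2 s (x - b) := by rw [map_sub]
  set B := r • (T.varL t a + T.varL t f) + (1 + r⁻¹) • T.varL t (f - a) with hB
  have hva := T.varL_nonneg ht.le a
  have hvf := T.varL_nonneg ht.le f
  have hvd := T.varL_nonneg ht.le (f - a)
  have hB0 : 0 ≤ B := add_nonneg (smul_nonneg hr.le (add_nonneg hva hvf))
    (smul_nonneg (by positivity) hvd)
  have hle : |T.varL t f - T.varL t a| ≤ |B| := by
    rw [abs_of_nonneg hB0]
    have e1 : T.varL t f - T.varL t a ≤ r • T.varL t a + (1 + r⁻¹) • T.varL t (f - a) := by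
      rw [sub_le_iff_le_add]
      refine h1.trans_eq ?_
      module
    have e2 : T.varL t a - T.varL t f ≤ r • T.varL t f + (1 + r⁻¹) • T.varL t (f - a) := by
      rw [sub_le_iff_le_add]
      refine h2.trans_eq ?_
      module
    refine abs_le'.2 ⟨e1.trans ?_, ?_⟩
    · rw [hB, smul_add, add_assoc]
      gcongr
      exact le_add_of_nonneg_left (smul_nonneg hr.le hvf)
    · rw [neg_sub]
      refine e2.trans ?_
      rw [hB, smul_add]
      gcongr
      exact le_add_of_nonneg_left (smul_nonneg hr.le hva)
  refine (norm_le_norm_of_abs_le_abs hle).trans ?_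
  rw [norm_eq_tau hB0, hB, map_add, map_smul, map_smul, map_add, smul_eq_mul, smul_eq_mul]
  have e1 := T.tau_varL_op_le hs ht b
  have e2 := T.tau_varL_op_le hs ht x
  have e3 := T.tau_varL_op_le hs ht (x - b)
  rw [← hd] at e3
  calc _ ≤ r * (t * (2 / s * ‖b‖ ^ 2) + t * (2 / s * ‖x‖ ^ 2)) +
        (1 + r⁻¹) * (t * (2 / s * r ^ 2)) := by gcongr
    _ = _ := by field_simp; ring

/-! ### The gradient form as derivative of the variance. -/

lemma ofReal_inv_smul {p : ℝ≥0∞} (t : ℝ) (y : Lp ℂ p μ) : ((t : ℂ)⁻¹) • y = t⁻¹ • y := by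
  apply Lp.ext
  filter_upwards [Lp.coeFn_smul ((t : ℂ)⁻¹) y, Lp.coeFn_smul t⁻¹ y] with x h1 h2
  rw [h1, h2, Pi.smul_apply, Pi.smul_apply, Complex.real_smul, smul_eq_mul, Complex.ofReal_inv]

/-- The gradient form on the diagonal, as an element of real `L^1`. -/
def gamL (f : Lp ℂ 2 μ) : Lp ℝ 1 μ := reL (T.Gam f f)

lemma gen_two_star {f : Lp ℂ 2 μ} (hf : T.InDomain 2 f) : T.gen 2 (star f) = star (T.gen 2 f) := by
  apply T.gen_eq
  have h := T.isGenerator_gen hf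
  rw [IsGenerator] at h ⊢
  have h1 := (conjL.continuous.tendsto (T.gen 2 f)).comp h
  rw [conjL_apply] at h1
  refine h1.congr' ?_
  filter_upwards [self_mem_nhdsWithin] with t ht
  have ht' : 0 ≤ t := le_of_lt ht
  rw [Function.comp, ofReal_inv_smul, ofReal_inv_smul, map_smul, map_sub, conjL_apply, conjL_apply, T.op_two_star ht']

lemma tendsto_nsq_slope {f : Lp ℂ 2 μ} (hf : T.InDomain 2 f) :
    Tendsto (fun t : ℝ => t⁻¹ • (nsq (T.op 2 t f) - nsq f)) (𝓝[>] 0)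
      (𝓝 (reL (star (T.gen 2 f) • f + star f • T.gen 2 f : Lp ℂ 1 μ))) := by
  have h := T.isGenerator_gen hf
  rw [IsGenerator] at h
  have h0 := T.continuous_zero f
  have h1 := (continuous_star_smul.tendsto (T.gen 2 f, f)).comp (h.prodMk_nhds h0)
  have h2 := (continuous_star_smul.tendsto (f, T.gen 2 f)).comp
    ((tendsto_const_nhds (x := f) (f := 𝓝[>] (0 : ℝ))).prodMk_nhds h)
  have h3 := (reL.continuous.tendsto _).comp (h1.add h2)
  refine h3.congr fun t => ?_
  simp only [Function.comp]
  rw [nsq_sub, ← map_smul]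
  congr 1
  apply Lp.ext
  set g := T.op 2 t f - f
  set c : ℂ := (t : ℂ)⁻¹ with hc
  filter_upwards [Lp.coeFn_add (star (c • g) • T.op 2 t f : Lp ℂ 1 μ) (star f • c • g : Lp ℂ 1 μ),
    Lp.coeFn_smul (t⁻¹) (star g • T.op 2 t f + star f • g : Lp ℂ 1 μ),
    Lp.coeFn_add (star g • T.op 2 t f : Lp ℂ 1 μ) (star f • g : Lp ℂ 1 μ),
    coeFn_star_smul (c • g) (T.op 2 t f), coeFn_star_smul f (c • g), coeFn_star_smul g (T.op 2 t f),
    coeFn_star_smul f g, Lp.coeFn_smul c g] with x e1 e2 e3 e4 e5 e6 e7 e8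
  rw [e1, e2, Pi.add_apply, Pi.smul_apply, e3, Pi.add_apply, e4, e5, e6, e7, e8, Pi.smul_apply,
    Complex.real_smul]
  simp [hc]
  ring

/-- If the variance quotients converge, then their limit is `2 Γ(f)`. -/
lemma gamL_eq_of_tendsto {f : Lp ℂ 2 μ} (hf : T.InDomain 2 f) {G : Lp ℝ 1 μ}
    (hG : Tendsto (fun t : ℝ => t⁻¹ • T.varL t f) (𝓝[>] 0) (𝓝 G)) : (2 : ℝ) • T.gamL f = G := by
  set D : Lp ℂ 1 μ := star (T.gen 2 f) • f + star f • T.gen 2 f with hD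
  have hDre : ofL (reL D) = D := by
    apply Lp.ext
    filter_upwards [coeFn_ofL (reL D), coeFn_reL D, coeFn_star_smul (T.gen 2 f) f,
      coeFn_star_smul f (T.gen 2 f), Lp.coeFn_add (star (T.gen 2 f) • f : Lp ℂ 1 μ)
        (star f • T.gen 2 f : Lp ℂ 1 μ)] with x e1 e2 e3 e4 e5
    rw [e1, e2, hD, e5, Pi.add_apply, e3, e4]
    apply Complex.ext <;> simp
    ring
  -- T_t|f|² - |f|² is the variance plus |T_t f|² - |f|². The second part contributes exactly the
  -- product-rule terms that the definition of Γ subtracts.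
  have hgen : T.IsGenerator 1 (star f • f : Lp ℂ 1 μ) (ofL G + D) := by
    have h1 := hG.add (T.tendsto_nsq_slope hf)
    have h2 := (ofL.continuous.tendsto _).comp h1
    rw [map_add, hDre] at h2
    refine h2.congr' ?_
    filter_upwards [self_mem_nhdsWithin] with t ht
    have ht' : 0 ≤ t := le_of_lt ht
    rw [Function.comp, ← smul_add, varL, sub_add_sub_cancel, map_smul, map_sub, ← T.op_ofL ht',
      ofL_nsq, ofReal_inv_smul]
  rw [gamL, Gam, T.gen_eq hgen, T.gen_two_star hf, hD]
  have : ofL G + (star (T.gen 2 f) • f + star f • T.gen 2 f) - star (T.gen 2 f) • f -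
      star f • T.gen 2 f = ofL G := by abel
  rw [this, ← Complex.ofReal_ofNat, ofReal_inv_smul, map_smul, reL_ofL,
    smul_smul]
  norm_num

end StandardSemigroup

end

noncomputable section

namespace StandardSemigroup

variable {M : Type*} [MeasurableSpace M] {μ : Measure M}

/-! ### Existence of the gradient form -/

/-- Lower semicontinuity of the `L^1`-norm under `L^2`-convergence. -/
lemma eLpNorm_one_le_of_tendsto {v : ℕ → Lp ℂ 2 μ} {w : Lp ℂ 2 μ}
    (h : Tendsto v atTop (𝓝 w)) {C : ℝ≥0∞} (hC : ∀ n, eLpNorm (v n) 1 μ ≤ C) :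
    eLpNorm w 1 μ ≤ C := by
  obtain ⟨ns, -, hns⟩ := (tendstoInMeasure_of_tendsto_Lp h).exists_seq_tendsto_ae
  refine (Lp.eLpNorm_lim_le_liminf_eLpNorm
    (fun n => Lp.aestronglyMeasurable (v (ns n))) w hns).trans ?_
  exact (liminf_le_liminf (Eventually.of_forall fun n => hC (ns n))).trans (by simp)

lemma ae_eq_sum {p q : ℝ≥0∞} {u : ℕ → Lp ℂ p μ} {v : ℕ → Lp ℂ q μ}
    (h : ∀ j, u j =ᵐ[μ] v j) (n : ℕ) :
    (∑ j ∈ Finset.range n, u j : Lp ℂ p μ) =ᵐ[μ] (∑ j ∈ Finset.range n, v j : Lp ℂ q μ) := by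
  induction n with
  | zero => exact (Lp.coeFn_zero ℂ p μ).trans (Lp.coeFn_zero ℂ q μ).symm
  | succ n ih =>
    rw [Finset.sum_range_succ, Finset.sum_range_succ]
    filter_upwards [ih, h n, Lp.coeFn_add (∑ j ∈ Finset.range n, u j) (u n),
      Lp.coeFn_add (∑ j ∈ Finset.range n, v j) (v n)] with x h1 h2 h3 h4
    rw [h3, h4, Pi.add_apply, Pi.add_apply, h1, h2]

lemma ae_eq_sub {p q : ℝ≥0∞} {u u' : Lp ℂ p μ} {v v' : Lp ℂ q μ} (h : u =ᵐ[μ] v)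
    (h' : u' =ᵐ[μ] v') : (u - u' : Lp ℂ p μ) =ᵐ[μ] (v - v' : Lp ℂ q μ) := by
  filter_upwards [h, h', Lp.coeFn_sub u u', Lp.coeFn_sub v v'] with x h1 h2 h3 h4
  rw [h3, h4, Pi.sub_apply, Pi.sub_apply, h1, h2]

lemma ae_eq_smul {p q : ℝ≥0∞} {u : Lp ℂ p μ} {v : Lp ℂ q μ} (c : ℂ) (h : u =ᵐ[μ] v) :
    (c • u : Lp ℂ p μ) =ᵐ[μ] (c • v : Lp ℂ q μ) := by
  filter_upwards [h, Lp.coeFn_smul c u, Lp.coeFn_smul c v] with x h1 h2 h3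
  rw [h2, h3, Pi.smul_apply, Pi.smul_apply, h1]

variable (T : StandardSemigroup μ)

lemma tendsto_op_one_zero (G : Lp ℂ 1 μ) : Tendsto (fun t => T.op 1 t G) (𝓝[>] 0) (𝓝 G) := by
  have h1 := (ofL.continuous.tendsto _).comp (T.tendsto_P_zero (reL G))
  have h2 := (ofL.continuous.tendsto _).comp (T.tendsto_P_zero (reL ((-Complex.I) • G)))
  have h3 := h1.add (h2.const_smul Complex.I)
  rw [← ofL_decomposition G] at h3
  refine h3.congr' ?_
  filter_upwards [self_mem_nhdsWithin] with t ht
  have ht' : 0 ≤ t := le_of_lt ht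
  rw [Function.comp, Function.comp, ← T.op_ofL ht', ← T.op_ofL ht', ← map_smul, ← map_add,
    ← ofL_decomposition]

/-- If `φ ∈ L^1` lies in the domain of the `L^2`-generator, with image in `L^1`, then it lies in the
domain of the `L^1`-generator. -/
lemma isGenerator_one_of_two {φ₂ h₂ : Lp ℂ 2 μ} {φ₁ h₁ : Lp ℂ 1 μ} (hφ : φ₁ =ᵐ[μ] φ₂)
    (hh : h₁ =ᵐ[μ] h₂) (hgen : T.IsGenerator 2 φ₂ h₂) : T.IsGenerator 1 φ₁ h₁ := by
  rw [IsGenerator, Metric.tendsto_nhdsWithin_nhds]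
  intro ε hε
  obtain ⟨δ, hδ, hδ'⟩ := Metric.tendsto_nhdsWithin_nhds.1 (T.tendsto_op_one_zero h₁) (ε / 2)
    (half_pos hε)
  refine ⟨δ, hδ, fun {t} ht0 htδ => ?_⟩
  have ht0 : 0 < t := ht0
  rw [Real.dist_eq, sub_zero, abs_of_pos ht0] at htδ
  set d : ℕ → ℝ := fun n => t / ((n : ℝ) + 1) with hd
  have hd0 : ∀ n, 0 < d n := fun n => by positivity
  have hjd : ∀ n j : ℕ, 0 ≤ (j : ℝ) * d n := fun n j => mul_nonneg (Nat.cast_nonneg _) (hd0 n).le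
  have hsmall : ∀ n : ℕ, ∀ j ∈ Finset.range (n + 1), ‖T.op 1 (j * d n) h₁ - h₁‖ ≤ ε / 2 := by
    intro n j hj
    rcases Nat.eq_zero_or_pos j with rfl | hj0
    · simp [T.op_zero]
      positivity
    · rw [← dist_eq_norm]
      have hpos : 0 < (j : ℝ) * d n := mul_pos (by exact_mod_cast hj0) (hd0 n)
      refine (hδ' hpos ?_).le
      rw [Real.dist_eq, sub_zero, abs_of_pos hpos]
      refine lt_of_le_of_lt ?_ htδ
      have : (j : ℝ) ≤ n + 1 := by
        have := Finset.mem_range.1 hj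
        exact_mod_cast this.le
      calc (j : ℝ) * d n ≤ ((n : ℝ) + 1) * d n := by gcongr
        _ = t := by rw [hd]; field_simp
  -- Riemann sums for t⁻¹ ∫_0^t (T_r h - h) dr, formed in L² and in L¹. In L² they converge to the
  -- difference quotient minus h; in L¹ they are uniformly small.
  set a : ℕ → Lp ℂ 2 μ := fun n =>
    (((n + 1 : ℕ) : ℂ)⁻¹) • ∑ j ∈ Finset.range (n + 1), (T.op 2 (j * d n) h₂ - h₂) with ha
  set b : ℕ → Lp ℂ 1 μ := fun n =>
    (((n + 1 : ℕ) : ℂ)⁻¹) • ∑ j ∈ Finset.range (n + 1), (T.op 1 (j * d n) h₁ - h₁) with hb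
  have hab : ∀ n, b n =ᵐ[μ] a n := fun n => ae_eq_smul _ (ae_eq_sum
    (fun j => ae_eq_sub (T.compat 1 2 _ (hjd n j) _ _ hh) hh) _)
  have hbn : ∀ n, ‖b n‖ ≤ ε / 2 := by
    intro n
    rw [hb, norm_smul, norm_inv, Complex.norm_natCast]
    have := norm_sum_le_of_le _ (hsmall n)
    rw [Finset.sum_const, Finset.card_range, nsmul_eq_mul] at this
    have hn : (0 : ℝ) < (n + 1 : ℕ) := by positivity
    rw [inv_mul_le_iff₀ hn]
    exact this
  have hlim : Tendsto a atTop (𝓝 (((t : ℂ)⁻¹) • (T.op 2 t φ₂ - φ₂) - h₂)) := by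
    have hdlim : Tendsto d atTop (𝓝[>] 0) := by
      rw [tendsto_nhdsWithin_iff]
      refine ⟨?_, Eventually.of_forall hd0⟩
      have := (tendsto_one_div_add_atTop_nhds_zero_nat (𝕜 := ℝ)).const_mul t
      simpa [hd, div_eq_mul_inv] using this
    have h1 := ((hgen.comp hdlim).sub_const h₂).norm
    rw [sub_self, norm_zero] at h1
    rw [tendsto_iff_norm_sub_tendsto_zero]
    refine squeeze_zero (fun n => norm_nonneg _) (fun n => ?_) h1
    simp only [Function.comp]
    set D := ((d n : ℂ)⁻¹) • (T.op 2 (d n) φ₂ - φ₂) with hD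
    have hn : ((n + 1 : ℕ) : ℂ) ≠ 0 := by exact_mod_cast Nat.succ_ne_zero n
    have htC : (t : ℂ) ≠ 0 := by exact_mod_cast ht0.ne'
    have e1 : T.op 2 t φ₂ - φ₂ = ∑ j ∈ Finset.range (n + 1), T.op 2 (j * d n) (T.op 2 (d n) φ₂ - φ₂) := by
      have e2 := Finset.sum_range_sub (fun j : ℕ => T.op 2 (j * d n) φ₂) (n + 1)
      have e3 : ((n + 1 : ℕ) : ℝ) * d n = t := by rw [hd]; push_cast; field_simp
      rw [e3, Nat.cast_zero, zero_mul, T.op_zero] at e2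
      rw [← e2]
      refine Finset.sum_congr rfl fun j _ => ?_
      rw [map_sub, ← T.op_add 2 _ _ (hjd n j) (hd0 n).le]
      congr 3
      push_cast; ring
    have e4 : a n - (((t : ℂ)⁻¹) • (T.op 2 t φ₂ - φ₂) - h₂) =
        (((n + 1 : ℕ) : ℂ)⁻¹) • ∑ j ∈ Finset.range (n + 1), T.op 2 (j * d n) (h₂ - D) := by
      have e5 : (t : ℂ)⁻¹ = (((n + 1 : ℕ) : ℂ)⁻¹) * (d n : ℂ)⁻¹ := by
        rw [hd]; push_cast; push_cast at hn; field_simp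
      have e6 : h₂ = (((n + 1 : ℕ) : ℂ)⁻¹) • ∑ j ∈ Finset.range (n + 1), h₂ := by
        rw [Finset.sum_const, Finset.card_range, ← Nat.cast_smul_eq_nsmul ℂ, smul_smul,
          inv_mul_cancel₀ hn, one_smul]
      rw [e1, e5, mul_smul, Finset.smul_sum (r := (d n : ℂ)⁻¹)]
      conv_lhs => enter [2, 2]; rw [e6]
      rw [ha, ← smul_sub, ← smul_sub, ← Finset.sum_sub_distrib, ← Finset.sum_sub_distrib]
      congr 1
      refine Finset.sum_congr rfl fun j _ => ?_
      rw [map_sub _ h₂ D, hD, map_smul]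
      abel
    rw [e4, norm_smul, norm_inv, Complex.norm_natCast, norm_sub_rev D]
    have hn' : (0 : ℝ) < (n + 1 : ℕ) := by positivity
    rw [inv_mul_le_iff₀ hn']
    have := norm_sum_le_of_le (Finset.range (n + 1)) (f := fun j : ℕ => T.op 2 (j * d n) (h₂ - D))
      (n := fun _ => ‖h₂ - D‖) fun j _ => T.contraction 2 _ (hjd n j) _
    rwa [Finset.sum_const, Finset.card_range, nsmul_eq_mul] at this
  have hfin := eLpNorm_one_le_of_tendsto (C := ENNReal.ofReal (ε / 2)) hlim fun n => by
    rw [← eLpNorm_congr_ae (hab n), ← Lp.enorm_def, ← ofReal_norm]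
    exact ENNReal.ofReal_le_ofReal (hbn n)
  have heq : (((t : ℂ)⁻¹) • (T.op 1 t φ₁ - φ₁) - h₁ : Lp ℂ 1 μ) =ᵐ[μ]
      (((t : ℂ)⁻¹) • (T.op 2 t φ₂ - φ₂) - h₂ : Lp ℂ 2 μ) :=
    ae_eq_sub (ae_eq_smul _ (ae_eq_sub (T.compat 1 2 t ht0.le _ _ hφ) hφ)) hh
  rw [← eLpNorm_congr_ae heq, ← Lp.enorm_def, ← ofReal_norm,
    ENNReal.ofReal_le_ofReal_iff (half_pos hε).le] at hfin
  rw [dist_eq_norm]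
  linarith

variable {A : Submodule ℂ (Lp ℂ ∞ μ)}

variable {T} in
lemma inDomain_of_mem_algL2 (hA : T.IsAdmissibleAlgebra A) {f : Lp ℂ 2 μ} (hf : f ∈ algL2 A) :
    T.InDomain 2 f := by
  obtain ⟨a, ha, hfa⟩ := hf
  obtain ⟨f', hf', hd⟩ := hA.domain a ha
  rwa [Lp.ext (hfa.trans hf'.symm)]

variable {T} in
-- Since A is an algebra, |f|² lies in the domain of the L² generator. Its image is also in L¹,
-- because the L¹ norms of the difference quotients stay bounded. So |f|² is in the domain of the L¹
-- generator, and subtracting the slope of |T_t f|² leaves the variance quotient.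
lemma exists_tendsto_varL_of_mem_algL2 (hA : T.IsAdmissibleAlgebra A) {f : Lp ℂ 2 μ}
    (hf : f ∈ algL2 A) :
    ∃ G, Tendsto (fun t : ℝ => t⁻¹ • T.varL t f) (𝓝[>] 0) (𝓝 G) := by
  have hdom := inDomain_of_mem_algL2 hA hf
  obtain ⟨a, ha, hfa⟩ := hf
  obtain ⟨φ, hφ, hφd⟩ := hA.domain _ (hA.mul_mem _ (hA.star_mem a ha) a ha)
  have hgen := T.isGenerator_gen hφd
  set h := T.gen 2 φ
  have hslope := T.tendsto_nsq_slope hdom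
  have hφ₁ : (star f • f : Lp ℂ 1 μ) =ᵐ[μ] φ := by
    filter_upwards [coeFn_star_smul f f, hφ, Lp.coeFn_lpSMul (r := ∞) (star a) a, Lp.coeFn_star a,
      hfa] with x e1 e2 e3 e4 e5
    rw [e1, e2, e3, Pi.smul_apply', e4, Pi.star_apply, e5, smul_eq_mul]
  have heq : ∀ t : ℝ, 0 ≤ t → ((t : ℂ)⁻¹) • (T.op 1 t (star f • f : Lp ℂ 1 μ) - (star f • f : Lp ℂ 1 μ)) =
      ofL (t⁻¹ • T.varL t f + t⁻¹ • (nsq (T.op 2 t f) - nsq f)) := by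
    intro t ht
    rw [← smul_add, varL, sub_add_sub_cancel, map_smul, map_sub, ← T.op_ofL ht, ofL_nsq,
      ofReal_inv_smul]
  -- The variance quotient is nonnegative, so its L¹ norm is its integral. As T_t preserves
  -- integrals, this is minus the integral of the other summand, which explains the factor 2.
  have hbound : ∀ t : ℝ, 0 < t →
      ‖((t : ℂ)⁻¹) • (T.op 1 t (star f • f : Lp ℂ 1 μ) - (star f • f : Lp ℂ 1 μ))‖ ≤
        2 * ‖t⁻¹ • (nsq (T.op 2 t f) - nsq f)‖ := by
    intro t ht
    rw [heq t ht.le, norm_ofL, two_mul]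
    refine (norm_add_le _ _).trans (add_le_add_left ?_ _)
    rw [norm_eq_tau (smul_nonneg (inv_nonneg.2 ht.le) (T.varL_nonneg ht.le f)), map_smul,
      T.tau_varL ht.le, ← tau_nsq, ← tau_nsq, ← map_sub, ← map_smul, tau_apply,
      L1.norm_eq_integral_norm, ← neg_sub (nsq (T.op 2 t f)), smul_neg]
    set F := t⁻¹ • (nsq (T.op 2 t f) - nsq f)
    rw [integral_congr_ae (Lp.coeFn_neg F)]
    apply integral_mono ((L1.integrable_coeFn F).neg) (L1.integrable_coeFn F).norm
    intro x
    exact (neg_le_abs (F x))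
  set d : ℕ → ℝ := fun n => 1 / ((n : ℝ) + 1) with hd
  have hd0 : ∀ n, 0 < d n := fun n => by positivity
  have hdlim : Tendsto d atTop (𝓝[>] 0) := by
    rw [tendsto_nhdsWithin_iff]
    exact ⟨tendsto_one_div_add_atTop_nhds_zero_nat, Eventually.of_forall hd0⟩
  obtain ⟨C, hC⟩ := (hslope.comp hdlim).norm.bddAbove_range
  have hC' : ∀ n, ‖(d n)⁻¹ • (nsq (T.op 2 (d n) f) - nsq f)‖ ≤ C := fun n => hC ⟨n, rfl⟩
  have hmem : MemLp h 1 μ := by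
    refine ⟨Lp.aestronglyMeasurable h, ?_⟩
    refine (eLpNorm_one_le_of_tendsto (C := ENNReal.ofReal (2 * C)) (hgen.comp hdlim)
      fun n => ?_).trans_lt ENNReal.ofReal_lt_top
    simp only [Function.comp]
    rw [← eLpNorm_congr_ae (ae_eq_smul _ (ae_eq_sub (T.compat 1 2 _ (hd0 n).le _ _ hφ₁) hφ₁)),
      ← Lp.enorm_def, ← ofReal_norm]
    exact ENNReal.ofReal_le_ofReal ((hbound _ (hd0 n)).trans (by linarith [hC' n]))
  have hgen₁ := T.isGenerator_one_of_two hφ₁ hmem.coeFn_toLp hgen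
  refine ⟨_, (((reL.continuous.tendsto _).comp hgen₁).sub hslope).congr' ?_⟩
  filter_upwards [self_mem_nhdsWithin] with t ht
  have ht' : 0 ≤ t := le_of_lt ht
  rw [Function.comp, heq t ht', reL_ofL, add_sub_cancel_right]

lemma exists_tendsto_of_approx {ι X : Type*} [PseudoMetricSpace X] [CompleteSpace X]
    {l : Filter ι} [l.NeBot] {F : ι → X}
    (h : ∀ ε > 0, ∃ F' : ι → X, (∀ᶠ i in l, dist (F i) (F' i) < ε) ∧ ∃ y, Tendsto F' l (𝓝 y)) :
    ∃ y, Tendsto F l (𝓝 y) := by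
  apply CompleteSpace.complete
  rw [Metric.cauchy_iff]
  refine ⟨inferInstance, fun ε hε => ?_⟩
  obtain ⟨F', h1, y, hy⟩ := h (ε / 4) (by positivity)
  have h2 := Metric.tendsto_nhds.1 hy (ε / 4) (by positivity)
  refine ⟨F '' {i | dist (F i) (F' i) < ε / 4 ∧ dist (F' i) y < ε / 4},
    image_mem_map (h1.and h2), ?_⟩
  rintro _ ⟨i, hi, rfl⟩ _ ⟨j, hj, rfl⟩
  have a1 := dist_triangle (F i) (F' i) y
  have a2 := dist_triangle (F j) (F' j) y
  have a3 := dist_triangle_right (F i) (F j) y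
  linarith [hi.1, hi.2, hj.1, hj.2]

lemma continuous_bound (x : Lp ℂ 2 μ) (s : ℝ) :
    Tendsto (fun b : Lp ℂ 2 μ => 2 / s * (‖x - b‖ * (‖x‖ ^ 2 + ‖b‖ ^ 2 + ‖x - b‖ + 1))) (𝓝 x)
      (𝓝 0) := by
  have : Continuous fun b : Lp ℂ 2 μ =>
    2 / s * (‖x - b‖ * (‖x‖ ^ 2 + ‖b‖ ^ 2 + ‖x - b‖ + 1)) := by fun_prop
  simpa using this.tendsto x

lemma norm_inv_smul_varL_sub_le {s t : ℝ} (hs : 0 < s) (ht : 0 < t) (x b : Lp ℂ 2 μ) :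
    ‖t⁻¹ • T.varL t (T.op 2 s x) - t⁻¹ • T.varL t (T.op 2 s b)‖ ≤
      2 / s * (‖x - b‖ * (‖x‖ ^ 2 + ‖b‖ ^ 2 + ‖x - b‖ + 1)) := by
  rw [← smul_sub, norm_smul, norm_inv, Real.norm_eq_abs, abs_of_pos ht, inv_mul_le_iff₀ ht]
  exact T.norm_varL_sub_le hs ht x b

variable {T} in
/-- The variance quotients converge to `2 Γ` on the range of `T_s`. -/
lemma tendsto_varL (hA : T.IsAdmissibleAlgebra A) {s : ℝ} (hs : 0 < s) (x : Lp ℂ 2 μ) :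
    Tendsto (fun t : ℝ => t⁻¹ • T.varL t (T.op 2 s x)) (𝓝[>] 0)
      (𝓝 ((2 : ℝ) • T.gamL (T.op 2 s x))) := by
  have h : ∃ G, Tendsto (fun t : ℝ => t⁻¹ • T.varL t (T.op 2 s x)) (𝓝[>] 0) (𝓝 G) := by
    -- For b ∈ A the quotients at T_s b converge because T_s b stays in A, and those at T_s x are
    -- close to them uniformly in t.
    refine exists_tendsto_of_approx fun ε hε => ?_
    have h1 := (continuous_bound x s).eventually (gt_mem_nhds hε)
    obtain ⟨b, hbA, hb⟩ := (dense_algL2 hA).inter_nhds_nonempty h1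
    refine ⟨_, ?_, exists_tendsto_varL_of_mem_algL2 hA (op_mem_algL2 hA hs.le hbA)⟩
    filter_upwards [self_mem_nhdsWithin] with t ht
    rw [dist_eq_norm]
    exact (T.norm_inv_smul_varL_sub_le hs ht x b).trans_lt hb
  obtain ⟨G, hG⟩ := h
  rwa [T.gamL_eq_of_tendsto (T.inDomain_op hs x) hG]

variable {T} in
lemma gamL_nonneg (hA : T.IsAdmissibleAlgebra A) {s : ℝ} (hs : 0 < s) (x : Lp ℂ 2 μ) :
    0 ≤ T.gamL (T.op 2 s x) := by
  have h : 0 ≤ (2 : ℝ) • T.gamL (T.op 2 s x) := by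
    refine ge_of_tendsto (tendsto_varL hA hs x) ?_
    filter_upwards [self_mem_nhdsWithin] with t ht
    have ht' : 0 ≤ t := le_of_lt ht
    exact smul_nonneg (inv_nonneg.2 ht') (T.varL_nonneg ht' _)
  have := smul_nonneg (by norm_num : (0 : ℝ) ≤ 2⁻¹) h
  rwa [smul_smul, inv_mul_cancel₀ (by norm_num), one_smul] at this

variable {T} in
lemma continuous_gamL_op (hA : T.IsAdmissibleAlgebra A) {s : ℝ} (hs : 0 < s) :
    Continuous fun x : Lp ℂ 2 μ => T.gamL (T.op 2 s x) := by
  have h : Continuous fun x : Lp ℂ 2 μ => (2 : ℝ) • T.gamL (T.op 2 s x) := by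
    rw [continuous_iff_continuousAt]
    intro x
    rw [ContinuousAt, tendsto_iff_norm_sub_tendsto_zero]
    refine squeeze_zero (fun b => norm_nonneg _) (fun b => ?_) (continuous_bound x s)
    rw [norm_sub_rev]
    refine le_of_tendsto ((tendsto_varL hA hs x).sub (tendsto_varL hA hs b)).norm ?_
    filter_upwards [self_mem_nhdsWithin] with t ht
    exact T.norm_inv_smul_varL_sub_le hs ht x b
  refine (h.const_smul (2⁻¹ : ℝ)).congr fun x => ?_
  simp [smul_smul]

variable {T} in
/-- The curvature condition extends to the range of `T_s`. -/
lemma gamL_op_le (hA : T.IsAdmissibleAlgebra A) (hG : T.Gam2Nonneg A) {s v : ℝ} (hs : 0 < s)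
    (hv : 0 ≤ v) (x : Lp ℂ 2 μ) :
    T.gamL (T.op 2 (s + v) x) ≤ T.P v (T.gamL (T.op 2 s x)) := by
  rcases hv.eq_or_lt with rfl | hv0
  · rw [add_zero, T.P_zero]
  have hcl : IsClosed {x : Lp ℂ 2 μ | T.gamL (T.op 2 (s + v) x) ≤ T.P v (T.gamL (T.op 2 s x))} :=
    isClosed_le (continuous_gamL_op hA (by positivity))
      ((T.P v).continuous.comp (continuous_gamL_op hA hs))
  refine hcl.closure_subset_iff.2 ?_ (dense_algL2 hA x)
  intro b hb
  have h := hG v hv0 _ (op_mem_algL2 hA hs.le hb)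
  rw [← T.op_add 2 v s hv hs.le, add_comm v s] at h
  change T.gamL (T.op 2 (s + v) b) ≤ T.P v (T.gamL (T.op 2 s b))
  rw [← Lp.coeFn_le, gamL, gamL, ← T.reL_op hv]
  filter_upwards [h, coeFn_reL (T.Gam (T.op 2 (s + v) b) (T.op 2 (s + v) b)),
    coeFn_reL (T.op 1 v (T.Gam (T.op 2 s b) (T.op 2 s b)))] with y h1 h2 h3
  rw [h2, h3]
  exact h1

end StandardSemigroup

end

/-! ### Order properties of L¹-valued integrals; orbits and their gradient forms. -/

noncomputable section

namespace StandardSemigroup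

variable {M : Type*} [MeasurableSpace M] {μ : Measure M}

lemma intervalIntegral_mono_L1 {F G : ℝ → Lp ℝ 1 μ} {a b : ℝ} (hab : a ≤ b)
    (hF : IntervalIntegrable F volume a b) (hG : IntervalIntegrable G volume a b)
    (h : ∀ v ∈ Set.Icc a b, F v ≤ G v) : ∫ v in a..b, F v ≤ ∫ v in a..b, G v := by
  rw [intervalIntegral.integral_of_le hab, intervalIntegral.integral_of_le hab]
  exact setIntegral_mono_on hF.1 hG.1 measurableSet_Ioc
    fun v hv => h v (Set.Ioc_subset_Icc_self hv)

lemma intervalIntegral_nonneg_L1 {F : ℝ → Lp ℝ 1 μ} {a b : ℝ} (hab : a ≤ b)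
    (h : ∀ v ∈ Set.Icc a b, 0 ≤ F v) : 0 ≤ ∫ v in a..b, F v := by
  rw [intervalIntegral.integral_of_le hab]
  refine integral_nonneg_of_ae ((ae_restrict_iff' measurableSet_Ioc).2 (ae_of_all _ fun v hv => ?_))
  exact h v (Set.Ioc_subset_Icc_self hv)

variable (T : StandardSemigroup μ)

/-! ### Orbits -/

/-- A curve in `L^2`, defined at positive times, that is an orbit of the semigroup. -/
def IsOrbit (u : ℝ → Lp ℂ 2 μ) : Prop :=
  ∀ s t : ℝ, 0 < s → 0 ≤ t → u (s + t) = T.op 2 t (u s)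

lemma isOrbit_op (g : Lp ℂ 2 μ) : T.IsOrbit fun s => T.op 2 s g := by
  intro s t hs ht
  simp only
  rw [add_comm, T.op_add 2 t s ht hs.le]

variable {T} {A : Submodule ℂ (Lp ℂ ∞ μ)} {u : ℝ → Lp ℂ 2 μ}

namespace IsOrbit

lemma eq_op (hu : T.IsOrbit u) {r s : ℝ} (hr : 0 < r) (hrs : r ≤ s) :
    u s = T.op 2 (s - r) (u r) := by
  rw [← hu r (s - r) hr (sub_nonneg.2 hrs), add_sub_cancel]

lemma eq_op_half (hu : T.IsOrbit u) {s : ℝ} (hs : 0 < s) : u s = T.op 2 (s / 2) (u (s / 2)) := by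
  rw [← hu _ _ (half_pos hs) (half_pos hs).le, add_halves]

lemma inDomain (hu : T.IsOrbit u) {s : ℝ} (hs : 0 < s) : T.InDomain 2 (u s) := by
  rw [hu.eq_op_half hs]
  exact T.inDomain_op (half_pos hs) _

lemma continuousOn (hu : T.IsOrbit u) : ContinuousOn u (Set.Ioi 0) := by
  intro s hs
  have hs : 0 < s := hs
  apply ContinuousAt.continuousWithinAt
  have h1 : ∀ᶠ v in 𝓝 s, s / 2 < v := lt_mem_nhds (half_lt_self hs)
  have h2 : Tendsto (fun v => T.R (v - s / 2) (u (s / 2))) (𝓝 s) (𝓝 (T.R (s - s / 2) (u (s / 2)))) :=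
    T.isContractionSemigroup_R.tendsto_apply (h1.mono fun v hv => sub_nonneg.2 hv.le)
      (by linarith) ((continuous_id.sub continuous_const).tendsto s) tendsto_const_nhds
  rw [ContinuousAt, hu.eq_op (half_pos hs) (half_le_self hs.le)]
  refine h2.congr' ?_
  filter_upwards [h1] with v hv
  exact (hu.eq_op (half_pos hs) hv.le).symm

lemma gamL_nonneg (hu : T.IsOrbit u) (hA : T.IsAdmissibleAlgebra A) {s : ℝ} (hs : 0 < s) :
    0 ≤ T.gamL (u s) := by
  rw [hu.eq_op_half hs]
  exact StandardSemigroup.gamL_nonneg hA (half_pos hs) _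

lemma continuousOn_gamL (hu : T.IsOrbit u) (hA : T.IsAdmissibleAlgebra A) :
    ContinuousOn (fun s => T.gamL (u s)) (Set.Ioi 0) := by
  intro s hs
  have hs : 0 < s := hs
  apply ContinuousAt.continuousWithinAt
  have h1 : ∀ᶠ v in 𝓝 s, s / 2 < v := lt_mem_nhds (half_lt_self hs)
  have h2 : Tendsto (fun v => u (v - s / 2)) (𝓝 s) (𝓝 (u (s / 2))) := by
    have h3 := hu.continuousOn.continuousAt (Ioi_mem_nhds (half_pos hs))
    have h4 : Tendsto (fun v : ℝ => v - s / 2) (𝓝 s) (𝓝 (s / 2)) := by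
      have : Continuous fun v : ℝ => v - s / 2 := by fun_prop
      simpa [sub_half] using this.tendsto s
    exact h3.tendsto.comp h4
  have h5 := ((continuous_gamL_op hA (half_pos hs)).tendsto (u (s / 2))).comp h2
  rw [← hu.eq_op_half hs] at h5
  refine h5.congr' ?_
  filter_upwards [h1] with v hv
  rw [Function.comp, ← hu _ _ (sub_pos.2 hv) (half_pos hs).le, sub_add_cancel]

lemma gamL_le (hu : T.IsOrbit u) (hA : T.IsAdmissibleAlgebra A) (hG : T.Gam2Nonneg A) {s v : ℝ}
    (hs : 0 < s) (hv : 0 ≤ v) : T.gamL (u (s + v)) ≤ T.P v (T.gamL (u s)) := by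
  have h := gamL_op_le hA hG (half_pos hs) hv (u (s / 2))
  rw [← hu.eq_op_half hs, ← hu _ _ (half_pos hs) (by positivity), ← add_assoc, add_halves] at h
  exact h

lemma tendsto_varL (hu : T.IsOrbit u) (hA : T.IsAdmissibleAlgebra A) {s : ℝ} (hs : 0 < s) :
    Tendsto (fun t : ℝ => t⁻¹ • T.varL t (u s)) (𝓝[>] 0) (𝓝 ((2 : ℝ) • T.gamL (u s))) := by
  rw [hu.eq_op_half hs]
  exact StandardSemigroup.tendsto_varL hA (half_pos hs) _

/-- The curve T_{δ-v}|u_{s+v}|² has right derivative -2 T_{δ-v}Γ(u_{s+v}), so the variance is the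
integral of 2 T_{δ-v}Γ(u_{s+v}) over [0, δ]. The curvature condition bounds each integrand below by
2Γ(u_{s+δ}). -/
lemma smul_gamL_le_varL (hu : T.IsOrbit u) (hA : T.IsAdmissibleAlgebra A) (hG : T.Gam2Nonneg A)
    {s δ : ℝ} (hs : 0 < s) (hδ : 0 ≤ δ) :
    δ • (2 : ℝ) • T.gamL (u (s + δ)) ≤ T.varL δ (u s) := by
  set y : ℝ → Lp ℝ 1 μ := fun v => T.P (δ - v) (nsq (u (s + v))) with hy
  set y' : ℝ → Lp ℝ 1 μ := fun v => T.P (δ - v) ((2 : ℝ) • T.gamL (u (s + v))) with hy'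
  have hmaps : Set.MapsTo (fun v : ℝ => s + v) (Set.Icc 0 δ) (Set.Ioi 0) := fun v hv =>
    add_pos_of_pos_of_nonneg hs hv.1
  have hc1 : ContinuousOn (fun v => u (s + v)) (Set.Icc 0 δ) :=
    hu.continuousOn.comp (by fun_prop) hmaps
  have hcy : ContinuousOn y (Set.Icc 0 δ) :=
    T.isContractionSemigroup_P.continuousOn_apply (fun v hv => sub_nonneg.2 hv.2) (by fun_prop)
      (continuous_nsq.comp_continuousOn hc1)
  have hcy' : ContinuousOn y' (Set.Icc 0 δ) :=
    T.isContractionSemigroup_P.continuousOn_apply (fun v hv => sub_nonneg.2 hv.2) (by fun_prop)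
      (((hu.continuousOn_gamL hA).comp (by fun_prop) hmaps).const_smul (2 : ℝ))
  have hint : IntervalIntegrable y' volume 0 δ :=
    (hcy'.mono (by rw [Set.uIcc_of_le hδ])).intervalIntegrable
  have hderiv : ∀ v ∈ Set.Ioo (min 0 δ) (max 0 δ), HasDerivWithinAt y (-y' v) (Set.Ioi v) v := by
    intro v hv
    rw [min_eq_left hδ, max_eq_right hδ] at hv
    rw [hasDerivWithinAt_iff_tendsto_slope' (by simp)]
    have hsv : 0 < s + v := add_pos hs hv.1
    have hlim : Tendsto (fun w : ℝ => w - v) (𝓝[>] v) (𝓝[>] 0) := by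
      rw [tendsto_nhdsWithin_iff]
      refine ⟨?_, ?_⟩
      · have h0 : Continuous fun w : ℝ => w - v := by fun_prop
        have := h0.tendsto v
        rw [sub_self] at this
        exact this.mono_left nhdsWithin_le_nhds
      · filter_upwards [self_mem_nhdsWithin] with w hw
        exact sub_pos.2 (Set.mem_Ioi.1 hw)
    have hlt : ∀ᶠ w in 𝓝[>] v, w < δ := nhdsWithin_le_nhds (gt_mem_nhds hv.2)
    have h1 : Tendsto (fun w => T.P (δ - w) ((w - v)⁻¹ • T.varL (w - v) (u (s + v)))) (𝓝[>] v)
        (𝓝 (y' v)) := by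
      refine T.isContractionSemigroup_P.tendsto_apply (hlt.mono fun w hw => sub_nonneg.2 hw.le)
        (sub_nonneg.2 hv.2.le) ?_ ((hu.tendsto_varL hA hsv).comp hlim)
      have := (continuous_const (y := δ).sub continuous_id).tendsto v
      exact this.mono_left nhdsWithin_le_nhds
    refine h1.neg.congr' ?_
    filter_upwards [hlt, self_mem_nhdsWithin] with w hw hvw
    have hvw : v < w := hvw
    rw [slope_def_module, hy]
    simp only
    have e1 : u (s + w) = T.op 2 (w - v) (u (s + v)) := by
      rw [← hu _ _ hsv (sub_nonneg.2 hvw.le)]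
      congr 1; ring
    have e2 : T.P (δ - v) (nsq (u (s + v))) = T.P (δ - w) (T.P (w - v) (nsq (u (s + v)))) := by
      rw [← T.P_add (sub_nonneg.2 hw.le) (sub_nonneg.2 hvw.le)]
      congr 2; ring
    rw [e1, e2, varL, map_smul, ← map_sub, ← smul_neg, ← map_neg, neg_sub]
  have hftc := intervalIntegral.integral_eq_sub_of_hasDeriv_right
    (by rwa [Set.uIcc_of_le hδ]) hderiv hint.neg
  rw [intervalIntegral.integral_neg] at hftc
  have e : ∫ v in (0 : ℝ)..δ, y' v = T.varL δ (u s) := by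
    rw [← neg_inj, hftc, hy]
    simp only [sub_self, sub_zero, add_zero, T.P_zero, varL, neg_sub]
    rw [hu s δ hs hδ]
  rw [← e]
  have h2 := intervalIntegral_mono_L1 hδ
    (intervalIntegrable_const (c := (2 : ℝ) • T.gamL (u (s + δ)))) hint fun v hv => by
      rw [hy']
      simp only
      rw [map_smul]
      refine smul_le_smul_of_nonneg_left ?_ (by norm_num)
      have := hu.gamL_le hA hG (s := s + v) (v := δ - v) (add_pos_of_pos_of_nonneg hs hv.1)
        (sub_nonneg.2 hv.2)
      rwa [add_assoc, add_sub_cancel] at this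
  rwa [intervalIntegral.integral_const, sub_zero] at h2

end IsOrbit

/-! ### Accumulated gradients and summation by parts. -/

/-- Discrete form of `2 ∫_0^t T_{t-s} Γ(T_s g) ds ≤ T_t |g|² - |T_t g|²`. -/
lemma smul_accumulated_le_varL (hA : T.IsAdmissibleAlgebra A) (hG : T.Gam2Nonneg A)
    (g : Lp ℂ 2 μ) {s δ : ℝ} (hδ : 0 < δ) (hs : δ < s) {U : ℕ → Lp ℝ 1 μ}
    (hU0 : U 0 = T.gamL (T.op 2 s g))
    (hU : ∀ j : ℕ, U (j + 1) = T.P δ (U j) + T.gamL (T.op 2 (s + (j + 1 : ℕ) * δ) g)) (j : ℕ) :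
    δ • (2 : ℝ) • U j ≤ T.varL (s + j * δ) g := by
  have hu := T.isOrbit_op g
  have hs0 : 0 < s := hδ.trans hs
  induction j with
  | zero =>
    -- The margin δ < s leaves room to start one grid step earlier, at a positive time.
    have h1 := hu.smul_gamL_le_varL hA hG (s := s - δ) (δ := δ) (sub_pos.2 hs) hδ.le
    rw [sub_add_cancel] at h1
    rw [hU0, Nat.cast_zero, zero_mul, add_zero]
    refine h1.trans ?_
    have e1 : s = δ + (s - δ) := by ring
    rw [varL, varL, ← T.op_add 2 _ _ hδ.le (sub_pos.2 hs).le, add_sub_cancel]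
    conv_rhs => rw [e1, T.P_add hδ.le (sub_pos.2 hs).le, ← e1]
    exact sub_le_sub_right (T.P_mono hδ.le (T.nsq_op_le (sub_pos.2 hs).le g)) _
  | succ j ih =>
    have hsj : 0 < s + j * δ := by positivity
    have h1 := hu.smul_gamL_le_varL hA hG hsj hδ.le
    have e1 : s + (j + 1 : ℕ) * δ = s + j * δ + δ := by push_cast; ring
    have e2 : s + (j + 1 : ℕ) * δ = δ + (s + j * δ) := by push_cast; ring
    have h2 := T.P_mono hδ.le ih
    rw [map_smul, map_smul] at h2
    rw [hU, smul_add, smul_add, e1]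
    refine (add_le_add h2 h1).trans_eq ?_
    -- Cocycle identity: the variance of g at time δ + t is T_δ of its variance at time t plus the
    -- variance of T_t g at time δ.
    rw [← e1, e2, varL, varL, varL, map_sub, T.P_add hδ.le hsj.le, T.op_add 2 _ _ hδ.le hsj.le]
    abel

lemma integrable_mul_of_bdd {V K : Lp ℝ 1 μ} {c : ℝ} (hV : ∀ᵐ x ∂μ, |V x| ≤ c) :
    Integrable (fun x => V x * K x) μ :=
  (L1.integrable_coeFn K).bdd_mul (Lp.aestronglyMeasurable V) hV

variable (T) in
/-- Summation by parts against a bounded supermartingale. -/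
lemma sum_integral_mul_le {δ : ℝ} (hδ : 0 ≤ δ) {V U b : ℕ → Lp ℝ 1 μ} {c r : ℝ}
    (hc : 0 ≤ c) (hU0 : U 0 = b 0) (hU : ∀ j, U (j + 1) = T.P δ (U j) + b (j + 1))
    (hUc : ∀ j, ∀ᵐ x ∂μ, U j x ≤ c) (hV0 : ∀ j, 0 ≤ V j) (hVr : ∀ j, ∀ᵐ x ∂μ, |V j x| ≤ r)
    (hVs : ∀ j, T.P δ (V (j + 1)) ≤ V j) (n : ℕ) :
    ∑ j ∈ Finset.range n, ∫ x, V j x * b j x ∂μ ≤ c * tau (V 0) := by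
  have hle : ∀ (W : Lp ℝ 1 μ) (j : ℕ), 0 ≤ W → (∀ᵐ x ∂μ, |W x| ≤ r) →
      ∫ x, W x * U j x ∂μ ≤ c * tau W := by
    intro W j hW hWr
    rw [tau_apply, ← integral_const_mul]
    apply integral_mono_ae (integrable_mul_of_bdd hWr) ((L1.integrable_coeFn W).const_mul c)
    filter_upwards [hUc j, (Lp.coeFn_nonneg W).2 hW] with x h1 h2
    rw [mul_comm]
    exact mul_le_mul_of_nonneg_right h1 h2
  cases n with
  | zero =>
    simp only [Finset.range_zero, Finset.sum_empty]
    exact mul_nonneg hc (tau_nonneg (hV0 0))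
  | succ n =>
    have key : ∑ j ∈ Finset.range (n + 1), ∫ x, V j x * b j x ∂μ ≤
        c * (tau (V 0) - tau (V n)) + ∫ x, V n x * U n x ∂μ := by
      induction n with
      | zero => simp [hU0]
      | succ n ih =>
        rw [Finset.sum_range_succ]
        have e1 : ∫ x, V (n + 1) x * U (n + 1) x ∂μ =
            ∫ x, V (n + 1) x * T.P δ (U n) x ∂μ + ∫ x, V (n + 1) x * b (n + 1) x ∂μ := by
          rw [← integral_add (integrable_mul_of_bdd (hVr _)) (integrable_mul_of_bdd (hVr _))]
          apply integral_congr_ae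
          rw [hU]
          filter_upwards [Lp.coeFn_add (T.P δ (U n)) (b (n + 1))] with x hx
          rw [hx, Pi.add_apply, mul_add]
        -- Symmetry moves T_δ from U onto V. Then V_n - T_δ V_{n+1} ≥ 0 is paired with U_n ≤ c, and
        -- the bounds c(τ(V_n) - τ(V_{n+1})) telescope.
        rw [← T.integral_mul_P hδ _ _ (hVr _)] at e1
        have hPr : ∀ᵐ x ∂μ, |T.P δ (V (n + 1)) x| ≤ r := by
          filter_upwards [hVr n, (Lp.coeFn_le _ _).2 (hVs n),
            (Lp.coeFn_nonneg _).2 (T.P_nonneg hδ (hV0 (n + 1)))] with x h1 h2 h3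
          rw [abs_of_nonneg h3]
          exact h2.trans ((le_abs_self _).trans h1)
        have hdr : ∀ᵐ x ∂μ, |(V n - T.P δ (V (n + 1))) x| ≤ r := by
          filter_upwards [hVr n, (Lp.coeFn_le _ _).2 (hVs n),
            (Lp.coeFn_nonneg _).2 (T.P_nonneg hδ (hV0 (n + 1))),
            Lp.coeFn_sub (V n) (T.P δ (V (n + 1)))] with x h1 h2 h3 h4
          rw [h4, Pi.sub_apply, abs_of_nonneg (sub_nonneg.2 h2)]
          have h3 : 0 ≤ T.P δ (V (n + 1)) x := h3
          linarith [le_abs_self (V n x)]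
        have e2 := hle (V n - T.P δ (V (n + 1))) n (sub_nonneg.2 (hVs n)) hdr
        have e3 : ∫ x, (V n - T.P δ (V (n + 1))) x * U n x ∂μ =
            ∫ x, V n x * U n x ∂μ - ∫ x, T.P δ (V (n + 1)) x * U n x ∂μ := by
          rw [← integral_sub (integrable_mul_of_bdd (hVr _)) (integrable_mul_of_bdd hPr)]
          apply integral_congr_ae
          filter_upwards [Lp.coeFn_sub (V n) (T.P δ (V (n + 1)))] with x hx
          rw [hx, Pi.sub_apply, sub_mul]
        rw [e3, map_sub, T.tau_P hδ] at e2
        linarith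
    linarith [hle (V n) n (hV0 n) (hVr n)]

end StandardSemigroup

end

noncomputable section

namespace StandardSemigroup

variable {M : Type*} [MeasurableSpace M] {μ : Measure M}

/-! ### Integration against bounded weights -/

lemma exists_pairL {v : M → ℝ} (hv : AEStronglyMeasurable v μ) {c : ℝ} (hc : ∀ᵐ x ∂μ, |v x| ≤ c) :
    ∃ w : Lp ℝ ∞ μ, w =ᵐ[μ] v ∧ ∀ F : Lp ℝ 1 μ, pairL w F = ∫ x, v x * F x ∂μ := by
  have hm : MemLp v ∞ μ := memLp_top_of_bound hv c hc
  refine ⟨hm.toLp v, hm.coeFn_toLp, fun F => ?_⟩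
  rw [pairL_apply]
  apply integral_congr_ae
  filter_upwards [hm.coeFn_toLp] with x hx
  rw [hx]

lemma integral_mul_intervalIntegral {v : M → ℝ} (hv : AEStronglyMeasurable v μ) {c : ℝ}
    (hc : ∀ᵐ x ∂μ, |v x| ≤ c) {F : ℝ → Lp ℝ 1 μ} {a b : ℝ} (hF : IntervalIntegrable F volume a b) :
    ∫ x, v x * (∫ s in a..b, F s : Lp ℝ 1 μ) x ∂μ = ∫ s in a..b, ∫ x, v x * F s x ∂μ := by
  obtain ⟨w, -, hw⟩ := exists_pairL hv hc
  simp_rw [← hw]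
  exact ((pairL w).intervalIntegral_comp_comm hF).symm

/-! ### Weighted Cauchy–Schwarz inequality and variation of the pairing of two orbits. -/

variable (T : StandardSemigroup μ)

lemma varL_smul (t : ℝ) {θ : ℂ} (hθ : ‖θ‖ = 1) (f : Lp ℂ 2 μ) : T.varL t (θ • f) = T.varL t f := by
  have h : ∀ g : Lp ℂ 2 μ, nsq (θ • g) = nsq g := by
    intro g
    apply Lp.ext
    filter_upwards [coeFn_nsq g, coeFn_nsq (θ • g), Lp.coeFn_smul θ g] with x h1 h2 h3
    rw [h1, h2, h3, Pi.smul_apply, norm_smul, hθ, one_mul]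
  rw [varL, varL, map_smul, h, h]

/-- Weighted Cauchy-Schwarz inequality for the variance form. -/
lemma two_mul_norm_inner_sub_le {t : ℝ} (ht : 0 ≤ t) (a b : Lp ℂ 2 μ) {φ ψ : Lp ℝ ∞ μ}
    (hφ : ∀ᵐ x ∂μ, 0 < φ x) (hψ : ∀ᵐ x ∂μ, ψ x = (φ x)⁻¹) :
    2 * ‖inner ℂ a b - inner ℂ (T.op 2 t a) (T.op 2 t b)‖ ≤
      pairL ψ (T.varL t a) + pairL φ (T.varL t b) := by
  set z : ℂ := inner ℂ a b - inner ℂ (T.op 2 t a) (T.op 2 t b) with hz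
  obtain ⟨θ, hθ, hθz⟩ : ∃ θ : ℂ, ‖θ‖ = 1 ∧ θ * z = ‖z‖ := by
    rcases eq_or_ne z 0 with h | h
    · exact ⟨1, by simp, by simp [h]⟩
    · refine ⟨star z / ‖z‖, by rw [norm_div, norm_star]; simp [h], ?_⟩
      have hz' : (‖z‖ : ℂ) ≠ 0 := by exact_mod_cast norm_ne_zero_iff.2 h
      rw [div_mul_eq_mul_div, Complex.star_def, ← Complex.normSq_eq_conj_mul_self,
        Complex.normSq_eq_norm_sq]
      push_cast
      field_simp
  -- The polarised variance, after rotating b by the phase θ so that its integral is 2‖z‖.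
  set B := T.varL t (a + θ • b) - T.varL t a - T.varL t (θ • b) with hB
  have htau : tau B = 2 * ‖z‖ := by
    rw [hB, map_sub, map_sub, T.tau_varL ht, T.tau_varL ht, T.tau_varL ht, map_add, map_smul,
      @norm_add_sq ℂ, @norm_add_sq ℂ, inner_smul_right, inner_smul_right]
    have : (θ * z).re = ‖z‖ := by rw [hθz, Complex.ofReal_re]
    rw [hz, mul_sub, Complex.sub_re] at this
    simp only [RCLike.re_to_complex]
    rw [← hz] at this
    linarith
  -- Positive weights are parametrised as exp c, so that continuity in c gives one null set for all
  -- weights. A variable weight is then allowed: c = -log φ(x) at each point.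
  have h1 : ∀ c : ℝ, ∀ᵐ x ∂μ,
      0 ≤ Real.exp c * T.varL t a x + Real.exp (-c) * T.varL t b x - B x := by
    intro c
    have h2 := T.varL_add_le ht a (θ • b) (Real.exp_pos c)
    rw [← Lp.coeFn_le, ← Real.exp_neg, T.varL_smul t hθ b] at h2
    rw [T.varL_smul t hθ b] at hB
    filter_upwards [h2, Lp.coeFn_add ((1 + Real.exp c) • T.varL t a) ((1 + Real.exp (-c)) • T.varL t b),
      Lp.coeFn_smul (1 + Real.exp c) (T.varL t a), Lp.coeFn_smul (1 + Real.exp (-c)) (T.varL t b),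
      Lp.coeFn_sub (T.varL t (a + θ • b) - T.varL t a) (T.varL t b),
      Lp.coeFn_sub (T.varL t (a + θ • b)) (T.varL t a)] with x e1 e2 e3 e4 e5 e6
    rw [e2, Pi.add_apply, e3, e4, Pi.smul_apply, Pi.smul_apply, smul_eq_mul, smul_eq_mul] at e1
    rw [hB, e5, Pi.sub_apply, e6, Pi.sub_apply]
    linarith
  have h2 := ae_forall_nonneg_of_continuous (fun x => by fun_prop) h1
  rw [← htau, tau_apply, pairL_apply, pairL_apply,
    ← integral_add (integrable_mul_top _ _) (integrable_mul_top _ _)]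
  apply integral_mono_ae (L1.integrable_coeFn B)
    ((integrable_mul_top _ _).add (integrable_mul_top _ _))
  filter_upwards [h2, hφ, hψ] with x e1 e2 e3
  have := e1 (-Real.log (φ x))
  rw [neg_neg, Real.exp_neg, Real.exp_log e2, ← e3] at this
  rw [Pi.add_apply]
  linarith

variable {T} {A : Submodule ℂ (Lp ℂ ∞ μ)} {u w : ℝ → Lp ℂ 2 μ}

namespace IsOrbit

lemma hasDerivWithinAt (hu : T.IsOrbit u) {s : ℝ} (hs : 0 < s) :
    HasDerivWithinAt u (T.gen 2 (u s)) (Set.Ici s) s := by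
  rw [← hasDerivWithinAt_Ioi_iff_Ici, hasDerivWithinAt_iff_tendsto_slope' (by simp)]
  have hlim : Tendsto (fun v : ℝ => v - s) (𝓝[>] s) (𝓝[>] 0) := by
    rw [tendsto_nhdsWithin_iff]
    refine ⟨?_, ?_⟩
    · have h0 : Continuous fun v : ℝ => v - s := by fun_prop
      have := h0.tendsto s
      rw [sub_self] at this
      exact this.mono_left nhdsWithin_le_nhds
    · filter_upwards [self_mem_nhdsWithin] with v hv
      exact sub_pos.2 (Set.mem_Ioi.1 hv)
  refine ((T.isGenerator_gen (hu.inDomain hs)).comp hlim).congr' ?_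
  filter_upwards [self_mem_nhdsWithin] with v hv
  have hv : s < v := hv
  rw [Function.comp, slope_def_module, ofReal_inv_smul, ← hu.eq_op hs hv.le]

/-- The increments of `⟨u, w⟩` are controlled by the gradient forms of `u` and `w`, with an
arbitrary weight. -/
lemma norm_inner_sub_le (hu : T.IsOrbit u) (hw : T.IsOrbit w) (hA : T.IsAdmissibleAlgebra A)
    {φ : M → ℝ} (hφ : AEStronglyMeasurable φ μ) {m c : ℝ} (hm : 0 < m) (hφm : ∀ x, m ≤ φ x)
    (hφc : ∀ x, φ x ≤ c) {a b : ℝ} (ha : 0 < a) (hab : a ≤ b) :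
    ‖inner ℂ (u b) (w b) - inner ℂ (u a) (w a)‖ ≤
      ∫ x, (φ x)⁻¹ * (∫ s in a..b, T.gamL (u s) : Lp ℝ 1 μ) x ∂μ +
      ∫ x, φ x * (∫ s in a..b, T.gamL (w s) : Lp ℝ 1 μ) x ∂μ := by
  have hφ0 : ∀ x, 0 < φ x := fun x => hm.trans_le (hφm x)
  have hφb : ∀ x, |φ x| ≤ c := fun x => by rw [abs_of_pos (hφ0 x)]; exact hφc x
  have hψb : ∀ x, |(φ x)⁻¹| ≤ m⁻¹ := fun x => by
    rw [abs_of_pos (inv_pos.2 (hφ0 x))]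
    exact inv_anti₀ hm (hφm x)
  have hψ : AEStronglyMeasurable (fun x => (φ x)⁻¹) μ := hφ.aemeasurable.inv.aestronglyMeasurable
  obtain ⟨Φ, hΦ, hΦ'⟩ := exists_pairL hφ (ae_of_all _ hφb)
  obtain ⟨Ψ, hΨ, hΨ'⟩ := exists_pairL hψ (ae_of_all _ hψb)
  have hcu := hu.continuousOn_gamL hA
  have hcw := hw.continuousOn_gamL hA
  have hsub : Set.Icc a b ⊆ Set.Ioi 0 := fun s hs => ha.trans_le hs.1
  have hiu : IntervalIntegrable (fun s => T.gamL (u s)) volume a b :=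
    (hcu.mono (by rwa [Set.uIcc_of_le hab])).intervalIntegrable
  have hiw : IntervalIntegrable (fun s => T.gamL (w s)) volume a b :=
    (hcw.mono (by rwa [Set.uIcc_of_le hab])).intervalIntegrable
  rw [← hΦ', ← hΨ', ← (pairL Φ).intervalIntegral_comp_comm hiw,
    ← (pairL Ψ).intervalIntegral_comp_comm hiu]
  set β : ℝ → ℝ := fun s => pairL Ψ (T.gamL (u s)) + pairL Φ (T.gamL (w s)) with hβ
  have hβc : ContinuousOn β (Set.Ioi 0) :=
    ((pairL Ψ).continuous.comp_continuousOn hcu).add ((pairL Φ).continuous.comp_continuousOn hcw)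
  -- Constant extension to the left of a, so that the majorant is continuous on ℝ and its primitive
  -- is differentiable everywhere.
  set β' : ℝ → ℝ := fun s => β (max s a) with hβ'
  have hβ'c : Continuous β' := by
    rw [← continuousOn_univ]
    exact hβc.comp (by fun_prop) fun s _ => ha.trans_le (le_max_right s a)
  set y' : ℝ → ℂ := fun s => inner ℂ (u s) (T.gen 2 (w s)) + inner ℂ (T.gen 2 (u s)) (w s) with hy'
  have hderiv : ∀ s ∈ Set.Ico a b,
      HasDerivWithinAt (fun s => inner ℂ (u s) (w s) - inner ℂ (u a) (w a)) (y' s) (Set.Ici s) s := by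
    intro s hs
    have hs0 : 0 < s := ha.trans_le hs.1
    exact ((hu.hasDerivWithinAt hs0).inner ℂ (hw.hasDerivWithinAt hs0)).sub_const _
  have hbound : ∀ s ∈ Set.Ico a b, ‖y' s‖ ≤ β' s := by
    intro s hs
    have hs0 : 0 < s := ha.trans_le hs.1
    have h1 := (hu.hasDerivWithinAt hs0).inner ℂ (hw.hasDerivWithinAt hs0)
    rw [← hasDerivWithinAt_Ioi_iff_Ici, hasDerivWithinAt_iff_tendsto_slope' (by simp)] at h1
    have hlim : Tendsto (fun t : ℝ => s + t) (𝓝[>] 0) (𝓝[>] s) := by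
      rw [tendsto_nhdsWithin_iff]
      refine ⟨?_, ?_⟩
      · have h0 : Continuous fun t : ℝ => s + t := by fun_prop
        have := h0.tendsto 0
        rw [add_zero] at this
        exact this.mono_left nhdsWithin_le_nhds
      · filter_upwards [self_mem_nhdsWithin] with t ht
        exact lt_add_of_pos_right s ht
    have h2 := (h1.comp hlim).norm
    have h3 := (((pairL Ψ).continuous.tendsto _).comp (hu.tendsto_varL hA hs0)).add
      (((pairL Φ).continuous.tendsto _).comp (hw.tendsto_varL hA hs0))
    have h4 := h3.const_mul (2⁻¹ : ℝ)
    have e1 : 2⁻¹ * (pairL Ψ ((2 : ℝ) • T.gamL (u s)) + pairL Φ ((2 : ℝ) • T.gamL (w s))) = β' s := by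
      rw [map_smul, map_smul, hβ', hβ]
      simp only [smul_eq_mul, max_eq_left hs.1]
      ring
    rw [e1] at h4
    refine le_of_tendsto_of_tendsto h2 h4 ?_
    filter_upwards [self_mem_nhdsWithin] with t ht
    have ht : 0 < t := ht
    have h5 := T.two_mul_norm_inner_sub_le ht.le (u s) (w s) (φ := Φ) (ψ := Ψ)
      (by filter_upwards [hΦ] with x hx; rw [hx]; exact hφ0 x)
      (by filter_upwards [hΦ, hΨ] with x hx hx'; rw [hx, hx'])
    rw [← hu s t hs0 ht.le, ← hw s t hs0 ht.le] at h5
    simp only [Function.comp]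
    rw [slope_def_module, add_sub_cancel_left, norm_smul, norm_inv, Real.norm_eq_abs, abs_of_pos ht,
      norm_sub_rev, map_smul, map_smul, smul_eq_mul, smul_eq_mul, ← mul_add]
    have ht' : 0 < t⁻¹ := inv_pos.2 ht
    nlinarith
  have hcont : ContinuousOn (fun s => inner ℂ (u s) (w s) - inner ℂ (u a) (w a)) (Set.Icc a b) :=
    ((hu.continuousOn.mono hsub).inner (hw.continuousOn.mono hsub)).sub continuousOn_const
  have h := image_norm_le_of_norm_deriv_right_le_deriv_boundary hcont hderiv
    (B := fun x => ∫ s in a..x, β' s) (B' := β') (by simp)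
    (fun x => hβ'c.integral_hasStrictDerivAt a x |>.hasDerivAt) hbound
    (Set.right_mem_Icc.2 hab)
  refine h.trans_eq ?_
  have hcu' : IntervalIntegrable (fun s => pairL Ψ (T.gamL (u s))) volume a b :=
    ((pairL Ψ).continuous.comp_continuousOn
      (hcu.mono (by rwa [Set.uIcc_of_le hab]))).intervalIntegrable
  have hcw' : IntervalIntegrable (fun s => pairL Φ (T.gamL (w s))) volume a b :=
    ((pairL Φ).continuous.comp_continuousOn
      (hcw.mono (by rwa [Set.uIcc_of_le hab]))).intervalIntegrable
  rw [← intervalIntegral.integral_add hcu' hcw']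
  refine intervalIntegral.integral_congr fun s hs => ?_
  rw [Set.uIcc_of_le hab] at hs
  simp only [hβ', hβ, max_eq_left hs.1]

end IsOrbit

end StandardSemigroup

end

noncomputable section

namespace StandardSemigroup

variable {M : Type*} [MeasurableSpace M] {μ : Measure M} {T : StandardSemigroup μ}
  {A : Submodule ℂ (Lp ℂ ∞ μ)} {u : ℝ → Lp ℂ 2 μ}

/-! ### Truncated square functions -/

variable (T) in
/-- The semigroup does not decrease the integral of the square root. -/
lemma lintegral_sqrt_le_P {t : ℝ} (ht : 0 ≤ t) {h : Lp ℝ 1 μ} (hh : 0 ≤ h) :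
    ∫⁻ x, ENNReal.ofReal √(h x) ∂μ ≤ ∫⁻ x, ENNReal.ofReal √(T.P t h x) ∂μ := by
  have hh' := (Lp.coeFn_nonneg h).2 hh
  have hmeas : AEMeasurable h μ := (Lp.aestronglyMeasurable h).aemeasurable
  -- √h need not be integrable, but this minorant is, being at most nh. Each v_n satisfies ∫v_n =
  -- ∫T_t v_n ≤ ∫√(T_t h), and v_n increases to √h.
  set v : ℕ → M → ℝ := fun n x => min √(h x) (n * h x) with hv
  have hvm : ∀ n, AEMeasurable (v n) μ := fun n => hmeas.sqrt.min (hmeas.const_mul _)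
  have hv0 : ∀ n, ∀ᵐ x ∂μ, 0 ≤ v n x := fun n => by
    filter_upwards [hh'] with x hx
    exact le_min (Real.sqrt_nonneg _) (mul_nonneg (Nat.cast_nonneg n) hx)
  have hvi : ∀ n, MemLp (v n) 1 μ := fun n => by
    rw [memLp_one_iff_integrable]
    refine ((L1.integrable_coeFn h).const_mul (n : ℝ)).mono' (hvm n).aestronglyMeasurable ?_
    filter_upwards [hv0 n] with x hx
    rw [Real.norm_of_nonneg hx]
    exact min_le_right _ _
  have hle : ∀ n, ∫⁻ x, ENNReal.ofReal (v n x) ∂μ ≤ ∫⁻ x, ENNReal.ofReal √(T.P t h x) ∂μ := by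
    intro n
    set V := (hvi n).toLp (v n)
    have hV : V =ᵐ[μ] v n := (hvi n).coeFn_toLp
    have hV0 : 0 ≤ V := by
      rw [← Lp.coeFn_nonneg]
      filter_upwards [hV, hv0 n] with x h1 h2
      rw [h1]; exact h2
    have h1 := T.sq_P_le ht (V := V) (h := h) (by
      filter_upwards [hV, hh', hv0 n] with x e1 e2 e3
      rw [e1, ← Real.sq_sqrt e2]
      exact pow_le_pow_left₀ e3 (min_le_left _ _) 2)
    have h2 := T.tau_P ht V
    have hPV := (Lp.coeFn_nonneg _).2 (T.P_nonneg ht hV0)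
    calc ∫⁻ x, ENNReal.ofReal (v n x) ∂μ = ∫⁻ x, ENNReal.ofReal (V x) ∂μ := by
          apply lintegral_congr_ae
          filter_upwards [hV] with x hx
          rw [hx]
      _ = ENNReal.ofReal (tau V) := by
          rw [tau_apply, ofReal_integral_eq_lintegral_ofReal (L1.integrable_coeFn V)
            ((Lp.coeFn_nonneg V).2 hV0)]
      _ = ∫⁻ x, ENNReal.ofReal (T.P t V x) ∂μ := by
          rw [← h2, tau_apply, ofReal_integral_eq_lintegral_ofReal (L1.integrable_coeFn _) hPV]
      _ ≤ _ := by
          apply lintegral_mono_ae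
          filter_upwards [h1] with x hx
          exact ENNReal.ofReal_le_ofReal (Real.le_sqrt_of_sq_le hx)
  have hsup : ∫⁻ x, ENNReal.ofReal √(h x) ∂μ = ⨆ n, ∫⁻ x, ENNReal.ofReal (v n x) ∂μ := by
    rw [← lintegral_iSup' (fun n => (hvm n).ennreal_ofReal)]
    · apply lintegral_congr_ae
      filter_upwards [hh'] with x hx
      have hx : 0 ≤ h x := hx
      apply le_antisymm
      · rcases hx.eq_or_lt with h0 | h0
        · rw [← h0]; simp
        · obtain ⟨n, hn⟩ := exists_nat_ge (√(h x) / h x)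
          refine le_iSup_of_le n (ENNReal.ofReal_le_ofReal (le_min le_rfl ?_))
          rwa [div_le_iff₀ h0] at hn
      · exact iSup_le fun n => ENNReal.ofReal_le_ofReal (min_le_left _ _)
    · filter_upwards [hh'] with x hx i j hij
      have hx : 0 ≤ h x := hx
      have : (i : ℝ) ≤ j := by exact_mod_cast hij
      exact ENNReal.ofReal_le_ofReal (min_le_min_left _ (by gcongr))
  rw [hsup]
  exact iSup_le hle

namespace IsOrbit

lemma intervalIntegrable_gamL (hu : T.IsOrbit u) (hA : T.IsAdmissibleAlgebra A) {a b : ℝ}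
    (ha : 0 < a) (hb : 0 < b) : IntervalIntegrable (fun v => T.gamL (u v)) volume a b :=
  ((hu.continuousOn_gamL hA).mono fun _ hv => (lt_min ha hb).trans_le hv.1).intervalIntegrable

lemma intervalIntegrable_P_gamL (hu : T.IsOrbit u) (hA : T.IsAdmissibleAlgebra A) {a b c : ℝ}
    (ha : 0 < a) (hab : a ≤ b) (hca : c ≤ a) :
    IntervalIntegrable (fun v => T.P (v - c) (T.gamL (u v))) volume a b := by
  apply ContinuousOn.intervalIntegrable
  rw [Set.uIcc_of_le hab]
  exact T.isContractionSemigroup_P.continuousOn_apply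
    (fun v hv => sub_nonneg.2 (hca.trans hv.1)) (by fun_prop)
    ((hu.continuousOn_gamL hA).mono fun v hv => ha.trans_le hv.1)

lemma P_gamL_nonneg (hu : T.IsOrbit u) (hA : T.IsAdmissibleAlgebra A) {v t : ℝ} (hv : 0 < v)
    (ht : 0 ≤ t) : 0 ≤ T.P t (T.gamL (u v)) := T.P_nonneg ht (hu.gamL_nonneg hA hv)

end IsOrbit

variable (T) in
/-- `∫_a^N T_{v-c} Γ(u_v) dv`. -/
def areaIntegral (u : ℝ → Lp ℂ 2 μ) (c a b : ℝ) : Lp ℝ 1 μ :=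
  ∫ v in a..b, T.P (v - c) (T.gamL (u v))

namespace IsOrbit

/-- The base point c is separate from a because the semigroup shifts it alone. A shift by δ compares
area integrals on neighbouring grid points; a shift to c = 0 reaches the truncated area function of
the H_1^S norm. -/
lemma P_areaIntegral (hu : T.IsOrbit u) (hA : T.IsAdmissibleAlgebra A) {a b c r : ℝ}
    (ha : 0 < a) (hab : a ≤ b) (hca : c ≤ a) (hr : 0 ≤ r) :
    T.P r (T.areaIntegral u c a b) = T.areaIntegral u (c - r) a b := by
  rw [areaIntegral, areaIntegral,
    ← (T.P r).intervalIntegral_comp_comm (hu.intervalIntegrable_P_gamL hA ha hab hca)]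
  refine intervalIntegral.integral_congr fun v hv => ?_
  rw [Set.uIcc_of_le hab] at hv
  rw [← T.P_add hr (sub_nonneg.2 (hca.trans hv.1))]
  congr 2
  ring

lemma areaIntegral_nonneg (hu : T.IsOrbit u) (hA : T.IsAdmissibleAlgebra A) {a b c : ℝ}
    (ha : 0 < a) (hab : a ≤ b) (hca : c ≤ a) : 0 ≤ T.areaIntegral u c a b :=
  intervalIntegral_nonneg_L1 hab fun _ hv => hu.P_gamL_nonneg hA (ha.trans_le hv.1)
    (sub_nonneg.2 (hca.trans hv.1))

lemma areaIntegral_mono (hu : T.IsOrbit u) (hA : T.IsAdmissibleAlgebra A) {a a' b b' c : ℝ}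
    (ha : 0 < a) (haa : a ≤ a') (hab : a' ≤ b') (hbb : b' ≤ b) (hca : c ≤ a) :
    T.areaIntegral u c a' b' ≤ T.areaIntegral u c a b := by
  have i1 := hu.intervalIntegrable_P_gamL hA ha haa hca
  have i2 := hu.intervalIntegrable_P_gamL hA (ha.trans_le haa) hab (hca.trans haa)
  have i3 := hu.intervalIntegrable_P_gamL hA ((ha.trans_le haa).trans_le hab) hbb
    ((hca.trans haa).trans hab)
  have e : T.areaIntegral u c a b = T.areaIntegral u c a a' + T.areaIntegral u c a' b' +
      T.areaIntegral u c b' b := by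
    simp only [areaIntegral]
    rw [intervalIntegral.integral_add_adjacent_intervals i1 i2,
      intervalIntegral.integral_add_adjacent_intervals (i1.trans i2) i3]
  rw [e]
  have h1 := hu.areaIntegral_nonneg hA ha haa hca
  have h3 := hu.areaIntegral_nonneg hA ((ha.trans_le haa).trans_le hab) hbb
    ((hca.trans haa).trans hab)
  calc T.areaIntegral u c a' b' ≤ T.areaIntegral u c a a' + T.areaIntegral u c a' b' :=
        le_add_of_nonneg_left h1
    _ ≤ _ := le_add_of_nonneg_right h3

lemma gamma_nonneg (hu : T.IsOrbit u) (hA : T.IsAdmissibleAlgebra A) {a b : ℝ}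
    (ha : 0 < a) (hab : a ≤ b) : 0 ≤ ∫ v in a..b, T.gamL (u v) :=
  intervalIntegral_nonneg_L1 hab fun _ hv => hu.gamL_nonneg hA (ha.trans_le hv.1)

lemma gamma_mono (hu : T.IsOrbit u) (hA : T.IsAdmissibleAlgebra A) {a b b' : ℝ}
    (ha : 0 < a) (hab : a ≤ b) (hbb : b ≤ b') :
    ∫ v in a..b, T.gamL (u v) ≤ ∫ v in a..b', T.gamL (u v) := by
  rw [← intervalIntegral.integral_add_adjacent_intervals
    (hu.intervalIntegrable_gamL hA ha (ha.trans_le hab))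
    (hu.intervalIntegrable_gamL hA (ha.trans_le hab) ((ha.trans_le hab).trans_le hbb))]
  exact le_add_of_nonneg_right (hu.gamma_nonneg hA (ha.trans_le hab) hbb)

/-- The curvature condition bounds the Littlewood-Paley integral by the area integral. -/
lemma gamma_le_areaIntegral (hu : T.IsOrbit u) (hA : T.IsAdmissibleAlgebra A)
    (hG : T.Gam2Nonneg A) {a b c : ℝ} (ha : 0 < a) (hab : a ≤ b) (hca : c ≤ a) :
    ∫ v in (2 * a - c)..(2 * b - c), T.gamL (u v) ≤ (2 : ℝ) • T.areaIntegral u c a b := by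
  -- With time written as 2v - c = v + (v - c), the curvature condition applies with increment v -
  -- c; the factor 2 is the Jacobian.
  have h1 : ∫ v in (2 * a - c)..(2 * b - c), T.gamL (u v) =
      (2 : ℝ) • ∫ v in a..b, T.gamL (u (2 * v - c)) := by
    rw [← intervalIntegral.smul_integral_comp_mul_sub]
  rw [h1]
  refine smul_le_smul_of_nonneg_left ?_ (by norm_num)
  have hcont : ContinuousOn (fun v => T.gamL (u (2 * v - c))) (Set.uIcc a b) := by
    rw [Set.uIcc_of_le hab]
    refine (hu.continuousOn_gamL hA).comp (by fun_prop) fun v hv => ?_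
    have := hv.1
    exact Set.mem_Ioi.2 (by linarith)
  refine intervalIntegral_mono_L1 hab hcont.intervalIntegrable
    (hu.intervalIntegrable_P_gamL hA ha hab hca) fun v hv => ?_
  have := hu.gamL_le hA hG (ha.trans_le hv.1) (sub_nonneg.2 (hca.trans hv.1))
  have e : v + (v - c) = 2 * v - c := by ring
  rwa [e] at this

end IsOrbit

end StandardSemigroup

end

noncomputable section

namespace StandardSemigroup

variable {M : Type*} [MeasurableSpace M] {μ : Measure M} {T : StandardSemigroup μ}
  {A : Submodule ℂ (Lp ℂ ∞ μ)} {u : ℝ → Lp ℂ 2 μ}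

/-! ### The main estimate -/

/-- The Carleson-type estimate for the gradient form of `T_v g` against a bounded supermartingale,
sampled on a grid. -/
lemma sum_weight_gamma_le (hA : T.IsAdmissibleAlgebra A) (hG : T.Gam2Nonneg A) {g : Lp ℂ 2 μ}
    {β : ℝ} (hβ : 0 ≤ β) (hbmo : ∀ t : ℝ, 0 < t → ∀ᵐ x ∂μ, T.varL t g x ≤ β) {ε δ : ℝ}
    (hδ : 0 < δ) (hε : δ < ε) {V : ℕ → Lp ℝ 1 μ} {r : ℝ}
    (hV0 : ∀ j, 0 ≤ V j) (hVr : ∀ j, ∀ᵐ x ∂μ, |V j x| ≤ r)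
    (hVs : ∀ j, T.P δ (V (j + 1)) ≤ V j) (n : ℕ) :
    ∑ j ∈ Finset.range n, ∫ x, V j x * (∫ v in (ε + j * δ)..(ε + (j + 1 : ℕ) * δ),
      T.gamL (T.op 2 v g) : Lp ℝ 1 μ) x ∂μ ≤ β / 2 * tau (V 0) := by
  have hε0 : 0 < ε := hδ.trans hε
  have hu := T.isOrbit_op g
  have hcont := hu.continuousOn_gamL hA
  set I : ℕ → ℝ → ℝ := fun j v => ∫ x, V j x * T.gamL (T.op 2 v g) x ∂μ with hI
  have hIc : ∀ j, ContinuousOn (I j) (Set.Ioi 0) := by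
    intro j
    obtain ⟨w, -, hw⟩ := exists_pairL (Lp.aestronglyMeasurable (V j)) (hVr j)
    simp only [hI, ← hw]
    exact (pairL w).continuous.comp_continuousOn hcont
  have hIc' : ∀ j : ℕ, ContinuousOn (fun q => I j (ε + j * δ + q)) (Set.Icc 0 δ) := by
    intro j
    refine (hIc j).comp (by fun_prop) fun q hq => Set.mem_Ioi.2 ?_
    have : 0 ≤ (j : ℝ) * δ := by positivity
    have := hq.1
    linarith
  have e1 : ∀ j : ℕ, ∫ x, V j x * (∫ v in (ε + j * δ)..(ε + (j + 1 : ℕ) * δ),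
      T.gamL (T.op 2 v g) : Lp ℝ 1 μ) x ∂μ = ∫ q in (0 : ℝ)..δ, I j (ε + j * δ + q) := by
    intro j
    rw [integral_mul_intervalIntegral (Lp.aestronglyMeasurable (V j)) (hVr j)
      (hu.intervalIntegrable_gamL hA (by positivity) (by positivity)),
      intervalIntegral.integral_comp_add_left (I j), add_zero]
    congr 1
    push_cast; ring
  have hint : ∀ j : ℕ, IntervalIntegrable (fun q => I j (ε + j * δ + q)) volume 0 δ := fun j =>
    ((hIc' j).mono (by rw [Set.uIcc_of_le hδ.le])).intervalIntegrable
  simp_rw [e1]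
  rw [← intervalIntegral.integral_finsetSum fun j _ => hint j]
  -- For each offset q the shifted grid is treated separately by summation by parts. Integrating
  -- over q in [0, δ] cancels the 1/δ and restores the cell integrals.
  have h1 : ∀ q ∈ Set.Icc 0 δ, ∑ j ∈ Finset.range n, I j (ε + j * δ + q) ≤
      β / (2 * δ) * tau (V 0) := by
    intro q hq
    set b : ℕ → Lp ℝ 1 μ := fun j => T.gamL (T.op 2 (ε + q + j * δ) g) with hb
    set U : ℕ → Lp ℝ 1 μ := fun j => Nat.rec (b 0) (fun j y => T.P δ y + b (j + 1)) j with hU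
    have hUc : ∀ j, ∀ᵐ x ∂μ, U j x ≤ β / (2 * δ) := by
      intro j
      have h2 := smul_accumulated_le_varL hA hG g (s := ε + q) hδ (by linarith [hq.1]) (U := U)
        (by simp [hU, hb]) (fun j => rfl) j
      have hpos : 0 < ε + q + j * δ := by
        have : 0 ≤ (j : ℝ) * δ := by positivity
        linarith [hq.1]
      rw [← Lp.coeFn_le] at h2
      filter_upwards [h2, hbmo _ hpos, Lp.coeFn_smul δ ((2 : ℝ) • U j),
        Lp.coeFn_smul (2 : ℝ) (U j)] with x a1 a2 a3 a4
      rw [a3, Pi.smul_apply, a4, Pi.smul_apply, smul_eq_mul, smul_eq_mul] at a1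
      rw [le_div_iff₀ (by positivity)]
      linarith
    have h3 := T.sum_integral_mul_le hδ.le (V := V) (U := U) (b := b) (c := β / (2 * δ)) (r := r)
      (by positivity) rfl (fun j => rfl) hUc hV0 hVr hVs n
    refine le_trans (le_of_eq ?_) h3
    refine Finset.sum_congr rfl fun j _ => ?_
    simp only [hI, hb]
    congr! 7
    ring_nf
  have h2 := intervalIntegral.integral_mono_on hδ.le
    (IntervalIntegrable.sum (Finset.range n) fun j _ => hint j)
    (intervalIntegrable_const (c := β / (2 * δ) * tau (V 0))) (fun q hq => by
      simpa using h1 q hq)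
  rw [intervalIntegral.integral_const, sub_zero, smul_eq_mul] at h2
  refine le_trans (le_of_eq ?_) (h2.trans (le_of_eq ?_))
  · exact intervalIntegral.integral_congr fun q _ => by simp
  · field_simp

/-- The elementary telescoping inequality behind the estimate of the Littlewood-Paley factor. -/
lemma sum_div_min_sqrt_le {γ σ : ℕ → ℝ} {η R : ℝ} (hη : 0 < η) (hR : 0 < R) {n : ℕ}
    (hγ : ∀ j < n, γ (j + 1) ≤ γ j) (hγ0 : ∀ j ≤ n, 0 ≤ γ j) (hσ : ∀ j < n, γ j ≤ 2 * σ j) :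
    ∑ j ∈ Finset.range n, (min √(σ j) R + η)⁻¹ * (γ j - γ (j + 1)) ≤
      2 * √2 * √(γ 0) + R⁻¹ * γ 0 := by
  have hterm : ∀ j ∈ Finset.range n, (min √(σ j) R + η)⁻¹ * (γ j - γ (j + 1)) ≤
      2 * √2 * (√(γ j) - √(γ (j + 1))) + R⁻¹ * (γ j - γ (j + 1)) := by
    intro j hj
    have hj := Finset.mem_range.1 hj
    have h0 := hγ0 j hj.le
    have h1 := hγ0 (j + 1) hj
    have hF : 0 ≤ γ j - γ (j + 1) := sub_nonneg.2 (hγ j hj)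
    have hs : 0 ≤ √(γ j) - √(γ (j + 1)) := sub_nonneg.2 (Real.sqrt_le_sqrt (hγ j hj))
    have hm : 0 ≤ min √(σ j) R := le_min (Real.sqrt_nonneg _) hR.le
    -- Where the cutoff is inactive, γ_j - γ_{j+1} is factored as a difference of squares, with √γ_j
    -- + √γ_{j+1} ≤ 2√2 √σ_j. Where it is active, the trivial bound R⁻¹ is used and disappears as R
    -- → ∞.
    rcases min_choice √(σ j) R with h | h
    · have a1 : γ j - γ (j + 1) ≤ 2 * √2 * (√(γ j) - √(γ (j + 1))) * (√(σ j) + η) := by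
        have b1 : √(γ j) ≤ √2 * √(σ j) := by
          rw [← Real.sqrt_mul (by norm_num)]
          exact Real.sqrt_le_sqrt (hσ j hj)
        have b2 : γ j - γ (j + 1) = (√(γ j) - √(γ (j + 1))) * (√(γ j) + √(γ (j + 1))) := by
          have c1 := Real.sq_sqrt h0
          have c2 := Real.sq_sqrt h1
          nlinarith
        have b3 : √(γ (j + 1)) ≤ √(γ j) := sub_nonneg.1 hs
        have b4 : √(γ j) + √(γ (j + 1)) ≤ 2 * √2 * (√(σ j) + η) := by
          have : 0 ≤ √2 * η := by positivity
          nlinarith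
        calc γ j - γ (j + 1) = (√(γ j) - √(γ (j + 1))) * (√(γ j) + √(γ (j + 1))) := b2
          _ ≤ (√(γ j) - √(γ (j + 1))) * (2 * √2 * (√(σ j) + η)) := by gcongr
          _ = _ := by ring
      have hpos : 0 < √(σ j) + η := by positivity
      rw [h]
      have : (√(σ j) + η)⁻¹ * (γ j - γ (j + 1)) ≤ 2 * √2 * (√(γ j) - √(γ (j + 1))) := by
        rw [inv_mul_le_iff₀ hpos]
        linarith
      have : 0 ≤ R⁻¹ * (γ j - γ (j + 1)) := by positivity
      linarith
    · rw [h]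
      have a1 : (R + η)⁻¹ ≤ R⁻¹ := inv_anti₀ hR (by linarith)
      have : 0 ≤ 2 * √2 * (√(γ j) - √(γ (j + 1))) := by positivity
      have := mul_le_mul_of_nonneg_right a1 hF
      linarith
  refine (Finset.sum_le_sum hterm).trans ?_
  rw [Finset.sum_add_distrib, ← Finset.mul_sum, ← Finset.mul_sum,
    Finset.sum_range_sub' (fun j => √(γ j)), Finset.sum_range_sub' γ]
  have h0 := hγ0 n le_rfl
  have : 0 ≤ 2 * √2 * √(γ n) := by positivity
  have : 0 ≤ R⁻¹ * γ n := by positivity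
  linarith

end StandardSemigroup

end

/-! ### The grid estimate with truncated area weights. -/

noncomputable section

namespace StandardSemigroup

variable {M : Type*} [MeasurableSpace M] {μ : Measure M} {T : StandardSemigroup μ}
  {A : Submodule ℂ (Lp ℂ ∞ μ)} {u : ℝ → Lp ℂ 2 μ}

lemma integrable_sqrt {h : Lp ℝ 1 μ} (hfin : ∫⁻ x, ENNReal.ofReal √(h x) ∂μ ≠ ∞) :
    Integrable (fun x => √(h x)) μ := by
  have hm : AEMeasurable h μ := (Lp.aestronglyMeasurable h).aemeasurable
  refine ⟨hm.sqrt.aestronglyMeasurable, ?_⟩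
  rw [hasFiniteIntegral_iff_ofReal (ae_of_all _ fun x => Real.sqrt_nonneg _)]
  exact hfin.lt_top

lemma integrable_min_sqrt {h : Lp ℝ 1 μ} (hfin : ∫⁻ x, ENNReal.ofReal √(h x) ∂μ ≠ ∞) {R : ℝ}
    (hR : 0 < R) : Integrable (fun x => min √(h x) R) μ := by
  have hm : AEMeasurable h μ := (Lp.aestronglyMeasurable h).aemeasurable
  refine (integrable_sqrt hfin).mono' (hm.sqrt.min aemeasurable_const).aestronglyMeasurable
    (ae_of_all _ fun x => ?_)
  rw [Real.norm_of_nonneg (le_min (Real.sqrt_nonneg _) hR.le)]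
  exact min_le_left _ _

lemma lintegral_sqrt_mono {h k : Lp ℝ 1 μ} (hk : h ≤ k) :
    ∫⁻ x, ENNReal.ofReal √(h x) ∂μ ≤ ∫⁻ x, ENNReal.ofReal √(k x) ∂μ := by
  apply lintegral_mono_ae
  filter_upwards [(Lp.coeFn_le h k).2 hk] with x hx
  exact ENNReal.ofReal_le_ofReal (Real.sqrt_le_sqrt hx)

namespace IsOrbit

/-- The sum of the Littlewood-Paley factors over a grid. -/
lemma sum_integral_inv_weight_le (hu : T.IsOrbit u) (hA : T.IsAdmissibleAlgebra A)
    {s : ℕ → ℝ} {n : ℕ} (hs0 : ∀ j, 0 < s j) (hs : ∀ j, s j ≤ s (j + 1)) {N : ℝ} (hN : s n = N)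
    {σ : ℕ → Lp ℝ 1 μ} (hσ : ∀ j < n, ∫ v in (s j)..N, T.gamL (u v) ≤ (2 : ℝ) • σ j)
    {η R : ℝ} (hη : 0 < η) (hR : 0 < R)
    (hint : Integrable (fun x => √((∫ v in (s 0)..N, T.gamL (u v) : Lp ℝ 1 μ) x)) μ) :
    ∑ j ∈ Finset.range n, ∫ x, (min √(σ j x) R + η)⁻¹ *
        (∫ v in (s j)..(s (j + 1)), T.gamL (u v) : Lp ℝ 1 μ) x ∂μ ≤
      2 * √2 * ∫ x, √((∫ v in (s 0)..N, T.gamL (u v) : Lp ℝ 1 μ) x) ∂μ +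
        R⁻¹ * tau (∫ v in (s 0)..N, T.gamL (u v)) := by
  have hmono : Monotone s := monotone_nat_of_le_succ hs
  set γ : ℕ → Lp ℝ 1 μ := fun j => ∫ v in (s j)..N, T.gamL (u v) with hγ
  set F : ℕ → Lp ℝ 1 μ := fun j => ∫ v in (s j)..(s (j + 1)), T.gamL (u v) with hF
  have hN0 : 0 < N := hN ▸ hs0 n
  have hFγ : ∀ j, F j = γ j - γ (j + 1) := by
    intro j
    rw [eq_sub_iff_add_eq]
    exact intervalIntegral.integral_add_adjacent_intervals
      (hu.intervalIntegrable_gamL hA (hs0 _) (hs0 _))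
      (hu.intervalIntegrable_gamL hA (hs0 _) hN0)
  have hF0 : ∀ j, 0 ≤ F j := fun j => hu.gamma_nonneg hA (hs0 j) (hs j)
  have hγ0 : ∀ j ≤ n, 0 ≤ γ j := fun j hj => hu.gamma_nonneg hA (hs0 j) (hN ▸ hmono hj)
  have hwb : ∀ j x, ‖(min √(σ j x) R + η)⁻¹‖ ≤ η⁻¹ := by
    intro j x
    have : 0 ≤ min √(σ j x) R := le_min (Real.sqrt_nonneg _) hR.le
    rw [norm_inv, Real.norm_of_nonneg (by positivity)]
    exact inv_anti₀ hη (by linarith)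
  have hwm : ∀ j, AEStronglyMeasurable (fun x => (min √(σ j x) R + η)⁻¹) μ := fun j =>
    (((Lp.aestronglyMeasurable (σ j)).aemeasurable.sqrt.min aemeasurable_const).add_const
      η).inv.aestronglyMeasurable
  rw [← integral_finsetSum _ fun j _ =>
    (L1.integrable_coeFn (F j)).bdd_mul (hwm j) (ae_of_all _ (hwb j)), tau_apply,
    ← integral_const_mul, ← integral_const_mul, ← integral_add (hint.const_mul _)
      ((L1.integrable_coeFn (γ 0)).const_mul _)]
  refine integral_mono_ae (integrable_finsetSum _ fun j _ =>
    (L1.integrable_coeFn (F j)).bdd_mul (hwm j) (ae_of_all _ (hwb j)))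
    ((hint.const_mul _).add ((L1.integrable_coeFn (γ 0)).const_mul _)) ?_
  have h1 : ∀ᵐ x ∂μ, ∀ j, F j x = γ j x - γ (j + 1) x := ae_all_iff.2 fun j => by
    filter_upwards [Lp.coeFn_sub (γ j) (γ (j + 1))] with x hx
    rw [hFγ, hx, Pi.sub_apply]
  have h2 : ∀ᵐ x ∂μ, ∀ j, 0 ≤ F j x := ae_all_iff.2 fun j => (Lp.coeFn_nonneg _).2 (hF0 j)
  have h3 : ∀ᵐ x ∂μ, ∀ j ≤ n, 0 ≤ γ j x := ae_all_iff.2 fun j => by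
    by_cases hj : j ≤ n
    · filter_upwards [(Lp.coeFn_nonneg _).2 (hγ0 j hj)] with x hx _ using hx
    · exact ae_of_all _ fun x h => absurd h hj
  have h4 : ∀ᵐ x ∂μ, ∀ j < n, γ j x ≤ 2 * σ j x := ae_all_iff.2 fun j => by
    by_cases hj : j < n
    · filter_upwards [(Lp.coeFn_le _ _).2 (hσ j hj), Lp.coeFn_smul (2 : ℝ) (σ j)] with x hx hx' _
      rw [hx', Pi.smul_apply, smul_eq_mul] at hx
      exact hx
    · exact ae_of_all _ fun x h => absurd h hj
  filter_upwards [h1, h2, h3, h4] with x a1 a2 a3 a4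
  have := sum_div_min_sqrt_le (γ := fun j => γ j x) (σ := fun j => σ j x) hη hR (n := n)
    (fun j _ => by have := a2 j; rw [a1] at this; linarith) a3 a4
  refine le_trans (le_of_eq (Finset.sum_congr rfl fun j _ => ?_)) this
  rw [a1]

/-- On the cell starting at s_j the weight is r⁻¹(min(√σ_j, R) + η), where σ_j is the area integral
based at s_j. The cutoff R and the shift η keep the weight between positive constants; r is left
free for optimisation. -/
lemma norm_inner_sub_le_truncated (hu : T.IsOrbit u) (hA : T.IsAdmissibleAlgebra A)
    (hG : T.Gam2Nonneg A) {g : Lp ℂ 2 μ} {β : ℝ} (hβ : 0 ≤ β)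
    (hbmo : ∀ t : ℝ, 0 < t → ∀ᵐ x ∂μ, T.varL t g x ≤ β) {ε N : ℝ} (hε : 0 < ε) (hεN : ε < N)
    (hfin : ∫⁻ x, ENNReal.ofReal √(T.areaIntegral u 0 ε N x) ∂μ ≠ ∞) {r η R : ℝ} (hr : 0 < r)
    (hη : 0 < η) (hR : 0 < R) :
    ‖inner ℂ (u N) (T.op 2 N g) - inner ℂ (u ε) (T.op 2 ε g)‖ ≤
      r * (2 * √2 * ∫ x, √((∫ v in ε..N, T.gamL (u v) : Lp ℝ 1 μ) x) ∂μ +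
        R⁻¹ * tau (∫ v in ε..N, T.gamL (u v))) +
      r⁻¹ * (β / 2 * (∫⁻ x, ENNReal.ofReal √(T.areaIntegral u 0 ε N x) ∂μ).toReal +
        η * tau (∫ v in ε..N, T.gamL (T.op 2 v g))) := by
  -- Enough cells to have δ < ε, the margin required by the Carleson-type estimate.
  obtain ⟨n, hn⟩ := exists_nat_gt ((N - ε) / ε)
  have hNε : 0 < N - ε := sub_pos.2 hεN
  have hn0 : (0 : ℝ) < n := lt_trans (by positivity) hn
  set δ : ℝ := (N - ε) / n with hδdef
  have hδ : 0 < δ := by positivity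
  have hδε : δ < ε := by
    rw [hδdef, div_lt_iff₀ hn0]
    rw [div_lt_iff₀ hε] at hn
    linarith
  set s : ℕ → ℝ := fun j => ε + j * δ with hs
  have hs0 : ∀ j, 0 < s j := fun j => by simp only [hs]; positivity
  have hsε : ∀ j, ε ≤ s j := fun j => by
    have : 0 ≤ (j : ℝ) * δ := by positivity
    simp only [hs]; linarith
  have hsucc : ∀ j, s (j + 1) = s j + δ := fun j => by simp only [hs]; push_cast; ring
  have hsle : ∀ j, s j ≤ s (j + 1) := fun j => by rw [hsucc]; linarith
  have hmono : Monotone s := monotone_nat_of_le_succ hsle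
  have hsn : s n = N := by simp only [hs, hδdef]; field_simp; ring
  have hsz : s 0 = ε := by simp [hs]
  have hsN : ∀ j ≤ n, s j ≤ N := fun j hj => hsn ▸ hmono hj
  set S := ∫⁻ x, ENNReal.ofReal √(T.areaIntegral u 0 ε N x) ∂μ with hS
  -- Past the last grid point the weight is set to 0, which keeps nonnegativity and the
  -- supermartingale property for every j.
  set σ : ℕ → Lp ℝ 1 μ := fun j => if j ≤ n then T.areaIntegral u (s j) (s j) N else 0 with hσdef
  have hσ : ∀ j ≤ n, σ j = T.areaIntegral u (s j) (s j) N := fun j hj => if_pos hj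
  have hσ0 : ∀ j, 0 ≤ σ j := by
    intro j
    by_cases hj : j ≤ n
    · rw [hσ j hj]; exact hu.areaIntegral_nonneg hA (hs0 j) (hsN j hj) le_rfl
    · simp only [hσdef, if_neg hj, le_refl]
  have hσP : ∀ j, T.P δ (σ (j + 1)) ≤ σ j := by
    intro j
    by_cases hj : j + 1 ≤ n
    · rw [hσ _ hj, hσ j (by omega), hu.P_areaIntegral hA (hs0 _) (hsN _ hj) le_rfl hδ.le]
      have e : s (j + 1) - δ = s j := by rw [hsucc]; ring
      rw [e]
      exact hu.areaIntegral_mono hA (hs0 j) (hsle j) (hsN _ hj) le_rfl le_rfl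
    · have : σ (j + 1) = 0 := by simp only [hσdef, if_neg hj]
      rw [this, map_zero]
      exact hσ0 j
  have hσS : ∀ j, ∫⁻ x, ENNReal.ofReal √(σ j x) ∂μ ≤ S := by
    intro j
    by_cases hj : j ≤ n
    -- Applying T_{s_j} does not decrease the integral of the root and moves the base point to 0,
    -- giving part of the area integral over [ε, N].
    · refine (T.lintegral_sqrt_le_P (hs0 j).le (hσ0 j)).trans ?_
      rw [hσ j hj, hu.P_areaIntegral hA (hs0 _) (hsN _ hj) le_rfl (hs0 j).le, sub_self]
      exact lintegral_sqrt_mono (hu.areaIntegral_mono hA hε (hsε j) (hsN j hj) le_rfl hε.le)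
    · have h0 : σ j = 0 := by simp only [hσdef, if_neg hj]
      rw [h0, lintegral_congr_ae (g := fun _ => 0)]
      · simp
      · filter_upwards [Lp.coeFn_zero ℝ 1 μ] with x hx
        rw [hx]; simp
  have hσfin : ∀ j, ∫⁻ x, ENNReal.ofReal √(σ j x) ∂μ ≠ ∞ := fun j =>
    ne_top_of_le_ne_top hfin (hσS j)
  have hVm : ∀ j, MemLp (fun x => min √(σ j x) R) 1 μ := fun j =>
    memLp_one_iff_integrable.2 (integrable_min_sqrt (hσfin j) hR)
  set V : ℕ → Lp ℝ 1 μ := fun j => (hVm j).toLp _ with hV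
  have hVe : ∀ j, V j =ᵐ[μ] fun x => min √(σ j x) R := fun j => (hVm j).coeFn_toLp
  have hV0 : ∀ j, 0 ≤ V j := fun j => by
    rw [← Lp.coeFn_nonneg]
    filter_upwards [hVe j] with x hx
    rw [hx]
    exact le_min (Real.sqrt_nonneg _) hR.le
  have hVr : ∀ j, ∀ᵐ x ∂μ, |V j x| ≤ R := fun j => by
    filter_upwards [hVe j] with x hx
    rw [hx, abs_of_nonneg (le_min (Real.sqrt_nonneg _) hR.le)]
    exact min_le_right _ _
  have hVs : ∀ j, T.P δ (V (j + 1)) ≤ V j := by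
    intro j
    -- The two terms of the minimum are handled apart: the Schwarz inequality compares T_δ V_{j+1}
    -- with √σ_j, and the maximum principle with R.
    have h1 := T.sq_P_le hδ.le (V := V (j + 1)) (h := σ (j + 1)) (by
      filter_upwards [hVe (j + 1), (Lp.coeFn_nonneg _).2 (hσ0 (j + 1))] with x e1 e2
      rw [e1]
      exact (pow_le_pow_left₀ (le_min (Real.sqrt_nonneg _) hR.le) (min_le_left _ _) 2).trans
        (Real.sq_sqrt e2).le)
    have h2 := T.P_le_const hδ.le hR.le (F := V (j + 1)) ((hVr (j + 1)).mono fun x hx =>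
      (le_abs_self _).trans hx)
    rw [← Lp.coeFn_le]
    filter_upwards [h1, h2, hVe j, (Lp.coeFn_le _ _).2 (hσP j)] with x a1 a2 a3 a4
    rw [a3]
    exact le_min (Real.le_sqrt_of_sq_le (a1.trans a4)) a2
  have hγσ : ∀ j < n, ∫ v in (s j)..N, T.gamL (u v) ≤ (2 : ℝ) • σ j := by
    intro j hj
    have hjN := hsN j hj.le
    have h1 := hu.gamma_le_areaIntegral hA hG (hs0 j) hjN le_rfl
    have e : 2 * s j - s j = s j := by ring
    rw [e, ← hσ j hj.le] at h1
    exact (hu.gamma_mono hA (hs0 j) hjN (by linarith)).trans h1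
  have hn1 : 0 < n := by exact_mod_cast hn0
  have hint : Integrable (fun x => √((∫ v in (s 0)..N, T.gamL (u v) : Lp ℝ 1 μ) x)) μ := by
    refine ((integrable_sqrt (hσfin 0)).const_mul √2).mono'
      (Lp.aestronglyMeasurable _).aemeasurable.sqrt.aestronglyMeasurable ?_
    filter_upwards [(Lp.coeFn_le _ _).2 (hγσ 0 hn1), Lp.coeFn_smul (2 : ℝ) (σ 0)] with x a1 a2
    rw [a2, Pi.smul_apply, smul_eq_mul] at a1
    rw [Real.norm_of_nonneg (Real.sqrt_nonneg _), ← Real.sqrt_mul (by norm_num)]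
    exact Real.sqrt_le_sqrt a1
  have hsum1 := hu.sum_integral_inv_weight_le hA hs0 hsle hsn hγσ hη hR hint
  have hsum2 := sum_weight_gamma_le hA hG hβ hbmo hδ hδε hV0 hVr hVs n
  have hw := T.isOrbit_op g
  have hτ : tau (V 0) ≤ S.toReal := by
    rw [← ENNReal.ofReal_le_iff_le_toReal hfin, tau_apply,
      ofReal_integral_eq_lintegral_ofReal (L1.integrable_coeFn _) ((Lp.coeFn_nonneg _).2 (hV0 0))]
    refine le_trans (lintegral_mono_ae ?_) (hσS 0)
    filter_upwards [hVe 0] with x hx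
    rw [hx]
    exact ENNReal.ofReal_le_ofReal (min_le_left _ _)
  set W : ℕ → Lp ℝ 1 μ := fun j => ∫ v in (s j)..(s (j + 1)), T.gamL (T.op 2 v g) with hWdef
  have hstep : ∀ j, ‖inner ℂ (u (s (j + 1))) (T.op 2 (s (j + 1)) g) -
      inner ℂ (u (s j)) (T.op 2 (s j) g)‖ ≤
      r * ∫ x, (min √(σ j x) R + η)⁻¹ *
        (∫ v in (s j)..(s (j + 1)), T.gamL (u v) : Lp ℝ 1 μ) x ∂μ +
      r⁻¹ * (∫ x, V j x * W j x ∂μ + η * tau (W j)) := by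
    intro j
    have hm0 : ∀ x, 0 ≤ min √(σ j x) R := fun x => le_min (Real.sqrt_nonneg _) hR.le
    have h := hu.norm_inner_sub_le hw hA (φ := fun x => r⁻¹ * (min √(σ j x) R + η))
      (m := r⁻¹ * η) (c := r⁻¹ * (R + η))
      ((((Lp.aestronglyMeasurable (σ j)).aemeasurable.sqrt.min aemeasurable_const).add_const
      η).const_mul r⁻¹).aestronglyMeasurable (by positivity)
      (fun x => by have := hm0 x; gcongr; linarith) (fun x => by gcongr; exact min_le_right _ _)
      (hs0 j) (hsle j)
    refine h.trans (le_of_eq ?_)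
    congr 1
    · rw [← integral_const_mul]
      congr 1 with x
      rw [mul_inv, inv_inv, mul_assoc]
    · rw [tau_apply, ← integral_const_mul η, ← integral_add (integrable_mul_of_bdd (hVr j))
        ((L1.integrable_coeFn _).const_mul η), ← integral_const_mul]
      apply integral_congr_ae
      filter_upwards [hVe j] with x hx
      rw [hx]
      simp only [hWdef]
      ring
  have htel : inner ℂ (u N) (T.op 2 N g) - inner ℂ (u ε) (T.op 2 ε g) =
      ∑ j ∈ Finset.range n, (inner ℂ (u (s (j + 1))) (T.op 2 (s (j + 1)) g) -
        inner ℂ (u (s j)) (T.op 2 (s j) g)) := by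
    rw [Finset.sum_range_sub (fun j => inner ℂ (u (s j)) (T.op 2 (s j) g)), hsn, hsz]
  have hWsum : ∑ j ∈ Finset.range n, tau (W j) = tau (∫ v in ε..N, T.gamL (T.op 2 v g)) := by
    rw [← map_sum, intervalIntegral.sum_integral_adjacent_intervals fun k _ =>
      hw.intervalIntegrable_gamL hA (hs0 _) (hs0 _), hsn, hsz]
  rw [htel]
  refine (norm_sum_le _ _).trans ((Finset.sum_le_sum fun j _ => hstep j).trans ?_)
  rw [Finset.sum_add_distrib, ← Finset.mul_sum, ← Finset.mul_sum, Finset.sum_add_distrib,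
    ← Finset.mul_sum, hWsum]
  rw [hsz] at hsum1
  have hsum2' : ∑ j ∈ Finset.range n, ∫ x, V j x * W j x ∂μ ≤ β / 2 * S.toReal :=
    hsum2.trans (by gcongr)
  gcongr

end IsOrbit

end StandardSemigroup

end

/-! ### Optimisation of the weight; square functions of f and their norms. -/

noncomputable section

namespace StandardSemigroup

variable {M : Type*} [MeasurableSpace M] {μ : Measure M} {T : StandardSemigroup μ}
  {A : Submodule ℂ (Lp ℂ ∞ μ)} {u : ℝ → Lp ℂ 2 μ}

/-- The quadratic ar² - Xr + b is nonnegative on the whole line, so its discriminant is at most 0;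
no case distinction on a = 0 or b = 0 is needed. -/
lemma sq_le_of_forall_le {X a b : ℝ} (hX : 0 ≤ X) (ha : 0 ≤ a) (hb : 0 ≤ b)
    (h : ∀ r > 0, X ≤ r * a + r⁻¹ * b) : X ^ 2 ≤ 4 * (a * b) := by
  have h1 : ∀ r : ℝ, 0 ≤ a * (r * r) + (-X) * r + b := by
    intro r
    rcases le_or_gt r 0 with hr | hr
    · have : 0 ≤ a * (r * r) := mul_nonneg ha (mul_self_nonneg r)
      nlinarith
    · have h2 := mul_le_mul_of_nonneg_right (h r hr) hr.le
      have h3 : (r * a + r⁻¹ * b) * r = a * (r * r) + b := by field_simp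
      linarith
  have := discrim_le_zero h1
  rw [discrim] at this
  linarith

namespace IsOrbit

/-- The main estimate on a compact time interval. -/
lemma norm_inner_sub_sq_le (hu : T.IsOrbit u) (hA : T.IsAdmissibleAlgebra A)
    (hG : T.Gam2Nonneg A) {g : Lp ℂ 2 μ} {β : ℝ} (hβ : 0 ≤ β)
    (hbmo : ∀ t : ℝ, 0 < t → ∀ᵐ x ∂μ, T.varL t g x ≤ β) {ε N : ℝ} (hε : 0 < ε) (hεN : ε < N)
    (hfin : ∫⁻ x, ENNReal.ofReal √(T.areaIntegral u 0 ε N x) ∂μ ≠ ∞) :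
    ‖inner ℂ (u N) (T.op 2 N g) - inner ℂ (u ε) (T.op 2 ε g)‖ ^ 2 ≤
      9 * ((∫⁻ x, ENNReal.ofReal √(T.areaIntegral u 0 ε N x) ∂μ).toReal *
        (∫⁻ x, ENNReal.ofReal √((∫ v in ε..N, T.gamL (u v) : Lp ℝ 1 μ) x) ∂μ).toReal * β) := by
  set γ : Lp ℝ 1 μ := ∫ v in ε..N, T.gamL (u v)
  set S := (∫⁻ x, ENNReal.ofReal √(T.areaIntegral u 0 ε N x) ∂μ).toReal with hS
  have hI : ∫ x, √(γ x) ∂μ = (∫⁻ x, ENNReal.ofReal √(γ x) ∂μ).toReal :=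
    integral_eq_lintegral_of_nonneg_ae (ae_of_all _ fun x => Real.sqrt_nonneg _)
      (Lp.aestronglyMeasurable γ).aemeasurable.sqrt.aestronglyMeasurable
  set I := (∫⁻ x, ENNReal.ofReal √(γ x) ∂μ).toReal
  have hI0 : 0 ≤ I := ENNReal.toReal_nonneg
  have hS0 : 0 ≤ S := ENNReal.toReal_nonneg
  have key := sq_le_of_forall_le (norm_nonneg (inner ℂ (u N) (T.op 2 N g) -
    inner ℂ (u ε) (T.op 2 ε g))) (a := 2 * √2 * I) (b := β / 2 * S) (by positivity)
    (by positivity) (by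
      intro r hr
      set B := tau (∫ v in ε..N, T.gamL (T.op 2 v g))
      have hc : Continuous fun t : ℝ => r * (2 * √2 * I + t * tau γ) +
          r⁻¹ * (β / 2 * S + t * B) := by fun_prop
      have hl := (hc.tendsto 0).mono_left (nhdsWithin_le_nhds (s := Set.Ioi 0))
      simp only [zero_mul, add_zero] at hl
      refine ge_of_tendsto hl ?_
      filter_upwards [self_mem_nhdsWithin] with t ht
      have ht : 0 < t := ht
      -- Shift η = t and cutoff R = 1/t, removed together as t → 0; their error terms are multiples
      -- of t because both τ values are finite on [ε, N].
      have := hu.norm_inner_sub_le_truncated hA hG hβ hbmo hε hεN hfin hr ht (R := t⁻¹)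
        (by positivity)
      rw [inv_inv, hI] at this
      exact this)
  -- Optimisation gives the constant 4√2, rounded up to the square 9 so that c₁ = 3.
  have h2 : √2 ≤ 9 / 4 := by
    rw [Real.sqrt_le_left (by norm_num)]; norm_num
  calc _ ≤ _ := key
    _ = 4 * √2 * (S * I * β) := by ring
    _ ≤ 9 * (S * I * β) := by
      have : 0 ≤ S * I * β := by positivity
      nlinarith

/-- The estimate with a constant weight. -/
lemma norm_inner_sub_le_tau (hu : T.IsOrbit u) {w : ℝ → Lp ℂ 2 μ} (hw : T.IsOrbit w)
    (hA : T.IsAdmissibleAlgebra A) {a b : ℝ} (ha : 0 < a) (hab : a ≤ b) :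
    ‖inner ℂ (u b) (w b) - inner ℂ (u a) (w a)‖ ^ 2 ≤
      4 * (tau (∫ s in a..b, T.gamL (u s)) * tau (∫ s in a..b, T.gamL (w s))) := by
  refine sq_le_of_forall_le (norm_nonneg _) (tau_nonneg (hu.gamma_nonneg hA ha hab))
    (tau_nonneg (hw.gamma_nonneg hA ha hab)) fun r hr => ?_
  have := hu.norm_inner_sub_le hw hA (φ := fun _ => r⁻¹) (m := r⁻¹) (c := r⁻¹)
    aestronglyMeasurable_const (by positivity) (fun _ => le_rfl) (fun _ => le_rfl) ha hab
  simp only [inv_inv, integral_const_mul, ← tau_apply] at this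
  exact this

lemma star (hu : T.IsOrbit u) : T.IsOrbit fun s => star (u s) := by
  intro s t hs ht
  simp only
  rw [hu s t hs ht, T.op_two_star ht]

lemma gamL_star (hu : T.IsOrbit u) (hA : T.IsAdmissibleAlgebra A) {s : ℝ} (hs : 0 < s) :
    T.gamL (Star.star (u s)) = T.gamL (u s) := by
  have hn : ∀ g : Lp ℂ 2 μ, nsq (Star.star g) = nsq g := by
    intro g
    apply Lp.ext
    filter_upwards [coeFn_nsq g, coeFn_nsq (Star.star g), Lp.coeFn_star g] with x h1 h2 h3
    rw [h1, h2, h3, Pi.star_apply, norm_star]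
  have h1 := hu.tendsto_varL hA hs
  have h2 := hu.star.tendsto_varL hA hs
  have h3 := tendsto_nhds_unique h1 (h2.congr' (by
    filter_upwards [self_mem_nhdsWithin] with t ht
    rw [varL, varL, T.op_two_star (le_of_lt ht), hn, hn]))
  exact (smul_right_injective _ (two_ne_zero (α := ℝ)) h3).symm

end IsOrbit

/-- The gradient form is real on the diagonal. -/
lemma ofL_gamL {f : Lp ℂ 2 μ} (hf : T.InDomain 2 f) : ofL (T.gamL f) = T.Gam f f := by
  have hre : ∀ G : Lp ℂ 1 μ, ofL (reL G) = G ↔ ∀ᵐ x ∂μ, (G x).im = 0 := by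
    intro G
    constructor
    · intro h
      rw [← h]
      filter_upwards [coeFn_ofL (reL G)] with x hx
      rw [hx, Complex.ofReal_im]
    · intro h
      apply Lp.ext
      filter_upwards [coeFn_ofL (reL G), coeFn_reL G, h] with x h1 h2 h3
      rw [h1, h2]
      exact Complex.ext rfl h3.symm
  have h1 : ofL (reL (T.gen 1 (Star.star f • f : Lp ℂ 1 μ))) = T.gen 1 (Star.star f • f) := by
    by_cases hd : T.InDomain 1 (Star.star f • f : Lp ℂ 1 μ)
    · have h := T.isGenerator_gen hd
      rw [IsGenerator] at h
      refine tendsto_nhds_unique (((ofL.continuous.comp reL.continuous).tendsto _).comp h) (h.congr' ?_)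
      filter_upwards [self_mem_nhdsWithin] with t ht
      have ht : 0 ≤ t := le_of_lt ht
      simp only [Function.comp_apply]
      rw [ofReal_inv_smul, ← ofL_nsq, T.op_ofL ht, ← map_sub, ← map_smul, reL_ofL]
    · rw [gen, dif_neg hd, map_zero, map_zero]
  rw [gamL, hre, Gam, T.gen_two_star hf]
  rw [hre] at h1
  set g := T.gen 2 f
  set K := T.gen 1 (Star.star f • f : Lp ℂ 1 μ)
  filter_upwards [h1, Lp.coeFn_smul (2⁻¹ : ℂ) (K - (Star.star g • f : Lp ℂ 1 μ) - (Star.star f • g)),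
    Lp.coeFn_sub (K - (Star.star g • f : Lp ℂ 1 μ)) (Star.star f • g),
    Lp.coeFn_sub K (Star.star g • f : Lp ℂ 1 μ), coeFn_star_smul g f, coeFn_star_smul f g]
    with x a1 a2 a3 a4 a5 a6
  rw [a2, Pi.smul_apply, a3, Pi.sub_apply, a4, Pi.sub_apply, a5, a6]
  simp only [Complex.star_def, smul_eq_mul, Complex.mul_im, Complex.sub_im, Complex.conj_re,
    Complex.conj_im, Complex.sub_re, Complex.mul_re, a1]
  norm_num
  ring

/-! ### Square functions of the semigroup orbits -/

variable {p : ℝ≥0∞} [Fact (1 ≤ p)] {f : Lp ℂ p μ}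

lemma SquareDomain.coeFn_flow (hf : T.SquareDomain p f) {s : ℝ} (hs : 0 < s) :
    T.flow p f s =ᵐ[μ] T.op p s f := by
  rw [flow, dif_pos (hf.1 s hs)]
  exact (hf.1 s hs).coeFn_toLp

lemma SquareDomain.isOrbit (hf : T.SquareDomain p f) : T.IsOrbit (T.flow p f) := by
  intro s t hs ht
  apply Lp.ext
  have h1 := T.compat 2 p t ht _ _ (hf.coeFn_flow hs)
  rw [← T.op_add p t s ht hs.le, add_comm t s] at h1
  exact (hf.coeFn_flow (by positivity)).trans h1.symm

lemma timeIntegral_eq {F : ℝ → Lp ℂ 1 μ} {H : ℝ → Lp ℝ 1 μ} (hF : ∀ s > 0, F s = ofL (H s))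
    (hH : ∀ a b : ℝ, 0 < a → a ≤ b → IntervalIntegrable H volume a b) :
    ∀ᵐ x ∂μ, timeIntegral F x = ⨆ n : ℕ, ENNReal.ofReal
      ((∫ s in (1 / ((n : ℝ) + 1))..((n : ℝ) + 1), H s : Lp ℝ 1 μ) x) := by
  have hab : ∀ n : ℕ, 1 / ((n : ℝ) + 1) ≤ (n : ℝ) + 1 := fun n => by
    rw [div_le_iff₀ (by positivity)]
    have : (0 : ℝ) ≤ n := n.cast_nonneg
    nlinarith
  have h : ∀ n : ℕ, (∫ s in (1 / ((n : ℝ) + 1))..((n : ℝ) + 1), F s : Lp ℂ 1 μ) =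
      ofL (∫ s in (1 / ((n : ℝ) + 1))..((n : ℝ) + 1), H s) := by
    intro n
    rw [← ofL.intervalIntegral_comp_comm (hH _ _ (by positivity) (hab n))]
    refine intervalIntegral.integral_congr fun s hs => ?_
    rw [Set.uIcc_of_le (hab n)] at hs
    exact hF s (lt_of_lt_of_le (by positivity) hs.1)
  filter_upwards [ae_all_iff.2 fun n : ℕ =>
    coeFn_ofL (∫ s in (1 / ((n : ℝ) + 1))..((n : ℝ) + 1), H s)] with x hx
  simp only [timeIntegral, h, hx, Complex.ofReal_re]

lemma SquareDomain.littlewoodPaleyFun_eq (hf : T.SquareDomain p f)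
    (hA : T.IsAdmissibleAlgebra A) :
    ∀ᵐ x ∂μ, T.littlewoodPaleyFun p f x = (⨆ n : ℕ, ENNReal.ofReal
      ((∫ s in (1 / ((n : ℝ) + 1))..((n : ℝ) + 1), T.gamL (T.flow p f s) : Lp ℝ 1 μ) x)) ^
        (1 / 2 : ℝ) := by
  filter_upwards [timeIntegral_eq (F := fun s => T.Gam (T.flow p f s) (T.flow p f s))
    (fun s hs => (ofL_gamL (hf.isOrbit.inDomain hs)).symm)
    (fun a b ha hab => hf.isOrbit.intervalIntegrable_gamL hA ha (ha.trans_le hab))] with x hx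
  rw [littlewoodPaleyFun, hx]

lemma SquareDomain.areaFun_eq (hf : T.SquareDomain p f) (hA : T.IsAdmissibleAlgebra A) :
    ∀ᵐ x ∂μ, T.areaFun p f x = (⨆ n : ℕ, ENNReal.ofReal
      (T.areaIntegral (T.flow p f) 0 (1 / ((n : ℝ) + 1)) ((n : ℝ) + 1) x)) ^ (1 / 2 : ℝ) := by
  filter_upwards [timeIntegral_eq
    (F := fun s => T.op 1 s (T.Gam (T.flow p f s) (T.flow p f s)))
    (H := fun v => T.P (v - 0) (T.gamL (T.flow p f v)))
    (fun s hs => by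
      rw [← ofL_gamL (hf.isOrbit.inDomain hs), T.op_ofL hs.le, sub_zero])
    (fun a b ha hab => hf.isOrbit.intervalIntegrable_P_gamL hA ha hab ha.le)] with x hx
  rw [areaFun, hx]
  rfl

lemma ofReal_sqrt_eq_rpow (x : ℝ) : ENNReal.ofReal √x = ENNReal.ofReal x ^ (1 / 2 : ℝ) := by
  rcases le_total 0 x with h | h
  · rw [Real.sqrt_eq_rpow, ENNReal.ofReal_rpow_of_nonneg h (by norm_num)]
  · rw [Real.sqrt_eq_zero_of_nonpos h, ENNReal.ofReal_of_nonpos h]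
    simp

lemma SquareDomain.lintegral_sqrt_area_le (hf : T.SquareDomain p f) (hA : T.IsAdmissibleAlgebra A)
    (n : ℕ) : ∫⁻ x, ENNReal.ofReal
      √(T.areaIntegral (T.flow p f) 0 (1 / ((n : ℝ) + 1)) ((n : ℝ) + 1) x) ∂μ ≤
      T.hardySNorm p f := by
  apply lintegral_mono_ae
  filter_upwards [hf.areaFun_eq hA] with x hx
  rw [hx, ofReal_sqrt_eq_rpow]
  exact ENNReal.rpow_le_rpow (le_iSup (fun n : ℕ => ENNReal.ofReal
      (T.areaIntegral (T.flow p f) 0 (1 / ((n : ℝ) + 1)) ((n : ℝ) + 1) x)) n) (by norm_num)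

lemma SquareDomain.lintegral_sqrt_gamma_le (hf : T.SquareDomain p f) (hA : T.IsAdmissibleAlgebra A)
    (n : ℕ) : ∫⁻ x, ENNReal.ofReal √((∫ s in (1 / ((n : ℝ) + 1))..((n : ℝ) + 1),
      T.gamL (T.flow p f s) : Lp ℝ 1 μ) x) ∂μ ≤ T.hardyGNorm p f := by
  apply lintegral_mono_ae
  filter_upwards [hf.littlewoodPaleyFun_eq hA] with x hx
  rw [hx, ofReal_sqrt_eq_rpow]
  exact ENNReal.rpow_le_rpow (le_iSup (fun n : ℕ => ENNReal.ofReal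
    ((∫ s in (1 / ((n : ℝ) + 1))..((n : ℝ) + 1), T.gamL (T.flow p f s) : Lp ℝ 1 μ) x)) n)
    (by norm_num)

/-- The Littlewood-Paley norm is dominated by the area norm. -/
lemma SquareDomain.hardyGNorm_le (hf : T.SquareDomain p f) (hA : T.IsAdmissibleAlgebra A)
    (hG : T.Gam2Nonneg A) : T.hardyGNorm p f ≤ 2 * T.hardySNorm p f := by
  rw [hardySNorm, ← lintegral_const_mul' _ _ (by simp)]
  apply lintegral_mono_ae
  -- The comparison halves times, so the n-th Littlewood–Paley truncation is met by the area
  -- integral from 1/(2n+2) to (n+1)/2, which lies inside truncation number 2n+1.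
  have h : ∀ᵐ x ∂μ, ∀ n : ℕ, (∫ s in (1 / ((n : ℝ) + 1))..((n : ℝ) + 1),
      T.gamL (T.flow p f s) : Lp ℝ 1 μ) x ≤ 2 *
      T.areaIntegral (T.flow p f) 0 (1 / (((2 * n + 1 : ℕ) : ℝ) + 1)) (((2 * n + 1 : ℕ) : ℝ) + 1) x := by
    refine ae_all_iff.2 fun n => ?_
    have hn : (0 : ℝ) ≤ n := n.cast_nonneg
    set a : ℝ := 1 / (((2 * n + 1 : ℕ) : ℝ) + 1) with ha
    have ha0 : 0 < a := by positivity
    have ea : 2 * a - 0 = 1 / ((n : ℝ) + 1) := by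
      rw [ha]; push_cast; field_simp; ring
    have eb : 2 * (((n : ℝ) + 1) / 2) - 0 = (n : ℝ) + 1 := by ring
    have hab : a ≤ ((n : ℝ) + 1) / 2 := by
      rw [ha, div_le_iff₀ (by positivity)]
      push_cast
      nlinarith
    have h1 := hf.isOrbit.gamma_le_areaIntegral hA hG ha0 hab ha0.le
    rw [ea, eb] at h1
    have h2 := hf.isOrbit.areaIntegral_mono hA (b := ((2 * n + 1 : ℕ) : ℝ) + 1) ha0 le_rfl hab
      (by push_cast; linarith) ha0.le
    filter_upwards [(Lp.coeFn_le _ _).2 h1, (Lp.coeFn_le _ _).2 h2,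
      Lp.coeFn_smul (2 : ℝ) (T.areaIntegral (T.flow p f) 0 a (((n : ℝ) + 1) / 2))] with x b1 b2 b3
    rw [b3, Pi.smul_apply, smul_eq_mul] at b1
    linarith
  filter_upwards [hf.littlewoodPaleyFun_eq hA, hf.areaFun_eq hA, h] with x h1 h2 h3
  have e2 : (2 : ℝ≥0∞) = (4 : ℝ≥0∞) ^ (1 / 2 : ℝ) := by
    rw [show (4 : ℝ≥0∞) = 2 ^ (2 : ℝ) by norm_num, ← ENNReal.rpow_mul]
    norm_num
  rw [h1, h2, e2, ← ENNReal.mul_rpow_of_nonneg _ _ (by norm_num)]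
  refine ENNReal.rpow_le_rpow (iSup_le fun n => ?_) (by norm_num)
  refine (ENNReal.ofReal_le_ofReal (h3 n)).trans ?_
  rw [ENNReal.ofReal_mul (by norm_num)]
  gcongr
  · rw [ENNReal.ofReal_ofNat]; norm_num
  · exact le_iSup (fun n : ℕ => ENNReal.ofReal
      (T.areaIntegral (T.flow p f) 0 (1 / ((n : ℝ) + 1)) ((n : ℝ) + 1) x)) (2 * n + 1)

end StandardSemigroup

end

noncomputable section

namespace StandardSemigroup

variable {M : Type*} [MeasurableSpace M] {μ : Measure M} {T : StandardSemigroup μ}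
  {A : Submodule ℂ (Lp ℂ ∞ μ)} {u : ℝ → Lp ℂ 2 μ}

/-! ### The bmo norm -/

variable (T) in
lemma coeFn_bmo_eq {t : ℝ} (ht : 0 ≤ t) (g : Lp ℂ 2 μ) :
    (T.op 1 t (star g • g : Lp ℂ 1 μ) - (star (T.op 2 t g) • T.op 2 t g : Lp ℂ 1 μ) : Lp ℂ 1 μ) =
      ofL (T.varL t g) := by
  rw [← ofL_nsq, ← ofL_nsq, T.op_ofL ht, ← map_sub, varL]

lemma varL_le_of_bmoNorm {g : Lp ℂ 2 μ} (hg : T.bmoNorm g ≠ ∞) {t : ℝ} (ht : 0 < t) :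
    ∀ᵐ x ∂μ, T.varL t g x ≤ (T.bmoNorm g).toReal ^ 2 := by
  have h1 : eLpNorm (ofL (T.varL t g)) ∞ μ ≤ T.bmoNorm g ^ (2 : ℝ) := by
    have h2 : eLpNorm (ofL (T.varL t g)) ∞ μ ^ (1 / 2 : ℝ) ≤ T.bmoNorm g := by
      rw [← T.coeFn_bmo_eq ht.le]
      exact le_iSup₂ (f := fun (t : ℝ) (_ : 0 < t) => eLpNorm ((T.op 1 t (star g • g : Lp ℂ 1 μ)
        - (star (T.op 2 t g) • T.op 2 t g : Lp ℂ 1 μ) : Lp ℂ 1 μ)) ∞ μ ^ (1 / 2 : ℝ)) t ht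
    have h3 := ENNReal.rpow_le_rpow h2 (z := 2) (by norm_num)
    rwa [← ENNReal.rpow_mul, show (1 / 2 : ℝ) * 2 = 1 by norm_num, ENNReal.rpow_one] at h3
  rw [eLpNorm_exponent_top] at h1
  filter_upwards [ae_le_eLpNormEssSup (f := ofL (T.varL t g)) (μ := μ), coeFn_ofL (T.varL t g)]
    with x hx hx'
  have h4 := hx.trans h1
  rw [hx', ENNReal.rpow_ofNat, ← ENNReal.ofReal_toReal hg, ← ENNReal.ofReal_pow ENNReal.toReal_nonneg,
    ← ofReal_norm, Complex.norm_real, ENNReal.ofReal_le_ofReal_iff (by positivity)] at h4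
  exact (le_abs_self _).trans h4

lemma bmoNorm_le_of_varL_le {g h : Lp ℂ 2 μ}
    (hgh : ∀ t : ℝ, 0 < t → T.varL t h ≤ T.varL t g) : T.bmoNorm h ≤ T.bmoNorm g := by
  refine iSup₂_mono fun t ht => ENNReal.rpow_le_rpow ?_ (by norm_num)
  rw [T.coeFn_bmo_eq ht.le, T.coeFn_bmo_eq ht.le]
  apply eLpNorm_mono_ae
  filter_upwards [coeFn_ofL (T.varL t g), coeFn_ofL (T.varL t h), (Lp.coeFn_le _ _).2 (hgh t ht),
    (Lp.coeFn_nonneg _).2 (T.varL_nonneg ht.le h)] with x h1 h2 h3 h4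
  rw [h1, h2, Complex.norm_real, Complex.norm_real, Real.norm_of_nonneg h4,
    Real.norm_of_nonneg (h4.trans h3)]
  exact h3

/-- The initial term of the accumulated gradient is dominated by a variance of g, and all of these
vanish. -/
lemma gamL_eq_zero_of_bmoNorm (hA : T.IsAdmissibleAlgebra A) (hG : T.Gam2Nonneg A) {g : Lp ℂ 2 μ}
    (hg : T.bmoNorm g = 0) {s : ℝ} (hs : 0 < s) : T.gamL (T.op 2 s g) = 0 := by
  have h1 := smul_accumulated_le_varL hA hG g (s := s) (half_pos hs) (half_lt_self hs)
    (U := fun j => Nat.rec (T.gamL (T.op 2 s g))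
      (fun j y => T.P (s / 2) y + T.gamL (T.op 2 (s + (j + 1 : ℕ) * (s / 2)) g)) j)
    rfl (fun j => rfl) 0
  have h2 := varL_le_of_bmoNorm (T := T) (g := g) (by rw [hg]; simp) (t := s + (0 : ℕ) * (s / 2))
    (by simpa using hs)
  have h3 := (T.isOrbit_op g).gamL_nonneg hA hs
  refine le_antisymm ?_ h3
  rw [← Lp.coeFn_le]
  set F := T.gamL (T.op 2 s g)
  filter_upwards [(Lp.coeFn_le _ _).2 h1, h2, Lp.coeFn_smul (s / 2) ((2 : ℝ) • F),
    Lp.coeFn_smul (2 : ℝ) F, Lp.coeFn_zero ℝ 1 μ] with x a1 a2 a3 a4 a5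
  have a3' : (s / 2 * (2 * F x)) ≤ T.varL (s + (0 : ℕ) * (s / 2)) g x := by
    refine le_trans (le_of_eq ?_) a1
    refine Eq.symm (a3.trans ?_)
    rw [Pi.smul_apply, a4, Pi.smul_apply, smul_eq_mul, smul_eq_mul]
  rw [hg] at a2
  simp only [ENNReal.toReal_zero] at a2
  rw [a5, Pi.zero_apply]
  have : s * F x ≤ 0 := by nlinarith
  exact nonpos_of_mul_nonpos_right this hs

/-! ### The duality estimate -/

variable {p : ℝ≥0∞} [Fact (1 ≤ p)] {f : Lp ℂ p μ}

/-- In [0, ∞] the product may read 0 · ∞ = 0, so a vanishing factor must force the left side to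
vanish even when another factor is infinite. This comes from the constant-weight estimate, in which
one gradient integral is then zero. Otherwise an infinite factor makes the bound trivial, and the
finite case is the main estimate. -/
lemma SquareDomain.enorm_inner_sub_sq_le (hf : T.SquareDomain p f) (hA : T.IsAdmissibleAlgebra A)
    (hG : T.Gam2Nonneg A) (g : Lp ℂ 2 μ) {n : ℕ} (hn : 0 < n) :
    ‖inner ℂ (star (T.flow p f ((n : ℝ) + 1))) (T.op 2 ((n : ℝ) + 1) g) -
      inner ℂ (star (T.flow p f (1 / ((n : ℝ) + 1)))) (T.op 2 (1 / ((n : ℝ) + 1)) g)‖ₑ ^ 2 ≤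
      9 * (T.hardySNorm p f * T.hardyGNorm p f * T.bmoNorm g ^ 2) := by
  have hn0 : (0 : ℝ) < n := by exact_mod_cast hn
  set ε : ℝ := 1 / ((n : ℝ) + 1) with hεdef
  set N : ℝ := (n : ℝ) + 1 with hNdef
  have hε : 0 < ε := by positivity
  have hεN : ε < N := by
    rw [hεdef, div_lt_iff₀ (by positivity), hNdef]
    nlinarith
  have hu := hf.isOrbit.star
  have hw := T.isOrbit_op g
  have hγ : ∫ s in ε..N, T.gamL (star (T.flow p f s)) = ∫ s in ε..N, T.gamL (T.flow p f s) := by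
    refine intervalIntegral.integral_congr fun s hs => ?_
    rw [Set.uIcc_of_le hεN.le] at hs
    exact hf.isOrbit.gamL_star hA (hε.trans_le hs.1)
  have hσ : T.areaIntegral (fun s => star (T.flow p f s)) 0 ε N =
      T.areaIntegral (T.flow p f) 0 ε N := by
    refine intervalIntegral.integral_congr fun s hs => ?_
    rw [Set.uIcc_of_le hεN.le] at hs
    simp only
    rw [hf.isOrbit.gamL_star hA (hε.trans_le hs.1)]
  have hle_tau := hu.norm_inner_sub_le_tau hw hA hε hεN.le
  rw [hγ] at hle_tau
  set z := inner ℂ (star (T.flow p f N)) (T.op 2 N g) - inner ℂ (star (T.flow p f ε)) (T.op 2 ε g)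
    with hz
  have hSn := hf.lintegral_sqrt_area_le hA n
  have hGn := hf.lintegral_sqrt_gamma_le hA n
  have hGS := hf.hardyGNorm_le hA hG
  have hzero : ‖z‖ ^ 2 ≤ 0 → ‖z‖ₑ ^ 2 ≤
      9 * (T.hardySNorm p f * T.hardyGNorm p f * T.bmoNorm g ^ 2) := by
    intro h
    have : z = 0 := norm_eq_zero.1 (pow_eq_zero_iff two_ne_zero |>.1 (le_antisymm h (by positivity)))
    simp [this]
  rcases eq_or_ne (T.hardyGNorm p f) 0 with hG0 | hG0
  · rw [hG0, nonpos_iff_eq_zero, lintegral_eq_zero_iff'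
      (Lp.aestronglyMeasurable _).aemeasurable.sqrt.ennreal_ofReal] at hGn
    have h0 : ∫ s in ε..N, T.gamL (T.flow p f s) = 0 := by
      refine le_antisymm ?_ (hf.isOrbit.gamma_nonneg hA hε hεN.le)
      rw [← Lp.coeFn_le]
      filter_upwards [hGn, Lp.coeFn_zero ℝ 1 μ] with x h1 h2
      rw [h2, Pi.zero_apply]
      exact Real.sqrt_eq_zero'.1 (le_antisymm (ENNReal.ofReal_eq_zero.1 h1) (Real.sqrt_nonneg _))
    rw [h0, map_zero, zero_mul, mul_zero] at hle_tau
    exact hzero hle_tau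
  rcases eq_or_ne (T.bmoNorm g) 0 with hB0 | hB0
  · have h0 : ∫ s in ε..N, T.gamL (T.op 2 s g) = 0 := by
      rw [← intervalIntegral.integral_zero (E := Lp ℝ 1 μ) (μ := volume) (a := ε) (b := N)]
      refine intervalIntegral.integral_congr fun s hs => ?_
      rw [Set.uIcc_of_le hεN.le] at hs
      exact gamL_eq_zero_of_bmoNorm hA hG hB0 (hε.trans_le hs.1)
    rw [h0, map_zero, mul_zero, mul_zero] at hle_tau
    exact hzero hle_tau
  have hS0 : T.hardySNorm p f ≠ 0 := by
    intro h
    rw [h, mul_zero, nonpos_iff_eq_zero] at hGS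
    exact hG0 hGS
  rcases eq_or_ne (T.bmoNorm g) ∞ with hB | hB
  · simp [hB, ENNReal.mul_top, hS0, hG0]
  rcases eq_or_ne (T.hardySNorm p f) ∞ with hS | hS
  · simp [hS, ENNReal.top_mul, ENNReal.mul_top, hG0, hB0]
  have hGfin : T.hardyGNorm p f ≠ ∞ := ne_top_of_le_ne_top (by finiteness) hGS
  have key := hu.norm_inner_sub_sq_le hA hG (g := g) (β := (T.bmoNorm g).toReal ^ 2) (by positivity)
    (fun t ht => varL_le_of_bmoNorm hB ht) hε hεN (by
      rw [hσ]; exact ne_top_of_le_ne_top hS hSn)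
  rw [hγ, hσ] at key
  have h1 : ‖z‖ ^ 2 ≤ 9 * ((T.hardySNorm p f).toReal * (T.hardyGNorm p f).toReal *
      (T.bmoNorm g).toReal ^ 2) := by
    refine key.trans ?_
    gcongr
  have h2 := ENNReal.ofReal_le_ofReal h1
  rw [ENNReal.ofReal_pow (norm_nonneg _), ofReal_norm, ENNReal.ofReal_mul (by norm_num),
    ENNReal.ofReal_mul (by positivity), ENNReal.ofReal_mul (by positivity),
    ENNReal.ofReal_pow ENNReal.toReal_nonneg, ENNReal.ofReal_toReal hS, ENNReal.ofReal_toReal hGfin,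
    ENNReal.ofReal_toReal hB, ENNReal.ofReal_ofNat] at h2
  exact h2

lemma inner_star_eq_integral (k g : Lp ℂ 2 μ) : inner ℂ (star k) g = ∫ x, k x * g x ∂μ := by
  rw [L2.inner_def]
  apply integral_congr_ae
  filter_upwards [Lp.coeFn_star k] with x hx
  rw [hx]
  simp [mul_comm]

lemma norm_star_eq (k : Lp ℂ 2 μ) : ‖star k‖ = ‖k‖ := by
  rw [Lp.norm_def, Lp.norm_def]
  congr 1
  apply eLpNorm_congr_norm_ae
  filter_upwards [Lp.coeFn_star k] with x hx
  rw [hx, Pi.star_apply, norm_star]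

/-- The duality estimate for the limit of the pairings at time `0`. -/
lemma SquareDomain.enorm_le_of_tendsto (hf : T.SquareDomain p f) (hA : T.IsAdmissibleAlgebra A)
    (hG : T.Gam2Nonneg A) (g : Lp ℂ 2 μ) {I : ℂ}
    (hI : Tendsto (fun s : ℝ => ∫ x, T.op p s f x * g x ∂μ) (𝓝[>] 0) (𝓝 I)) :
    ‖I‖ₑ ≤ 3 * T.hardySNorm p f ^ (1 / 2 : ℝ) * T.hardyGNorm p f ^ (1 / 2 : ℝ) * T.bmoNorm g := by
  have hu := hf.isOrbit.star
  -- Symmetry puts both operators on f, doubling the time; only the limit of the pairing with T_{2s}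
  -- f at time 0 is then needed.
  have hy : ∀ s : ℝ, 0 < s → inner ℂ (star (T.flow p f s)) (T.op 2 s g) =
      ∫ x, T.op p (s + s) f x * g x ∂μ := by
    intro s hs
    have h1 := hu s s hs hs.le
    simp only at h1
    rw [← T.symm s hs.le, ← h1, inner_star_eq_integral]
    apply integral_congr_ae
    filter_upwards [hf.coeFn_flow (s := s + s) (by positivity)] with x hx
    rw [hx]
  have hlimε : Tendsto (fun n : ℕ => 1 / ((n : ℝ) + 1) + 1 / ((n : ℝ) + 1)) atTop (𝓝[>] 0) := by
    rw [tendsto_nhdsWithin_iff]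
    refine ⟨?_, Eventually.of_forall fun n => Set.mem_Ioi.2 (by positivity)⟩
    simpa using (tendsto_one_div_add_atTop_nhds_zero_nat (𝕜 := ℝ)).add
      tendsto_one_div_add_atTop_nhds_zero_nat
  have hlim1 : Tendsto (fun n : ℕ => inner ℂ (star (T.flow p f (1 / ((n : ℝ) + 1))))
      (T.op 2 (1 / ((n : ℝ) + 1)) g)) atTop (𝓝 I) := by
    refine (hI.comp hlimε).congr fun n => ?_
    rw [hy _ (by positivity)]
    rfl
  have hlim2 : Tendsto (fun n : ℕ => inner ℂ (star (T.flow p f ((n : ℝ) + 1)))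
      (T.op 2 ((n : ℝ) + 1) g)) atTop (𝓝 0) := by
    have hN : Tendsto (fun n : ℕ => (n : ℝ) + 1) atTop atTop :=
      tendsto_atTop_add_const_right _ _ tendsto_natCast_atTop_atTop
    have h1 := (hf.2.comp hN).norm.mul_const ‖g‖
    rw [norm_zero, zero_mul] at h1
    refine squeeze_zero_norm (fun n => ?_) h1
    refine (norm_inner_le_norm _ _).trans ?_
    rw [norm_star_eq]
    exact mul_le_mul_of_nonneg_left (T.contraction 2 _ (by positivity) g) (norm_nonneg _)
  have hlim := ((ENNReal.continuous_pow 2).tendsto _).comp (hlim2.sub hlim1).enorm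
  rw [zero_sub, enorm_neg] at hlim
  have hsq : ‖I‖ₑ ^ 2 ≤ 9 * (T.hardySNorm p f * T.hardyGNorm p f * T.bmoNorm g ^ 2) := by
    refine le_of_tendsto hlim ?_
    filter_upwards [eventually_gt_atTop 0] with n hn
    exact hf.enorm_inner_sub_sq_le hA hG g hn
  have h1 := ENNReal.rpow_le_rpow hsq (z := 1 / 2) (by norm_num)
  have hhalf : ∀ a : ℝ≥0∞, (a ^ 2) ^ (1 / 2 : ℝ) = a := fun a => by
    rw [← ENNReal.rpow_ofNat, ← ENNReal.rpow_mul]; norm_num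
  have h9 : (9 : ℝ≥0∞) ^ (1 / 2 : ℝ) = 3 := by
    rw [show (9 : ℝ≥0∞) = 3 ^ 2 by norm_num, hhalf]
  rw [hhalf, ENNReal.mul_rpow_of_nonneg _ _ (by norm_num), ENNReal.mul_rpow_of_nonneg _ _ (by norm_num),
    ENNReal.mul_rpow_of_nonneg _ _ (by norm_num), hhalf, h9] at h1
  refine h1.trans (le_of_eq ?_)
  ring

/-- The factor 2 between the two norms is enlarged to 2² so that its root is exact; this gives 6 = 3
· 2. -/
lemma SquareDomain.mul_rpow_le (hf : T.SquareDomain p f) (hA : T.IsAdmissibleAlgebra A)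
    (hG : T.Gam2Nonneg A) (g : Lp ℂ 2 μ) :
    3 * T.hardySNorm p f ^ (1 / 2 : ℝ) * T.hardyGNorm p f ^ (1 / 2 : ℝ) * T.bmoNorm g ≤
      6 * T.hardySNorm p f * T.bmoNorm g := by
  have h1 : T.hardyGNorm p f ^ (1 / 2 : ℝ) ≤ 2 * T.hardySNorm p f ^ (1 / 2 : ℝ) := by
    have h2 : T.hardyGNorm p f ≤ 2 ^ (2 : ℝ) * T.hardySNorm p f :=
      (hf.hardyGNorm_le hA hG).trans (by gcongr; norm_num)
    have h3 := ENNReal.rpow_le_rpow h2 (z := 1 / 2) (by norm_num)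
    rwa [ENNReal.mul_rpow_of_nonneg _ _ (by norm_num), ← ENNReal.rpow_mul,
      show (2 : ℝ) * (1 / 2) = 1 by norm_num, ENNReal.rpow_one] at h3
  have h4 : T.hardySNorm p f ^ (1 / 2 : ℝ) * T.hardySNorm p f ^ (1 / 2 : ℝ) = T.hardySNorm p f := by
    rw [← ENNReal.rpow_add_of_nonneg _ _ (by norm_num) (by norm_num)]
    norm_num
  calc _ ≤ 3 * T.hardySNorm p f ^ (1 / 2 : ℝ) * (2 * T.hardySNorm p f ^ (1 / 2 : ℝ)) *
        T.bmoNorm g := by gcongr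
    _ = (3 * 2) * (T.hardySNorm p f ^ (1 / 2 : ℝ) * T.hardySNorm p f ^ (1 / 2 : ℝ)) *
        T.bmoNorm g := by ring
    _ = _ := by rw [h4]; norm_num

end StandardSemigroup

end

noncomputable section

namespace StandardSemigroup

variable {M : Type*} [MeasurableSpace M] {μ : Measure M} {T : StandardSemigroup μ}
  {A : Submodule ℂ (Lp ℂ ∞ μ)} {u : ℝ → Lp ℂ 2 μ}

/-! ### Truncation -/

/-- The radial retraction of the plane onto the disc of radius `k`. -/
def retract (k : ℝ) (z : ℂ) : ℂ := ((min 1 (k / ‖z‖) : ℝ) : ℂ) * z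

lemma measurable_retract (k : ℝ) : Measurable (retract k) := by
  unfold retract
  fun_prop

lemma retract_eq_self {k : ℝ} {z : ℂ} (h : ‖z‖ ≤ k) : retract k z = z := by
  rcases eq_or_ne z 0 with rfl | hz
  · simp [retract]
  · have : 1 ≤ k / ‖z‖ := (one_le_div (norm_pos_iff.2 hz)).2 h
    rw [retract, min_eq_left this, Complex.ofReal_one, one_mul]

lemma retract_of_lt {k : ℝ} {z : ℂ} (hk : 0 < k) (h : k < ‖z‖) :
    retract k z = ((k / ‖z‖ : ℝ) : ℂ) * z := by
  rw [retract, min_eq_right ((div_le_one (hk.trans h)).2 h.le)]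

lemma norm_retract_le_norm {k : ℝ} (hk : 0 < k) (z : ℂ) : ‖retract k z‖ ≤ ‖z‖ := by
  have h0 : 0 ≤ min 1 (k / ‖z‖) := le_min zero_le_one (by positivity)
  rw [retract, norm_mul, Complex.norm_real, Real.norm_of_nonneg h0]
  exact mul_le_of_le_one_left (norm_nonneg _) (min_le_left _ _)

lemma norm_retract_le {k : ℝ} (hk : 0 < k) (z : ℂ) : ‖retract k z‖ ≤ k := by
  rcases le_or_gt ‖z‖ k with h | h
  · rwa [retract_eq_self h]
  · have hz : 0 < ‖z‖ := hk.trans h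
    rw [retract_of_lt hk h, norm_mul, Complex.norm_real, Real.norm_of_nonneg (by positivity),
      div_mul_cancel₀ _ hz.ne']

/-- Outside the disc, z - `retract k z` points in the direction of `retract k z`, which has modulus
k, so the cross term is 2k times its length. -/
lemma norm_sq_eq_retract {k : ℝ} (hk : 0 < k) (z : ℂ) :
    ‖z‖ ^ 2 = ‖retract k z‖ ^ 2 + ‖z - retract k z‖ ^ 2 + 2 * k * ‖z - retract k z‖ := by
  rcases le_or_gt ‖z‖ k with h | h
  · simp [retract_eq_self h]
  · have hz : 0 < ‖z‖ := hk.trans h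
    have e : z - retract k z = ((1 - k / ‖z‖ : ℝ) : ℂ) * z := by
      rw [retract_of_lt hk h]; push_cast; ring
    have h1 : 0 ≤ 1 - k / ‖z‖ := sub_nonneg.2 ((div_le_one hz).2 h.le)
    rw [e, retract_of_lt hk h, norm_mul, norm_mul, Complex.norm_real, Complex.norm_real,
      Real.norm_of_nonneg h1, Real.norm_of_nonneg (by positivity)]
    field_simp
    ring

lemma norm_sub_retract_le {k : ℝ} (hk : 0 < k) (z : ℂ) : ‖z - retract k z‖ ≤ k⁻¹ * ‖z‖ ^ 2 := by
  have h := norm_sq_eq_retract hk z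
  rw [← div_eq_inv_mul, le_div_iff₀ hk]
  have h1 : 0 ≤ ‖z - retract k z‖ * k := by positivity
  nlinarith [sq_nonneg ‖retract k z‖, sq_nonneg ‖z - retract k z‖]

lemma memLp_retract {k : ℝ} (hk : 0 < k) (g : Lp ℂ 2 μ) : MemLp (fun x => retract k (g x)) 2 μ :=
  (Lp.memLp g).mono ((measurable_retract k).comp_aemeasurable
    (Lp.aestronglyMeasurable g).aemeasurable).aestronglyMeasurable
    (ae_of_all _ fun x => norm_retract_le_norm hk (g x))

/-- Truncation does not increase the variances `T_t|g|² - |T_t g|²`. -/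
lemma varL_retract_le {k : ℝ} (hk : 0 < k) (g : Lp ℂ 2 μ) {t : ℝ} (ht : 0 ≤ t) :
    T.varL t ((memLp_retract hk g).toLp _) ≤ T.varL t g := by
  set h : Lp ℂ 2 μ := (memLp_retract hk g).toLp _ with hh
  have hhe : h =ᵐ[μ] fun x => retract k (g x) := (memLp_retract hk g).coeFn_toLp
  set e : Lp ℂ 2 μ := g - h with he
  have hee : e =ᵐ[μ] fun x => g x - retract k (g x) := by
    filter_upwards [Lp.coeFn_sub g h, hhe] with x h1 h2
    rw [h1, Pi.sub_apply, h2]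
  have hge : g = h + e := by rw [he]; abel
  -- The excess is at most k⁻¹|g|², hence integrable, so the pointwise bound |T_t e| ≤ T_t|e| in L¹
  -- is available.
  have he1 : MemLp e 1 μ := by
    rw [memLp_one_iff_integrable]
    refine ((L1.integrable_coeFn (nsq g)).const_mul k⁻¹).mono' (Lp.aestronglyMeasurable e) ?_
    filter_upwards [hee, coeFn_nsq g] with x h1 h2
    rw [h1, h2]
    exact norm_sub_retract_le hk _
  set e₁ : Lp ℂ 1 μ := he1.toLp e
  have hee₁ : e =ᵐ[μ] e₁ := he1.coeFn_toLp.symm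
  have hop := T.compat 2 1 t ht e e₁ hee₁
  have hn : nsq g = nsq h + nsq e + (2 * k) • absL e₁ := by
    apply Lp.ext
    filter_upwards [coeFn_nsq g, coeFn_nsq h, coeFn_nsq e, hhe, hee, hee₁, coeFn_absL e₁,
      Lp.coeFn_add (nsq h + nsq e) ((2 * k) • absL e₁), Lp.coeFn_add (nsq h) (nsq e),
      Lp.coeFn_smul (2 * k) (absL e₁)] with x a1 a2 a3 a4 a5 a6 a7 a8 a9 a10
    rw [a8, Pi.add_apply, a9, Pi.add_apply, a10, Pi.smul_apply, smul_eq_mul, a1, a2, a3, a7, ← a6,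
      a4, a5]
    exact norm_sq_eq_retract hk _
  have hPn : T.P t (nsq g) = T.P t (nsq h) + T.P t (nsq e) + (2 * k) • T.P t (absL e₁) := by
    rw [hn, map_add, map_add, map_smul]
  have hTh : ∀ᵐ x ∂μ, ‖T.op 2 t h x‖ ≤ k := T.norm_op_le_of_norm_le ht h hk.le (by
    filter_upwards [hhe] with x hx
    rw [hx]
    exact norm_retract_le hk _)
  rw [← Lp.coeFn_le]
  simp only [varL]
  rw [hPn]
  set Ph := T.P t (nsq h)
  set Pe := T.P t (nsq e)
  set Pa := T.P t (absL e₁)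
  have hop2 : T.op 2 t g = T.op 2 t h + T.op 2 t e := by rw [← map_add, ← hge]
  filter_upwards [hTh, hop, T.norm_op_one_le ht e₁, (Lp.coeFn_le _ _).2 (T.nsq_op_le ht e),
    coeFn_nsq (T.op 2 t e), coeFn_nsq (T.op 2 t h), coeFn_nsq (T.op 2 t g),
    Lp.coeFn_add (T.op 2 t h) (T.op 2 t e), Lp.coeFn_sub Ph (nsq (T.op 2 t h)),
    Lp.coeFn_sub (Ph + Pe + (2 * k) • Pa) (nsq (T.op 2 t g)), Lp.coeFn_add (Ph + Pe) ((2 * k) • Pa),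
    Lp.coeFn_add Ph Pe, Lp.coeFn_smul (2 * k) Pa] with x a1 a2 a3 a4 a5 a6 a7 a8 a9 a10 a11 a12 a13
  rw [a9, Pi.sub_apply, a10, Pi.sub_apply, a11, Pi.add_apply, a12, Pi.add_apply, a13, Pi.smul_apply,
    smul_eq_mul, a6, a7, hop2, a8, Pi.add_apply]
  rw [a5] at a4
  rw [← a2] at a3
  -- The variance grows by T_t|e|² + 2k T_t|e| on one side and loses |T_t e|² and a cross term on
  -- the other. Since |T_t h| ≤ k, the cross term is at most 2k T_t|e|, and the Schwarz inequality
  -- covers the square.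
  have h1 : ‖T.op 2 t h x + T.op 2 t e x‖ ≤ ‖T.op 2 t h x‖ + ‖T.op 2 t e x‖ := norm_add_le _ _
  have h2 : ‖T.op 2 t h x‖ * ‖T.op 2 t e x‖ ≤ k * Pa x :=
    mul_le_mul a1 a3 (norm_nonneg _) hk.le
  have h3 := pow_le_pow_left₀ (norm_nonneg _) h1 2
  have a4 : ‖T.op 2 t e x‖ ^ 2 ≤ Pe x := a4
  nlinarith

lemma bmoNorm_retract_le {k : ℝ} (hk : 0 < k) (g : Lp ℂ 2 μ) :
    T.bmoNorm ((memLp_retract hk g).toLp _) ≤ T.bmoNorm g :=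
  bmoNorm_le_of_varL_le fun _ ht => varL_retract_le hk g ht.le

lemma integrable_mul_retract (f : Lp ℂ 1 μ) (g : Lp ℂ 2 μ) {k : ℝ} (hk : 0 < k) :
    Integrable (fun x => f x * retract k (g x)) μ :=
  (L1.integrable_coeFn f).mul_bdd (c := k) (memLp_retract hk g).1
    (ae_of_all _ fun _ => norm_retract_le hk _)

lemma tendsto_integral_mul_retract {f : Lp ℂ 1 μ} {g : Lp ℂ 2 μ}
    (hfg : Integrable (fun x => f x * g x) μ) :
    Tendsto (fun n : ℕ => ∫ x, f x * retract ((n : ℝ) + 1) (g x) ∂μ) atTop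
      (𝓝 (∫ x, f x * g x ∂μ)) := by
  refine tendsto_integral_of_dominated_convergence (fun x => ‖f x * g x‖)
    (fun n => (integrable_mul_retract f g (by positivity)).1) hfg.norm (fun n => ?_) ?_
  · refine ae_of_all _ fun x => ?_
    rw [norm_mul, norm_mul]
    exact mul_le_mul_of_nonneg_left (norm_retract_le_norm (by positivity) _) (norm_nonneg _)
  · refine ae_of_all _ fun x => tendsto_const_nhds.congr' ?_
    filter_upwards [eventually_ge_atTop ⌈‖g x‖⌉₊] with n hn
    have h1 : ‖g x‖ ≤ (n : ℝ) := (Nat.le_ceil _).trans (by exact_mod_cast hn)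
    rw [retract_eq_self (by linarith)]

/-! ### The estimates at time zero -/

lemma SquareDomain.enorm_integral_two_le {f : Lp ℂ 2 μ} (hf : T.SquareDomain 2 f)
    (hA : T.IsAdmissibleAlgebra A) (hG : T.Gam2Nonneg A) (g : Lp ℂ 2 μ) :
    ‖∫ x, f x * g x ∂μ‖ₑ ≤
      3 * T.hardySNorm 2 f ^ (1 / 2 : ℝ) * T.hardyGNorm 2 f ^ (1 / 2 : ℝ) * T.bmoNorm g := by
  refine hf.enorm_le_of_tendsto hA hG g ?_
  simp only [← inner_star_eq_integral, ← conjL_apply]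
  have h1 := (conjL.continuous.tendsto f).comp (T.continuous_zero f)
  exact h1.inner tendsto_const_nhds

/-- With g truncated, the pairing with T_s f converges as s → 0 by L¹ continuity alone, so
integrability of fg plays no role; the bmo norm has not grown. -/
lemma SquareDomain.enorm_integral_retract_le {f : Lp ℂ 1 μ} (hf : T.SquareDomain 1 f)
    (hA : T.IsAdmissibleAlgebra A) (hG : T.Gam2Nonneg A) (g : Lp ℂ 2 μ) {k : ℝ} (hk : 0 < k) :
    ‖∫ x, f x * retract k (g x) ∂μ‖ₑ ≤
      3 * T.hardySNorm 1 f ^ (1 / 2 : ℝ) * T.hardyGNorm 1 f ^ (1 / 2 : ℝ) * T.bmoNorm g := by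
  set h : Lp ℂ 2 μ := (memLp_retract hk g).toLp _ with hh
  have hhe : h =ᵐ[μ] fun x => retract k (g x) := (memLp_retract hk g).coeFn_toLp
  have key := hf.enorm_le_of_tendsto hA hG h (I := ∫ x, f x * retract k (g x) ∂μ) (by
    have hint : ∀ F : Lp ℂ 1 μ, ∫ x, F x * h x ∂μ = ∫ x, F x * retract k (g x) ∂μ := fun F => by
      apply integral_congr_ae
      filter_upwards [hhe] with x hx
      rw [hx]
    simp only [hint]
    rw [tendsto_iff_norm_sub_tendsto_zero]
    have h0 := (tendsto_iff_norm_sub_tendsto_zero.1 (T.tendsto_op_one_zero f)).mul_const k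
    rw [zero_mul] at h0
    refine squeeze_zero (fun s => norm_nonneg _) (fun s => ?_) h0
    rw [← integral_sub (integrable_mul_retract _ g hk) (integrable_mul_retract _ g hk),
      L1.norm_eq_integral_norm, ← integral_mul_const]
    refine norm_integral_le_of_norm_le ((L1.integrable_coeFn _).norm.mul_const k) ?_
    filter_upwards [Lp.coeFn_sub (T.op 1 s f) f] with x hx
    rw [hx, Pi.sub_apply, ← sub_mul, norm_mul]
    exact mul_le_mul_of_nonneg_left (norm_retract_le hk _) (norm_nonneg _))
  refine key.trans ?_
  gcongr
  exact bmoNorm_retract_le hk g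

lemma SquareDomain.enorm_integral_one_le {f : Lp ℂ 1 μ} (hf : T.SquareDomain 1 f)
    (hA : T.IsAdmissibleAlgebra A) (hG : T.Gam2Nonneg A) (g : Lp ℂ 2 μ)
    (hfg : Integrable (fun x => f x * g x) μ) :
    ‖∫ x, f x * g x ∂μ‖ₑ ≤
      3 * T.hardySNorm 1 f ^ (1 / 2 : ℝ) * T.hardyGNorm 1 f ^ (1 / 2 : ℝ) * T.bmoNorm g :=
  le_of_tendsto (tendsto_integral_mul_retract hfg).enorm
    (Eventually.of_forall fun _ => hf.enorm_integral_retract_le hA hG g (by positivity))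

/-! ### The functional defined by an element of bmo -/

lemma SquareDomain.zero : T.SquareDomain 1 (0 : Lp ℂ 1 μ) := by
  have h0 : ∀ s, T.op 1 s (0 : Lp ℂ 1 μ) =ᵐ[μ] fun _ => (0 : ℂ) := fun s => by
    rw [map_zero]; exact Lp.coeFn_zero ℂ 1 μ
  have hm : ∀ s, MemLp (T.op 1 s (0 : Lp ℂ 1 μ)) 2 μ := fun s =>
    (memLp_congr_ae (h0 s)).2 MemLp.zero'
  refine ⟨fun s _ => hm s, tendsto_const_nhds.congr fun s => ?_⟩
  apply Lp.ext
  rw [flow, dif_pos (hm s)]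
  filter_upwards [(hm s).coeFn_toLp, h0 s, Lp.coeFn_zero ℂ 2 μ] with x h1 h2 h3
  rw [h1, h2, h3, Pi.zero_apply]

lemma SquareDomain.add {f g : Lp ℂ 1 μ} (hf : T.SquareDomain 1 f) (hg : T.SquareDomain 1 g) :
    T.SquareDomain 1 (f + g) := by
  have h0 : ∀ s, T.op 1 s (f + g) =ᵐ[μ] ⇑(T.op 1 s f) + ⇑(T.op 1 s g) := fun s => by
    rw [map_add]; exact Lp.coeFn_add _ _
  have hm : ∀ s, 0 < s → MemLp (T.op 1 s (f + g)) 2 μ := fun s hs =>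
    (memLp_congr_ae (h0 s)).2 ((hf.1 s hs).add (hg.1 s hs))
  refine ⟨hm, ?_⟩
  have hl := hf.2.add hg.2
  rw [add_zero] at hl
  refine hl.congr' ?_
  filter_upwards [eventually_gt_atTop 0] with s hs
  apply Lp.ext
  rw [flow, flow, flow, dif_pos (hm s hs), dif_pos (hf.1 s hs), dif_pos (hg.1 s hs), ← MemLp.toLp_add]
  exact ((hf.1 s hs).add (hg.1 s hs)).coeFn_toLp.trans ((h0 s).symm.trans (hm s hs).coeFn_toLp.symm)

lemma SquareDomain.smul {f : Lp ℂ 1 μ} (c : ℂ) (hf : T.SquareDomain 1 f) :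
    T.SquareDomain 1 (c • f) := by
  have h0 : ∀ s, T.op 1 s (c • f) =ᵐ[μ] c • ⇑(T.op 1 s f) := fun s => by
    rw [map_smul]; exact Lp.coeFn_smul _ _
  have hm : ∀ s, 0 < s → MemLp (T.op 1 s (c • f)) 2 μ := fun s hs =>
    (memLp_congr_ae (h0 s)).2 ((hf.1 s hs).const_smul c)
  refine ⟨hm, ?_⟩
  have hl := hf.2.const_smul c
  rw [smul_zero] at hl
  refine hl.congr' ?_
  filter_upwards [eventually_gt_atTop 0] with s hs
  apply Lp.ext
  rw [flow, flow, dif_pos (hm s hs), dif_pos (hf.1 s hs), ← MemLp.toLp_const_smul]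
  exact ((hf.1 s hs).const_smul c).coeFn_toLp.trans ((h0 s).symm.trans (hm s hs).coeFn_toLp.symm)

lemma squareDomain_of_mem_hardyS {f : Lp ℂ 1 μ} (hf : f ∈ T.hardyS) : T.SquareDomain 1 f := by
  induction hf using Submodule.span_induction with
  | mem x hx => exact hx.1
  | zero => exact .zero
  | add x y _ _ hx hy => exact hx.add hy
  | smul c x _ hx => exact hx.smul c

/-- The pairing of `f ∈ L¹` with the `n`-th truncation of `g`. -/
def truncPairing (g : Lp ℂ 2 μ) (n : ℕ) : Lp ℂ 1 μ →ₗ[ℂ] ℂ where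
  toFun f := ∫ x, f x * retract ((n : ℝ) + 1) (g x) ∂μ
  map_add' f h := by
    rw [← integral_add (integrable_mul_retract f g (by positivity))
      (integrable_mul_retract h g (by positivity))]
    apply integral_congr_ae
    filter_upwards [Lp.coeFn_add f h] with x hx
    rw [hx, Pi.add_apply, add_mul]
  map_smul' c f := by
    rw [RingHom.id_apply, smul_eq_mul, ← integral_const_mul]
    apply integral_congr_ae
    filter_upwards [Lp.coeFn_smul c f] with x hx
    rw [hx, Pi.smul_apply, smul_eq_mul, mul_assoc]

lemma SquareDomain.enorm_truncPairing_le {f : Lp ℂ 1 μ} (hf : T.SquareDomain 1 f)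
    (hA : T.IsAdmissibleAlgebra A) (hG : T.Gam2Nonneg A) (g : Lp ℂ 2 μ) (n : ℕ) :
    ‖truncPairing g n f‖ₑ ≤ 6 * T.hardySNorm 1 f * T.bmoNorm g :=
  (hf.enorm_integral_retract_le hA hG g (by positivity)).trans (hf.mul_rpow_le hA hG g)

/-- On the span, finiteness of the H_1^S norm is not at hand. The ultrafilter limit needs only some
bound for each f, and such bounds survive linear combinations. -/
lemma exists_norm_truncPairing_le (hA : T.IsAdmissibleAlgebra A) (hG : T.Gam2Nonneg A)
    {g : Lp ℂ 2 μ} (hg : T.bmoNorm g < ∞) {f : Lp ℂ 1 μ} (hf : f ∈ T.hardyS) :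
    ∃ C, ∀ n, ‖truncPairing g n f‖ ≤ C := by
  induction hf using Submodule.span_induction with
  | mem x hx =>
    refine ⟨(6 * T.hardySNorm 1 x * T.bmoNorm g).toReal, fun n => ?_⟩
    have h := hx.1.enorm_truncPairing_le hA hG g n
    rw [← ofReal_norm] at h
    have h1 := hx.2.ne
    have h2 := hg.ne
    exact (ENNReal.ofReal_le_iff_le_toReal (by finiteness)).1 h
  | zero => exact ⟨0, fun n => by simp⟩
  | add x y _ _ hx hy =>
    obtain ⟨C, hC⟩ := hx
    obtain ⟨D, hD⟩ := hy
    refine ⟨C + D, fun n => ?_⟩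
    rw [map_add]
    exact (norm_add_le _ _).trans (add_le_add (hC n) (hD n))
  | smul c x _ hx =>
    obtain ⟨C, hC⟩ := hx
    refine ⟨‖c‖ * C, fun n => ?_⟩
    rw [map_smul, norm_smul]
    exact mul_le_mul_of_nonneg_left (hC n) (norm_nonneg _)

/-- A pointwise bounded sequence of linear functionals has a limit along a free ultrafilter. -/
lemma exists_linearMap_tendsto_hyperfilter {E : Type*} [AddCommGroup E] [Module ℂ E]
    (L : ℕ → E →ₗ[ℂ] ℂ) (hL : ∀ x, ∃ C, ∀ n, ‖L n x‖ ≤ C) :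
    ∃ l : E →ₗ[ℂ] ℂ, ∀ x, Tendsto (fun n => L n x) (hyperfilter ℕ : Filter ℕ) (𝓝 (l x)) := by
  have h : ∀ x, ∃ y, Tendsto (fun n => L n x) (hyperfilter ℕ : Filter ℕ) (𝓝 y) := by
    intro x
    obtain ⟨C, hC⟩ := hL x
    obtain ⟨y, -, hy⟩ := (isCompact_closedBall (0 : ℂ) C).ultrafilter_le_nhds
      ((hyperfilter ℕ).map fun n => L n x)
      (by
        rw [le_principal_iff]
        exact Filter.mem_map.2 (Eventually.of_forall fun n => mem_closedBall_zero_iff.2 (hC n)))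
    exact ⟨y, hy⟩
  choose l hl using h
  refine ⟨{ toFun := l, map_add' := fun x y => ?_, map_smul' := fun c x => ?_ }, hl⟩
  · refine tendsto_nhds_unique (hl (x + y)) (((hl x).add (hl y)).congr fun n => ?_)
    rw [map_add]
  · refine tendsto_nhds_unique (hl (c • x)) (((hl x).const_smul c).congr fun n => ?_)
    rw [map_smul]

/-- The truncated pairings may fail to converge when fg is not integrable. A limit along a free
ultrafilter always exists, is linear, keeps the uniform bound, and agrees with dominated convergence
when fg is integrable. -/
lemma exists_functional (hA : T.IsAdmissibleAlgebra A) (hG : T.Gam2Nonneg A)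
    {g : Lp ℂ 2 μ} (hg : T.bmoNorm g < ∞) :
    ∃ l : T.hardyS →ₗ[ℂ] ℂ,
      (∀ f : T.hardyS, Integrable (fun x => (f : Lp ℂ 1 μ) x * g x) μ →
        l f = ∫ x, (f : Lp ℂ 1 μ) x * g x ∂μ) ∧
      ∀ f : T.hardyS, ‖l f‖ₑ ≤ 6 * T.hardySNorm 1 (f : Lp ℂ 1 μ) * T.bmoNorm g := by
  obtain ⟨l, hl⟩ := exists_linearMap_tendsto_hyperfilter
    (fun n => (truncPairing g n).comp T.hardyS.subtype)
    fun f => exists_norm_truncPairing_le hA hG hg f.2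
  refine ⟨l, fun f hf => ?_, fun f => ?_⟩
  · exact tendsto_nhds_unique (hl f)
      ((tendsto_integral_mul_retract hf).mono_left Nat.hyperfilter_le_atTop)
  · exact le_of_tendsto (hl f).enorm (Eventually.of_forall fun n =>
      (squareDomain_of_mem_hardyS f.2).enorm_truncPairing_le hA hG g n)

end StandardSemigroup

end

theorem theorem0p1 :
    ∃ c₁ c₂ : ℝ≥0, ∀ (M : Type*) [MeasurableSpace M] (μ : Measure M) [SigmaFinite μ]
      (T : StandardSemigroup μ) (A : Submodule ℂ (Lp ℂ ∞ μ)),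
      T.IsAdmissibleAlgebra A → T.Gam2Nonneg A →
      (∀ (p : ℝ≥0∞) [Fact (1 ≤ p)], (p = 1 ∨ p = 2) →
        ∀ (f : Lp ℂ p μ) (g : Lp ℂ 2 μ), T.SquareDomain p f →
          Integrable (fun x => f x * g x) μ →
          ‖∫ x, f x * g x ∂μ‖ₑ ≤
              c₁ * T.hardySNorm p f ^ (1 / 2 : ℝ) * T.hardyGNorm p f ^ (1 / 2 : ℝ) * T.bmoNorm g ∧
            c₁ * T.hardySNorm p f ^ (1 / 2 : ℝ) * T.hardyGNorm p f ^ (1 / 2 : ℝ) * T.bmoNorm g ≤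
              c₂ * T.hardySNorm p f * T.bmoNorm g) ∧
      (∀ g : Lp ℂ 2 μ, T.bmoNorm g < ∞ →
        ∃ l : T.hardyS →ₗ[ℂ] ℂ,
          (∀ f : T.hardyS, Integrable (fun x => (f : Lp ℂ 1 μ) x * g x) μ →
            l f = ∫ x, (f : Lp ℂ 1 μ) x * g x ∂μ) ∧
          ∀ f : T.hardyS, ‖l f‖ₑ ≤ c₂ * T.hardySNorm 1 (f : Lp ℂ 1 μ) * T.bmoNorm g) := by
  refine ⟨3, 6, fun M _ μ _ T A hA hG => ⟨fun p hp1 hp f g hf hfg => ⟨?_, ?_⟩, fun g hg => ?_⟩⟩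
  · rcases hp with rfl | rfl
    · exact hf.enorm_integral_one_le hA hG g hfg
    · exact hf.enorm_integral_two_le hA hG g
  · exact hf.mul_rpow_le hA hG g
  · exact StandardSemigroup.exists_functional hA hG hg
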